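/- **Notation.** Let $n\ge 2$, let $\boldsymbol\mu\in\mathbb R^n$, and let $\Sigma\in\mathbb R^{n\times n}$ be a covariance (symmetric positive semidefinite) matrix. For a matrix $M$ put $\langle x,y\rangle_M=xMy'$ and $\|x\|_M^2=\langle x,x\rangle_M$. For $u\in[0,\infty)^n$ let $u\diamond\mu=(u_k\mu_k)_k$ and $u\diamond\Sigma=((u_k\wedge u_l)\Sigma_{kl})_{k,l}$. When $|\Sigma|=\det\Sigma\ne0$, set, for $x\in\mathbb R^n\setminus\{0\}$ and $u\in(0,\infty)^n$, $$\mathfrak A(x,u)=\big\{(2\|u\|^2+\|u\diamond\mu\|^2_{(u\diamond\Sigma)^{-1}})\,\|x\|^2_{(u\diamond\Sigma)^{-1}}\big\}^{1/2},\quad \mathfrak D(x,u)=\|x\|^n_{(u\diamond\Sigma)^{-1}}|u\diamond\Sigma|^{1/2},\quad \mathfrak E(x,u)=\langle x,u\diamond\mu\rangle_{(u\diamond\Sigma)^{-1}}.$$ Let $K_\rho$ be the modified Bessel function of the second kind, $\mathfrak K_\rho(w)=w^\rho K_\rho(w)$ (principal branch), $\mathrm{dom}_{\mathfrak K}=\{w\in\mathbb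 C:\Re w>0,\ \Re w^2>0\}$, and $c_n=2/(2\pi)^{n/2}$. A Thorin measure is a Borel measure $\mathcal U$ on $[0,\infty)^n\setminus\{0\}$ with $\int (1+\ln^-\|u\|)\wedge(1/\|u\|)\,\mathcal U(du)<\infty$. For $y\in\mathbb R^n\setminus\{0\}$ put $$\mathfrak H_y(w)=c_n\int_{(0,\infty)^n}e^{w\mathfrak E(y,u)}\,\mathfrak K_{n/2}\{w\mathfrak A(y,u)\}\,\frac{\mathcal U(du)}{\mathfrak D(y,u)}.$$ A subordinator $T\sim S^n(d,\mathcal T)$ is a Lévy process with nondecreasing components, drift $d\in[0,\infty)^n$ and Lévy measure $\mathcal T$ concentrated on $[0,\infty)^n\setminus\{0\}$. It is a Thorin subordinator, $T\sim GGC^n_S(d,\mathcal U)$, if $-\ln\mathbb E e^{-\langle\lambda,T(t)\rangle}=t\langle d,\lambda\rangle+t\int\ln\{(\|u\|^2+\langle\lambda,u\rangle)/\|u\|^2\}\,\mathcal U(du)$ for all $t\ge0$ and $\lambda\in[0,\infty)^n$. Let $B$ be Brownian motion on $\mathbb R^n$ with drift $\mu$ and covariance matrix $\Sigma$, and for $t\in[0,\infty)^n$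 write $B(t)=(B_1(t_1),\dots,B_n(t_n))$. The weak subordination $B\odot T$ of $B$ by $T\sim S^n(d,\mathcal T)$ is the Lévy process (in law) with Lévy measure $\mathcal X(dx)=\int\mathbb P(B(t)\in dx)\,\mathcal T(dt)$ on $\mathbb R^n\setminus\{0\}$, Gaussian covariance matrix $d\diamond\Sigma$ and, for the truncation function $\mathbf 1_{\{\|x\|\le1\}}$, location vector $d\diamond\mu+\int\mathbb E[B(t)\mathbf 1_{\{\|B(t)\|\le1\}}]\,\mathcal T(dt)$. A Lévy process $X$ is a $WVGG^n(d,\mu,\Sigma,\mathcal U)$ process if it is equal in law to $B\odot T$ for some $T\sim GGC_S^n(d,\mathcal U)$. **Theorem.** Let $n\ge2$, let $X\sim WVGG^n(d,\mu,\Sigma,\mathcal U)$ have Lévy measure $\mathcal X$, and let $|\Sigma|\ne0$. Let $z\in\mathbb R^n$ have only nonzero coordinates. (i) The integral defining $\mathfrak H_z(w)$ converges absolutely for $w\in\mathrm{dom}_{\mathfrak K}$, the function $\mathfrak H_z$ is holomorphic on $\mathrm{dom}_{\mathfrak K}$, $\mathfrak H_z((0,\infty))\subseteq[0,\infty)$,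 and for $w\in\mathrm{dom}_{\mathfrak K}$ $$\partial_w\mathfrak H_z(w)=c_n\!\int_{(0,\infty)^n}\!\!\mathfrak E(z,u)e^{w\mathfrak E(z,u)}\mathfrak K_{n/2}\{w\mathfrak A(z,u)\}\frac{\mathcal U(du)}{\mathfrak D(z,u)}-c_nw\!\int_{(0,\infty)^n}\!\!\mathfrak A^2(z,u)e^{w\mathfrak E(z,u)}\mathfrak K_{(n-2)/2}\{w\mathfrak A(z,u)\}\frac{\mathcal U(du)}{\mathfrak D(z,u)},$$ both integrals being absolutely convergent. (ii) If $\int_{(0,\infty)^n}\mathfrak A(z,u)\,\mathcal U(du)/\mathfrak D(z,u)<\infty$, then $\int_{(0,\infty)^n}|\mathfrak E(z,u)|\,\mathcal U(du)/\mathfrak D(z,u)<\infty$, and the right-hand limit at $0$ of the derivative of $r\mapsto\mathfrak H_z(r)$ exists and equals $$\partial_r\mathfrak H_z(0+)=\lim_{r\searrow0}\partial_r\mathfrak H_z(r)=c_n2^{(n-2)/2}\Gamma(n/2)\int_{(0,\infty)^n}\mathfrak E(z,u)\frac{\mathcal U(du)}{\mathfrak D(z,u)}.$$ (iii) For every Borel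 set $A\subseteq\{x\in\mathbb R^n:x_k\neq0\text{ for all }k\}$, $$\mathcal X(A)=\int_{\{s:\|s\|=1,\ s_k\ne0\ \forall k\}}\int_0^\infty\mathbf 1_A(rs)\,\mathfrak H_s(r)\,\frac{dr}{r}\,ds,$$ where $ds$ is the Lebesgue surface measure on the Euclidean unit sphere. -/

import Mathlib

open MeasureTheory ProbabilityTheory Filter Topology Set
open scoped NNReal ENNReal

namespace WVGG

noncomputable section

/-! ### The modified Bessel function of the second kind -/

/-- The modified Bessel function `K_ρ(w) = ∫₀^∞ exp(-w cosh t) cosh(ρ t) dt`, for `0 < re w`. -/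
def besselK (ρ : ℝ) (w : ℂ) : ℂ :=
  ∫ t in Ioi (0 : ℝ), Complex.exp (-w * (Real.cosh t : ℂ)) * (Real.cosh (ρ * t) : ℂ)

/-- `𝔎_ρ(w) = w ^ ρ * K_ρ(w)`, with the principal branch of the power. -/
def scaledBesselK (ρ : ℝ) (w : ℂ) : ℂ := w ^ (ρ : ℂ) * besselK ρ w

/-- The domain of `𝔎_ρ`: the complex `w` such that `w` and `w ^ 2` have positive real part. -/
def besselDomain : Set ℂ := {w | 0 < w.re ∧ 0 < (w ^ 2).re}

/-! ### Vectors and matrices -/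

/-- The open orthant `(0, ∞)ⁿ`. -/
def posOrthant (n : ℕ) : Set (EuclideanSpace ℝ (Fin n)) := {u | ∀ k, 0 < u k}

/-- The closed orthant `[0, ∞)ⁿ`. -/
def nonnegOrthant (n : ℕ) : Set (EuclideanSpace ℝ (Fin n)) := {u | ∀ k, 0 ≤ u k}

/-- The set of vectors all of whose coordinates are nonzero. -/
def nonzeroCoords (n : ℕ) : Set (EuclideanSpace ℝ (Fin n)) := {x | ∀ k, x k ≠ 0}

variable {n : ℕ}

/-- `⟨x, y⟩_M = x M yᵀ`. -/
def matInner (M : Matrix (Fin n) (Fin n) ℝ) (x y : EuclideanSpace ℝ (Fin n)) : ℝ :=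
  ∑ k, ∑ l, x k * M k l * y l

/-- `‖x‖_M = ⟨x, x⟩_M ^ (1 / 2)`. -/
def matNorm (M : Matrix (Fin n) (Fin n) ℝ) (x : EuclideanSpace ℝ (Fin n)) : ℝ :=
  Real.sqrt (matInner M x x)

/-- `u ⋄ μ`, with coordinates `u k * μ k`. -/
def vecDiamond (u μ : EuclideanSpace ℝ (Fin n)) : EuclideanSpace ℝ (Fin n) :=
  WithLp.toLp 2 fun k => u k * μ k

/-- `u ⋄ S`, with entries `min (u k) (u l) * S k l`. -/
def matDiamond (u : EuclideanSpace ℝ (Fin n)) (S : Matrix (Fin n) (Fin n) ℝ) :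
    Matrix (Fin n) (Fin n) ℝ :=
  Matrix.of fun k l => min (u k) (u l) * S k l

/-- `𝔄(x, u) = {(2 ‖u‖² + ‖u ⋄ μ‖²_{(u ⋄ S)⁻¹}) ‖x‖²_{(u ⋄ S)⁻¹}} ^ (1 / 2)`. -/
def fA (μ : EuclideanSpace ℝ (Fin n)) (S : Matrix (Fin n) (Fin n) ℝ)
    (x u : EuclideanSpace ℝ (Fin n)) : ℝ :=
  Real.sqrt ((2 * ‖u‖ ^ 2 + matNorm (matDiamond u S)⁻¹ (vecDiamond u μ) ^ 2)
    * matNorm (matDiamond u S)⁻¹ x ^ 2)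

/-- `𝔇(x, u) = ‖x‖ⁿ_{(u ⋄ S)⁻¹} |u ⋄ S| ^ (1 / 2)`. -/
def fD (S : Matrix (Fin n) (Fin n) ℝ) (x u : EuclideanSpace ℝ (Fin n)) : ℝ :=
  matNorm (matDiamond u S)⁻¹ x ^ n * Real.sqrt (matDiamond u S).det

/-- `𝔈(x, u) = ⟨x, u ⋄ μ⟩_{(u ⋄ S)⁻¹}`. -/
def fE (μ : EuclideanSpace ℝ (Fin n)) (S : Matrix (Fin n) (Fin n) ℝ)
    (x u : EuclideanSpace ℝ (Fin n)) : ℝ :=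
  matInner (matDiamond u S)⁻¹ x (vecDiamond u μ)

/-- `c_n = 2 / (2 π) ^ (n / 2)`. -/
def cConst (n : ℕ) : ℝ := 2 / (2 * Real.pi) ^ ((n : ℝ) / 2)

/-- `exp(w 𝔈(y, u)) 𝔎_ρ(w 𝔄(y, u)) / 𝔇(y, u)`. -/
def besselTerm (ρ : ℝ) (μ : EuclideanSpace ℝ (Fin n)) (S : Matrix (Fin n) (Fin n) ℝ)
    (y : EuclideanSpace ℝ (Fin n)) (w : ℂ) (u : EuclideanSpace ℝ (Fin n)) : ℂ :=
  Complex.exp (w * (fE μ S y u : ℂ)) * scaledBesselK ρ (w * (fA μ S y u : ℂ)) / (fD S y u : ℂ)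

/-- `ℌ_y(w) = c_n ∫_{(0, ∞)ⁿ} exp(w 𝔈(y, u)) 𝔎_{n/2}(w 𝔄(y, u)) U(du) / 𝔇(y, u)`. -/
def fH (μ : EuclideanSpace ℝ (Fin n)) (S : Matrix (Fin n) (Fin n) ℝ)
    (U : Measure (EuclideanSpace ℝ (Fin n))) (y : EuclideanSpace ℝ (Fin n)) (w : ℂ) : ℂ :=
  (cConst n : ℂ) * ∫ u in posOrthant n, besselTerm ((n : ℝ) / 2) μ S y w u ∂U

/-! ### Lévy processes

Measures on `ℝⁿ \ {0}` are represented by measures on `ℝⁿ` that do not charge the origin. -/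

/-- A Lévy measure. -/
structure IsLevyMeasure (ν : Measure (EuclideanSpace ℝ (Fin n))) : Prop where
  zero : ν {0} = 0
  finite : ∫⁻ x, ENNReal.ofReal (min 1 (‖x‖ ^ 2)) ∂ν < ∞

/-- The Lévy-Khintchine exponent of the triplet `(b, Q, ν)`. -/
def levyExponent (b : EuclideanSpace ℝ (Fin n)) (Q : Matrix (Fin n) (Fin n) ℝ)
    (ν : Measure (EuclideanSpace ℝ (Fin n))) (θ : EuclideanSpace ℝ (Fin n)) : ℂ :=
  Complex.I * (inner ℝ b θ : ℝ) - (1 / 2 : ℂ) * (matInner Q θ θ : ℝ)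
    + ∫ x, (Complex.exp (Complex.I * (inner ℝ θ x : ℝ)) - 1
        - Complex.I * (inner ℝ θ x : ℝ)
          * (Metric.closedBall (0 : EuclideanSpace ℝ (Fin n)) 1).indicator (fun _ => (1 : ℂ)) x) ∂ν

/-- `X` is an `n`-dimensional Lévy process on the probability space `(Ω, P)`: it starts at the
origin, has independent and stationary increments, and almost all its paths are right-continuous
with left limits. -/
structure IsLevyProcess {Ω : Type*} [MeasurableSpace Ω] (P : Measure Ω)
    (X : ℝ≥0 → Ω → EuclideanSpace ℝ (Fin n)) : Prop where
  isProbabilityMeasure : IsProbabilityMeasure P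
  measurable : ∀ t, Measurable (X t)
  start : ∀ᵐ ω ∂P, X 0 ω = 0
  indep : HasIndepIncrements X P
  stationary : ∀ s t, P.map (fun ω => X (s + t) ω - X s ω) = P.map (X t)
  cadlag : ∀ᵐ ω ∂P, ∀ t : ℝ≥0, ContinuousWithinAt (fun s => X s ω) (Ici t) t ∧
    ∃ l, Tendsto (fun s => X s ω) (𝓝[<] t) (𝓝 l)

/-- `X ∼ Lⁿ(b, Q, ν)`: `X` is a Lévy process with canonical triplet `(b, Q, ν)`. -/
structure HasTriplet {Ω : Type*} [MeasurableSpace Ω] (P : Measure Ω)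
    (X : ℝ≥0 → Ω → EuclideanSpace ℝ (Fin n)) (b : EuclideanSpace ℝ (Fin n))
    (Q : Matrix (Fin n) (Fin n) ℝ) (ν : Measure (EuclideanSpace ℝ (Fin n))) : Prop where
  isLevyProcess : IsLevyProcess P X
  posSemidef : Q.PosSemidef
  isLevyMeasure : IsLevyMeasure ν
  charFun_eq : ∀ (t : ℝ≥0) (θ : EuclideanSpace ℝ (Fin n)),
    charFun (P.map (X t)) θ = Complex.exp ((t : ℝ) * levyExponent b Q ν θ)

/-- `ν` is the Lévy measure of the Lévy process `X`. -/
def IsLevyMeasureOf {Ω : Type*} [MeasurableSpace Ω] (P : Measure Ω)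
    (X : ℝ≥0 → Ω → EuclideanSpace ℝ (Fin n)) (ν : Measure (EuclideanSpace ℝ (Fin n))) : Prop :=
  ∃ b Q, HasTriplet P X b Q ν

/-- `B ∼ BMⁿ(μ, S)`: Brownian motion with drift `μ` and covariance matrix `S`. -/
def IsBrownianMotion {Ω : Type*} [MeasurableSpace Ω] (P : Measure Ω)
    (B : ℝ≥0 → Ω → EuclideanSpace ℝ (Fin n)) (μ : EuclideanSpace ℝ (Fin n))
    (S : Matrix (Fin n) (Fin n) ℝ) : Prop :=
  HasTriplet P B μ S 0

/-- `T ∼ Sⁿ(d, τ)`: a subordinator with drift `d` and Lévy measure `τ`, that is a Lévy process with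
nondecreasing components; its Lévy measure integrates `‖x‖` near the origin, its Gaussian part
vanishes and its drift is the first entry of the triplet minus `∫_{‖x‖ ≤ 1} x τ(dx)`. -/
structure IsSubordinator {Ω : Type*} [MeasurableSpace Ω] (P : Measure Ω)
    (T : ℝ≥0 → Ω → EuclideanSpace ℝ (Fin n)) (d : EuclideanSpace ℝ (Fin n))
    (τ : Measure (EuclideanSpace ℝ (Fin n))) : Prop where
  mono : ∀ᵐ ω ∂P, ∀ s t : ℝ≥0, s ≤ t → ∀ k, T s ω k ≤ T t ω k
  drift_nonneg : d ∈ nonnegOrthant n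
  support : τ (nonnegOrthant n)ᶜ = 0
  integrable : IntegrableOn (fun x => x) (Metric.closedBall 0 1) τ
  triplet : HasTriplet P T (d + ∫ x in Metric.closedBall 0 1, x ∂τ) 0 τ

/-- A Thorin measure on `[0, ∞)ⁿ \ {0}`. -/
structure IsThorinMeasure (U : Measure (EuclideanSpace ℝ (Fin n))) : Prop where
  zero : U {0} = 0
  support : U (nonnegOrthant n)ᶜ = 0
  finite : ∫⁻ u, ENNReal.ofReal (min (1 + max (-Real.log ‖u‖) 0) (1 / ‖u‖)) ∂U < ∞

/-- `T ∼ GGC_Sⁿ(d, U)`: a Thorin subordinator with drift `d` and Thorin measure `U`, through its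
Laplace exponent. -/
structure IsThorinSubordinator {Ω : Type*} [MeasurableSpace Ω] (P : Measure Ω)
    (T : ℝ≥0 → Ω → EuclideanSpace ℝ (Fin n)) (d : EuclideanSpace ℝ (Fin n))
    (U : Measure (EuclideanSpace ℝ (Fin n))) : Prop where
  isSubordinator : ∃ d' τ, IsSubordinator P T d' τ
  drift_nonneg : d ∈ nonnegOrthant n
  isThorinMeasure : IsThorinMeasure U
  laplace : ∀ (t : ℝ≥0), ∀ l ∈ nonnegOrthant n,
    -Real.log (∫ ω, Real.exp (-inner ℝ l (T t ω)) ∂P)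
      = t * inner ℝ d l + t * ∫ u, Real.log ((‖u‖ ^ 2 + inner ℝ l u) / ‖u‖ ^ 2) ∂U

/-- `B(t) = (B₁(t₁), …, Bₙ(tₙ))` for a vector `t ∈ [0, ∞)ⁿ` of times. -/
def atTimes {Ω : Type*} (B : ℝ≥0 → Ω → EuclideanSpace ℝ (Fin n))
    (t : EuclideanSpace ℝ (Fin n)) (ω : Ω) : EuclideanSpace ℝ (Fin n) :=
  WithLp.toLp 2 fun k => B (t k).toNNReal ω k

/-- `X` is equal in law to `B ⊙ T`, the weak subordination of the Brownian motion
`B ∼ BMⁿ(μ, S)` by the subordinator `T`. If `T ∼ Sⁿ(d, τ)`, the Lévy measure is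
`ν(dx) = ∫ ℙ(B(t) ∈ dx) τ(dt)`, the Gaussian part is `d ⋄ S` and the first entry of the triplet is
`d ⋄ μ + ∫_{‖x‖ ≤ 1} x ν(dx)`, where the integral is the iterated one; in this order it converges
absolutely even if `∫_{‖x‖ ≤ 1} ‖x‖ ν(dx)` is infinite. -/
def IsWeakSubordination {Ω Ω₁ Ω₂ : Type*} [MeasurableSpace Ω] [MeasurableSpace Ω₁]
    [MeasurableSpace Ω₂] (P : Measure Ω) (X : ℝ≥0 → Ω → EuclideanSpace ℝ (Fin n))
    (P₁ : Measure Ω₁) (B : ℝ≥0 → Ω₁ → EuclideanSpace ℝ (Fin n)) (μ : EuclideanSpace ℝ (Fin n))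
    (S : Matrix (Fin n) (Fin n) ℝ)
    (P₂ : Measure Ω₂) (T : ℝ≥0 → Ω₂ → EuclideanSpace ℝ (Fin n)) : Prop :=
  IsBrownianMotion P₁ B μ S ∧ ∃ d τ ν, IsSubordinator P₂ T d τ ∧
    (∀ A : Set (EuclideanSpace ℝ (Fin n)), MeasurableSet A → 0 ∉ A →
      ν A = ∫⁻ t, (P₁.map (atTimes B t)) A ∂τ) ∧
    HasTriplet P X
      (vecDiamond d μ + ∫ t, (∫ x in Metric.closedBall 0 1, x ∂(P₁.map (atTimes B t))) ∂τ)
      (matDiamond d S) ν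

/-- `X ∼ WVGGⁿ(d, μ, S, U)`: a weak variance generalised gamma convolution process, that is a
process equal in law to `B ⊙ T` for `B ∼ BMⁿ(μ, S)` and `T ∼ GGC_Sⁿ(d, U)`. -/
def IsWVGG {Ω : Type*} [MeasurableSpace Ω] (P : Measure Ω)
    (X : ℝ≥0 → Ω → EuclideanSpace ℝ (Fin n)) (d μ : EuclideanSpace ℝ (Fin n))
    (S : Matrix (Fin n) (Fin n) ℝ) (U : Measure (EuclideanSpace ℝ (Fin n))) : Prop :=
  ∃ (Ω₁ : Type) (_ : MeasurableSpace Ω₁) (P₁ : Measure Ω₁)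
    (B : ℝ≥0 → Ω₁ → EuclideanSpace ℝ (Fin n))
    (Ω₂ : Type) (_ : MeasurableSpace Ω₂) (P₂ : Measure Ω₂)
    (T : ℝ≥0 → Ω₂ → EuclideanSpace ℝ (Fin n)),
    IsThorinSubordinator P₂ T d U ∧ IsWeakSubordination P X P₁ B μ S P₂ T

end

end WVGG

/-!
# The Lévy measure of a weak variance generalised gamma convolution

**The function `ℌ`.** On `besselDomain` the function `𝔎_ρ` equals the Gamma-type integral
`2 ^ (ρ - 1) ∫₀^∞ s ^ (ρ - 1) exp (-s - w² / (4 s)) ds` (`scaledBesselK_eq_cBessel`; both sides are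
holomorphic, and a substitution compares them on the positive axis). The integral depends on `w²`
only, its modulus is bounded by its value at `√(re w²)`, and differentiation gives
`𝔎_ρ' (w) = -w 𝔎_{ρ-1} (w)`. Since `S` is positive definite, `u ⋄ S` is bounded below by a multiple
of `diag u`, so that for `z` with nonzero coordinates `|𝔈(z, u)|` is bounded, `𝔇(z, u)` is bounded
away from `0`, and `𝔄(z, u)² ≥ c ‖u‖` (`exists_abs_fE_le`, `exists_le_fD`,
`exists_mul_norm_le_fA_sq`). Decay of `𝔎_ρ` then dominates every integrand by a multiple of
`min 1 (1 / ‖u‖)`, which a Thorin measure integrates. This yields absolute convergence and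
differentiation under the integral (`hasDerivAt_fH`). The limit at the origin is
dominated convergence with majorant `𝔄 / 𝔇`, because `|𝔈| ≤ 𝔄` by Cauchy-Schwarz and `w 𝔎_{ρ-1} (w)`
is bounded and tends to `0` at the origin (`tendsto_deriv_fH`).

**The Lévy measure.** The Lévy measure of `X` is determined by its characteristic exponent: the
second differences of the exponent are characteristic functions of finite measures
(`HasTriplet.levyMeasure_unique`). Hence it is `∫ ℙ(B(t) ∈ ·) τ(dt)`, where `τ` is the Lévy measure
of the subordinator. A Frullani integral identifies the Laplace exponent of a Thorin subordinator
with that of the image of `exp (-r ‖u‖²) / r dr U(du)` under `(u, r) ↦ r • u`. As Laplace exponents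
determine Lévy measures on the orthant, `τ` is this image (`levyMeasure_eq_thorinLevyMeasure`).
The law of `B(t)` is Gaussian with mean `t ⋄ μ` and covariance matrix `t ⋄ S`, by independence of
increments (`map_atTimes_eq_multivariateGaussian`); if some `t k` vanishes, it does not charge
vectors with nonzero coordinates. Integrating the Gaussian density at time `r • u` against
`exp (-r ‖u‖²) / r dr` produces the Bessel function of order `n / 2` in the definition of `ℌ`
(`lintegral_thorinDensity_mul_gaussDensity`). Finally `𝔈` and `𝔄` are homogeneous of degree `1` and
`𝔇` of degree `n` in the first variable, so that polar coordinates turn the Lévy density into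
`ℌ_s(r) dr / r ds` (`setLIntegral_levyDensity`).
-/

namespace WVGG

noncomputable section

variable {n : ℕ}

/-! ### A Gamma-type integral for the scaled Bessel function -/

/-- The integrand `s ^ (ρ - 1) * exp (-s - c / (4 s))` of the Gamma-type representation of
`𝔎_ρ` at an argument with square `c`. -/
def besselKernel (ρ c s : ℝ) : ℝ := s ^ (ρ - 1) * Real.exp (-s - c / (4 * s))

/-- The value `2 ^ (ρ - 1) ∫₀^∞ s ^ (ρ - 1) exp (-s - c / (4 s)) ds` of `𝔎_ρ` at `√c`. -/
def realBessel (ρ c : ℝ) : ℝ := 2 ^ (ρ - 1) * ∫ s in Ioi (0 : ℝ), besselKernel ρ c s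

/-- The complex version of `realBessel`, as a function of `w` with `w ^ 2 = c`. -/
def cBessel (ρ : ℝ) (w : ℂ) : ℂ :=
  (2 ^ (ρ - 1) : ℝ) * ∫ s in Ioi (0 : ℝ), ((s ^ (ρ - 1) : ℝ) : ℂ)
    * Complex.exp (-(s : ℂ) - w ^ 2 / (4 * s))

lemma exists_rpow_mul_exp_neg_le {p : ℝ} (hp : 0 ≤ p) :
    ∃ C, 0 < C ∧ ∀ x : ℝ, 0 ≤ x → x ^ p * Real.exp (-x) ≤ C := by
  refine ⟨(⌈p⌉₊).factorial * Real.exp 1, by positivity, fun x hx => ?_⟩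
  have h1 : x ^ p ≤ (1 + x) ^ ⌈p⌉₊ := by
    calc x ^ p ≤ (1 + x) ^ p := Real.rpow_le_rpow hx (by linarith) hp
      _ ≤ (1 + x) ^ ((⌈p⌉₊ : ℕ) : ℝ) :=
        Real.rpow_le_rpow_of_exponent_le (by linarith) (Nat.le_ceil p)
      _ = _ := Real.rpow_natCast _ _
  have h2 := Real.pow_div_factorial_le_exp (1 + x) (by linarith) ⌈p⌉₊
  rw [div_le_iff₀ (by positivity)] at h2
  rw [Real.exp_neg, ← div_eq_mul_inv, div_le_iff₀ (Real.exp_pos _)]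
  calc x ^ p ≤ Real.exp (1 + x) * (⌈p⌉₊).factorial := h1.trans h2
    _ = _ := by rw [Real.exp_add]; ring

lemma besselKernel_nonneg {ρ c s : ℝ} (hs : 0 < s) : 0 ≤ besselKernel ρ c s := by
  unfold besselKernel; positivity

lemma measurable_besselKernel (ρ c : ℝ) : Measurable (besselKernel ρ c) := by
  unfold besselKernel; fun_prop

/-- A power of `c` is absorbed by `exp (-c / (4 s))` at the price of the same power of `s`. -/
lemma exists_besselKernel_le (ρ : ℝ) {p : ℝ} (hp : 0 ≤ p) :
    ∃ C, 0 < C ∧ ∀ c s : ℝ, 0 ≤ c → 0 < s →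
      c ^ p * besselKernel ρ c s ≤ C * (Real.exp (-s) * s ^ (ρ + p - 1)) := by
  obtain ⟨C, hC, h⟩ := exists_rpow_mul_exp_neg_le hp
  refine ⟨C * 4 ^ p, by positivity, fun c s hc hs => ?_⟩
  have h1 := h (c / (4 * s)) (by positivity)
  rw [Real.div_rpow hc (by positivity), Real.mul_rpow (by norm_num) hs.le] at h1
  have hsp : 0 < s ^ p := Real.rpow_pos_of_pos hs p
  have h4 : (0 : ℝ) < 4 ^ p := by positivity
  have h2 : c ^ p * Real.exp (-(c / (4 * s))) ≤ C * (4 ^ p * s ^ p) := by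
    rw [div_mul_eq_mul_div, div_le_iff₀ (by positivity)] at h1
    exact h1
  have h3 : s ^ (ρ + p - 1) = s ^ (ρ - 1) * s ^ p := by
    rw [← Real.rpow_add hs]; congr 1; ring
  unfold besselKernel
  rw [sub_eq_add_neg (-s), Real.exp_add, h3]
  calc c ^ p * (s ^ (ρ - 1) * (Real.exp (-s) * Real.exp (-(c / (4 * s)))))
      = (c ^ p * Real.exp (-(c / (4 * s)))) * (s ^ (ρ - 1) * Real.exp (-s)) := by ring
    _ ≤ (C * (4 ^ p * s ^ p)) * (s ^ (ρ - 1) * Real.exp (-s)) := by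
        apply mul_le_mul_of_nonneg_right h2; positivity
    _ = _ := by ring

lemma integrableOn_besselKernel (ρ : ℝ) {c : ℝ} (hc : 0 < c) :
    IntegrableOn (besselKernel ρ c) (Ioi 0) := by
  obtain ⟨C, hC, h⟩ := exists_besselKernel_le ρ (p := |ρ| + 1) (by positivity)
  have hp : 0 < ρ + (|ρ| + 1) := by linarith [neg_abs_le ρ]
  refine Integrable.mono' ((Real.GammaIntegral_convergent hp).const_mul (C / c ^ (|ρ| + 1)))
    (measurable_besselKernel ρ c).aestronglyMeasurable ?_
  filter_upwards [ae_restrict_mem measurableSet_Ioi] with s hs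
  rw [Real.norm_of_nonneg (besselKernel_nonneg hs), div_mul_eq_mul_div, le_div_iff₀ (by positivity),
    mul_comm]
  exact h c s hc.le hs

lemma besselKernel_zero (ρ s : ℝ) : besselKernel ρ 0 s = Real.exp (-s) * s ^ (ρ - 1) := by
  simp [besselKernel, mul_comm]

lemma realBessel_nonneg (ρ c : ℝ) : 0 ≤ realBessel ρ c := by
  unfold realBessel
  have : 0 ≤ ∫ s in Ioi (0 : ℝ), besselKernel ρ c s :=
    setIntegral_nonneg measurableSet_Ioi fun s hs => besselKernel_nonneg hs
  positivity

/-- Decay of `𝔎_ρ` at infinity of every order `p`, uniformly up to the origin if `ρ + p > 0`. -/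
lemma exists_rpow_mul_realBessel_le {ρ p : ℝ} (hp : 0 ≤ p) (hρ : 0 < ρ + p) :
    ∃ C, 0 < C ∧ ∀ c : ℝ, 0 < c → c ^ p * realBessel ρ c ≤ C := by
  obtain ⟨C, hC, h⟩ := exists_besselKernel_le ρ hp
  have hint := (Real.GammaIntegral_convergent hρ).const_mul C
  have hnn : 0 ≤ ∫ s in Ioi (0 : ℝ), C * (Real.exp (-s) * s ^ (ρ + p - 1)) :=
    setIntegral_nonneg measurableSet_Ioi fun s (hs : 0 < s) => by positivity
  refine ⟨2 ^ (ρ - 1) * (∫ s in Ioi (0 : ℝ), C * (Real.exp (-s) * s ^ (ρ + p - 1))) + 1,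
    by positivity, fun c hc => ?_⟩
  have : ∫ s in Ioi (0 : ℝ), c ^ p * besselKernel ρ c s
      ≤ ∫ s in Ioi (0 : ℝ), C * (Real.exp (-s) * s ^ (ρ + p - 1)) :=
    setIntegral_mono_on ((integrableOn_besselKernel ρ hc).const_mul _) hint measurableSet_Ioi
      fun s hs => h c s hc.le hs
  rw [integral_const_mul] at this
  have h2 : (0 : ℝ) < 2 ^ (ρ - 1) := by positivity
  unfold realBessel
  nlinarith

lemma realBessel_anti (ρ : ℝ) {c c' : ℝ} (hc : 0 < c) (h : c ≤ c') :
    realBessel ρ c' ≤ realBessel ρ c := by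
  unfold realBessel
  refine mul_le_mul_of_nonneg_left ?_ (by positivity)
  refine setIntegral_mono_on (integrableOn_besselKernel ρ (hc.trans_le h))
    (integrableOn_besselKernel ρ hc) measurableSet_Ioi fun s (hs : 0 < s) => ?_
  unfold besselKernel
  gcongr

lemma tendsto_realBessel {ρ : ℝ} (hρ : 0 < ρ) :
    Tendsto (realBessel ρ) (𝓝[>] 0) (𝓝 (2 ^ (ρ - 1) * Real.Gamma ρ)) := by
  unfold realBessel
  refine Tendsto.const_mul _ ?_
  rw [Real.Gamma_eq_integral hρ]
  refine tendsto_integral_filter_of_dominated_convergence _ (.of_forall fun c =>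
    (measurable_besselKernel ρ c).aestronglyMeasurable) ?_ (Real.GammaIntegral_convergent hρ) ?_
  · filter_upwards [self_mem_nhdsWithin] with c (hc : 0 < c)
    filter_upwards [ae_restrict_mem measurableSet_Ioi] with s (hs : 0 < s)
    rw [Real.norm_of_nonneg (besselKernel_nonneg hs), ← besselKernel_zero]
    unfold besselKernel
    gcongr
  · filter_upwards [ae_restrict_mem measurableSet_Ioi] with s (hs : 0 < s)
    rw [← besselKernel_zero]
    refine Tendsto.mono_left (Continuous.tendsto ?_ 0) nhdsWithin_le_nhds
    unfold besselKernel
    fun_prop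

/-- `w 𝔎_ρ(w) → 0` at the origin. The case `ρ = 0`, in which `𝔎_ρ` has a logarithmic singularity,
is the one needed for `n = 2`. -/
lemma tendsto_sqrt_mul_realBessel {ρ : ℝ} (hρ : 0 ≤ ρ) :
    Tendsto (fun c => c ^ (1 / 2 : ℝ) * realBessel ρ c) (𝓝[>] 0) (𝓝 0) := by
  obtain ⟨C, hC, h⟩ := exists_besselKernel_le ρ (p := 1 / 2) (by norm_num)
  have key : Tendsto (fun c => ∫ s in Ioi (0 : ℝ), c ^ (1 / 2 : ℝ) * besselKernel ρ c s) (𝓝[>] 0)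
      (𝓝 (∫ s in Ioi (0 : ℝ), (0 : ℝ))) := by
    refine tendsto_integral_filter_of_dominated_convergence _ (.of_forall fun c =>
      ((measurable_besselKernel ρ c).const_mul _).aestronglyMeasurable) ?_
      ((Real.GammaIntegral_convergent (s := ρ + 1 / 2) (by linarith)).const_mul C) ?_
    · filter_upwards [self_mem_nhdsWithin] with c (hc : 0 < c)
      filter_upwards [ae_restrict_mem measurableSet_Ioi] with s (hs : 0 < s)
      have := besselKernel_nonneg (ρ := ρ) (c := c) hs
      rw [Real.norm_of_nonneg (by positivity)]
      exact h c s hc.le hs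
    · filter_upwards [ae_restrict_mem measurableSet_Ioi] with s (hs : 0 < s)
      refine Tendsto.mono_left ?_ nhdsWithin_le_nhds
      have hcont : Continuous fun c : ℝ => c ^ (1 / 2 : ℝ) * besselKernel ρ c s := by
        unfold besselKernel
        refine (Real.continuous_rpow_const (by norm_num)).mul ?_
        fun_prop
      exact hcont.tendsto' 0 0 (by simp)
  simp only [integral_const_mul, integral_zero] at key
  have := key.const_mul (2 ^ (ρ - 1) : ℝ)
  simp only [mul_zero] at this
  refine this.congr fun c => ?_
  unfold realBessel; ring

/-! ### Comparison with the modified Bessel function -/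

lemma besselDomain_eq : besselDomain = {w : ℂ | |w.im| < w.re} := by
  ext w
  simp only [besselDomain, mem_ofPred_eq, sq, Complex.mul_re, abs_lt]
  constructor
  · rintro ⟨h1, h2⟩; constructor <;> nlinarith
  · rintro ⟨h1, h2⟩; constructor <;> nlinarith

lemma isOpen_besselDomain : IsOpen besselDomain := by
  rw [besselDomain_eq]
  exact isOpen_lt (by fun_prop) (by fun_prop)

lemma convex_besselDomain : Convex ℝ besselDomain := by
  rw [besselDomain_eq]
  intro x hx y hy a b ha hb hab
  simp only [mem_ofPred_eq, abs_lt, Complex.add_re, Complex.add_im, Complex.real_smul,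
    Complex.re_ofReal_mul, Complex.im_ofReal_mul] at *
  obtain rfl | ha := ha.eq_or_lt
  · obtain rfl : b = 1 := by linarith
    simpa using hy
  · constructor <;> nlinarith

lemma ofReal_mem_besselDomain {r : ℝ} (hr : 0 < r) : (r : ℂ) ∈ besselDomain := by
  rw [besselDomain_eq]; simpa using hr

lemma mul_ofReal_mem_besselDomain {w : ℂ} (hw : w ∈ besselDomain) {r : ℝ} (hr : 0 < r) :
    w * (r : ℂ) ∈ besselDomain := by
  rw [besselDomain_eq] at *
  simp only [mem_ofPred_eq, Complex.mul_re, Complex.mul_im, Complex.ofReal_re, Complex.ofReal_im,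
    mul_zero, sub_zero, zero_add, abs_mul, abs_of_pos hr] at *
  nlinarith

lemma norm_cBessel_integrand (ρ : ℝ) (w : ℂ) {s : ℝ} (hs : 0 < s) :
    ‖((s ^ (ρ - 1) : ℝ) : ℂ) * Complex.exp (-(s : ℂ) - w ^ 2 / (4 * s))‖
      = besselKernel ρ (w ^ 2).re s := by
  have h : (-(s : ℂ) - w ^ 2 / (4 * s)).re = -s - (w ^ 2).re / (4 * s) := by
    rw [show (4 * (s : ℂ)) = ((4 * s : ℝ) : ℂ) by push_cast; ring, Complex.sub_re,
      Complex.div_ofReal_re]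
    simp
  rw [norm_mul, Complex.norm_exp, h, Complex.norm_real, Real.norm_of_nonneg (by positivity)]
  rfl

lemma measurable_cBessel_integrand (ρ : ℝ) : Measurable (fun p : ℂ × ℝ =>
    ((p.2 ^ (ρ - 1) : ℝ) : ℂ) * Complex.exp (-(p.2 : ℂ) - p.1 ^ 2 / (4 * p.2))) := by
  fun_prop

lemma measurable_cBessel (ρ : ℝ) : Measurable (cBessel ρ) := by
  unfold cBessel
  refine Measurable.const_mul ?_ _
  exact ((measurable_cBessel_integrand ρ).stronglyMeasurable.integral_prod_right
    (ν := volume.restrict (Ioi 0))).measurable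

lemma norm_cBessel_le (ρ : ℝ) (w : ℂ) : ‖cBessel ρ w‖ ≤ realBessel ρ (w ^ 2).re := by
  unfold cBessel realBessel
  rw [norm_mul, Complex.norm_real, Real.norm_of_nonneg (by positivity)]
  gcongr
  refine (norm_integral_le_integral_norm _).trans (le_of_eq ?_)
  exact setIntegral_congr_fun measurableSet_Ioi fun s hs => norm_cBessel_integrand ρ w hs

lemma cBessel_ofReal (ρ y : ℝ) : cBessel ρ y = realBessel ρ (y ^ 2) := by
  unfold cBessel realBessel besselKernel
  push_cast
  rw [← integral_complex_ofReal]
  push_cast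
  rfl

/-- `𝔎_ρ' (w) = -w 𝔎_{ρ - 1} (w)`, by differentiation under the integral; the integrand is dominated
locally uniformly by its value at a smaller positive `c`. -/
lemma hasDerivAt_cBessel (ρ : ℝ) {w : ℂ} (hw : 0 < (w ^ 2).re) :
    HasDerivAt (cBessel ρ) (-w * cBessel (ρ - 1) w) w := by
  set s : Set ℂ := {z | (w ^ 2).re / 2 < (z ^ 2).re ∧ ‖z‖ < ‖w‖ + 1} with hsdef
  have hs : s ∈ 𝓝 w := by
    have h1 : IsOpen {z : ℂ | (w ^ 2).re / 2 < (z ^ 2).re} := isOpen_lt (by fun_prop) (by fun_prop)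
    have h2 : IsOpen {z : ℂ | ‖z‖ < ‖w‖ + 1} := isOpen_lt (by fun_prop) (by fun_prop)
    exact (h1.inter h2).mem_nhds ⟨half_lt_self hw, lt_add_one ‖w‖⟩
  have hm (z : ℂ) (ρ : ℝ) : AEStronglyMeasurable (fun s : ℝ =>
      ((s ^ (ρ - 1) : ℝ) : ℂ) * Complex.exp (-(s : ℂ) - z ^ 2 / (4 * s)))
      (volume.restrict (Ioi 0)) :=
    ((measurable_cBessel_integrand ρ).comp (measurable_const.prodMk measurable_id :
      Measurable fun s : ℝ => (z, s))).aestronglyMeasurable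
  have key := hasDerivAt_integral_of_dominated_loc_of_deriv_le (μ := volume.restrict (Ioi 0))
    (F := fun (z : ℂ) (s : ℝ) => ((s ^ (ρ - 1) : ℝ) : ℂ)
      * Complex.exp (-(s : ℂ) - z ^ 2 / (4 * s)))
    (F' := fun (z : ℂ) (s : ℝ) => (-z / 2) * (((s ^ (ρ - 1 - 1) : ℝ) : ℂ)
      * Complex.exp (-(s : ℂ) - z ^ 2 / (4 * s))))
    (bound := fun s => (‖w‖ + 1) / 2 * besselKernel (ρ - 1) ((w ^ 2).re / 2) s)
    (x₀ := w) hs (.of_forall fun z => hm z ρ) ?_ ((hm w (ρ - 1)).const_mul _) ?_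
    ((integrableOn_besselKernel (ρ - 1) (by linarith)).const_mul _) ?_
  · have h := key.2.const_mul ((2 ^ (ρ - 1) : ℝ) : ℂ)
    convert! h using 1
    unfold cBessel
    rw [integral_const_mul, Real.rpow_sub_one (by norm_num) (ρ - 1)]
    push_cast
    ring
  · refine Integrable.mono' (integrableOn_besselKernel ρ hw) (hm w ρ) ?_
    filter_upwards [ae_restrict_mem measurableSet_Ioi] with t ht
    rw [norm_cBessel_integrand ρ w ht]
  · filter_upwards [ae_restrict_mem measurableSet_Ioi] with t (ht : 0 < t) z hz
    rw [norm_mul, norm_cBessel_integrand _ _ ht]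
    have h1 : ‖-z / 2‖ ≤ (‖w‖ + 1) / 2 := by
      rw [norm_div, norm_neg]; simp only [Complex.norm_ofNat]
      linarith [hz.2]
    have h2 : besselKernel (ρ - 1) (z ^ 2).re t ≤ besselKernel (ρ - 1) ((w ^ 2).re / 2) t := by
      unfold besselKernel
      gcongr
      exact hz.1.le
    exact mul_le_mul h1 h2 (besselKernel_nonneg ht) (by positivity)
  · filter_upwards [ae_restrict_mem measurableSet_Ioi] with t (ht : 0 < t) z _
    have h1 : HasDerivAt (fun z : ℂ => -(t : ℂ) - z ^ 2 / (4 * t)) (-(2 * z) / (4 * t)) z := by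
      have := ((hasDerivAt_pow 2 z).div_const (4 * (t : ℂ))).const_sub (-(t : ℂ))
      convert! this using 1
      simp; ring
    have h2 := (h1.cexp.const_mul ((t ^ (ρ - 1) : ℝ) : ℂ))
    convert! h2 using 1
    rw [Real.rpow_sub_one ht.ne' (ρ - 1)]
    have : (t : ℂ) ≠ 0 := by exact_mod_cast ht.ne'
    push_cast
    field_simp
    ring

/-- The substitution `s = (y / 2) * exp t` turns the Gamma-type integral into an integral over
the real line. -/
lemma integrable_exp_sub_cosh (ρ : ℝ) {y : ℝ} (hy : 0 < y) :
    Integrable (fun t => Real.exp (ρ * t - y * Real.cosh t)) ∧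
    ∫ s in Ioi (0 : ℝ), besselKernel ρ (y ^ 2) s
      = (y / 2) ^ ρ * ∫ t, Real.exp (ρ * t - y * Real.cosh t) := by
  have himg : (fun t => y / 2 * Real.exp t) '' univ = Ioi 0 := by
    ext x
    simp only [image_univ, mem_range, mem_Ioi]
    constructor
    · rintro ⟨t, rfl⟩; positivity
    · intro hx
      exact ⟨Real.log (x / (y / 2)), by rw [Real.exp_log (by positivity)]; field_simp⟩
  have hd : ∀ t ∈ univ,
      HasDerivWithinAt (fun t => y / 2 * Real.exp t) (y / 2 * Real.exp t) univ t :=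
    fun t _ => ((Real.hasDerivAt_exp t).const_mul _).hasDerivWithinAt
  have hmono : MonotoneOn (fun t => y / 2 * Real.exp t) univ := fun a _ b _ hab => by
    simp only; gcongr
  have hf : ∀ t, (y / 2 * Real.exp t) • besselKernel ρ (y ^ 2) (y / 2 * Real.exp t)
      = (y / 2) ^ ρ * Real.exp (ρ * t - y * Real.cosh t) := by
    intro t
    have hpos : 0 < y / 2 * Real.exp t := by positivity
    have h1 : y / 2 * Real.exp t * (y / 2 * Real.exp t) ^ (ρ - 1)
        = (y / 2) ^ ρ * Real.exp (ρ * t) := by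
      rw [Real.rpow_sub_one hpos.ne', Real.mul_rpow (by positivity) (Real.exp_pos _).le,
        ← Real.exp_mul, mul_comm t ρ]
      field_simp
    have h2 : -(y / 2 * Real.exp t) - y ^ 2 / (4 * (y / 2 * Real.exp t)) = - (y * Real.cosh t) := by
      rw [Real.cosh_eq, Real.exp_neg]; field_simp; ring
    rw [smul_eq_mul, besselKernel, ← mul_assoc, h1, h2, sub_eq_add_neg, Real.exp_add, mul_assoc]
  constructor
  · have h := (integrableOn_image_iff_integrableOn_deriv_smul_of_monotoneOn MeasurableSet.univ hd
      hmono (besselKernel ρ (y ^ 2))).1 (by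
        rw [himg]; exact integrableOn_besselKernel ρ (by positivity))
    simp only [hf, integrableOn_univ] at h
    refine (h.const_mul (((y / 2) ^ ρ)⁻¹)).congr (.of_forall fun t => ?_)
    have : (y / 2) ^ ρ ≠ 0 := (Real.rpow_pos_of_pos (by positivity) _).ne'
    simp [this]
  · have h := integral_image_eq_integral_deriv_smul_of_monotoneOn MeasurableSet.univ hd
      hmono (besselKernel ρ (y ^ 2))
    rw [himg] at h
    simp only [hf, setIntegral_univ, integral_const_mul] at h
    exact h

lemma integrable_cosh_mul_exp (ρ : ℝ) {y : ℝ} (hy : 0 < y) :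
    Integrable (fun t => Real.exp (-(y * Real.cosh t)) * Real.cosh (ρ * t)) := by
  have h1 := (integrable_exp_sub_cosh ρ hy).1
  have h2 := (integrable_exp_sub_cosh (-ρ) hy).1
  refine ((h1.add h2).div_const 2).congr (.of_forall fun t => ?_)
  simp only [Pi.add_apply, sub_eq_add_neg, Real.exp_add, Real.cosh_eq (ρ * t), neg_mul]
  ring

lemma scaledBesselK_ofReal (ρ : ℝ) {y : ℝ} (hy : 0 < y) :
    scaledBesselK ρ y = cBessel ρ y := by
  have hK : besselK ρ y
      = ((∫ t in Ioi (0 : ℝ), Real.exp (-(y * Real.cosh t)) * Real.cosh (ρ * t) : ℝ) : ℂ) := by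
    rw [besselK, ← integral_complex_ofReal]
    push_cast
    simp only [neg_mul]
  have hcosh := integrable_cosh_mul_exp ρ hy
  have hsplit : ∫ t, Real.exp (ρ * t - y * Real.cosh t)
      = 2 * ∫ t in Ioi (0 : ℝ), Real.exp (-(y * Real.cosh t)) * Real.cosh (ρ * t) := by
    have hsym : ∫ t, Real.exp (ρ * t - y * Real.cosh t)
        = ∫ t, Real.exp (-(y * Real.cosh t)) * Real.cosh (ρ * t) := by
      have h2 := integral_neg_eq_self (fun t => Real.exp (ρ * t - y * Real.cosh t)) volume
      have h3 : ∫ t, (Real.exp (ρ * t - y * Real.cosh t) + Real.exp (ρ * -t - y * Real.cosh (-t)))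
          = ∫ t, 2 * (Real.exp (-(y * Real.cosh t)) * Real.cosh (ρ * t)) := by
        congr 1; ext t
        simp only [sub_eq_add_neg, Real.exp_add, Real.cosh_eq (ρ * t), Real.cosh_neg, mul_neg]
        ring
      rw [integral_add (integrable_exp_sub_cosh ρ hy).1 (integrable_exp_sub_cosh ρ hy).1.comp_neg,
        h2, integral_const_mul] at h3
      linarith
    rw [hsym, ← integral_comp_abs (f := fun t => Real.exp (-(y * Real.cosh t)) * Real.cosh (ρ * t))]
    congr 1; ext t
    rw [Real.cosh_abs, ← Real.cosh_abs (ρ * |t|), abs_mul, abs_abs, ← abs_mul, Real.cosh_abs]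
  rw [cBessel_ofReal, realBessel, (integrable_exp_sub_cosh ρ hy).2, hsplit, scaledBesselK, hK,
    ← Complex.ofReal_cpow hy.le, ← Complex.ofReal_mul, Complex.ofReal_inj,
    Real.div_rpow hy.le (by norm_num), Real.rpow_sub_one (by norm_num)]
  field_simp

lemma differentiableAt_besselK (ρ : ℝ) {w : ℂ} (hw : 0 < w.re) :
    DifferentiableAt ℂ (besselK ρ) w := by
  have hs : {z : ℂ | w.re / 2 < z.re} ∈ 𝓝 w := by
    have h1 : IsOpen {z : ℂ | w.re / 2 < z.re} := isOpen_lt (by fun_prop) (by fun_prop)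
    exact h1.mem_nhds (half_lt_self hw)
  have hm (z : ℂ) : Measurable (fun t : ℝ =>
      Complex.exp (-z * (Real.cosh t : ℂ)) * (Real.cosh (ρ * t) : ℂ)) := by
    have h1 : Continuous fun t : ℝ => Real.cosh t := Real.continuous_cosh
    have h2 : Continuous fun t : ℝ => Real.cosh (ρ * t) := by fun_prop
    exact Continuous.measurable (by fun_prop)
  have hn (z : ℂ) (t : ℝ) : ‖Complex.exp (-z * (Real.cosh t : ℂ)) * (Real.cosh (ρ * t) : ℂ)‖
      = Real.exp (-(z.re * Real.cosh t)) * Real.cosh (ρ * t) := by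
    rw [norm_mul, Complex.norm_exp, Complex.norm_real, Real.norm_of_nonneg (Real.cosh_pos _).le,
      Complex.re_mul_ofReal]
    simp
  have hw2 : 0 < w.re / 2 := by linarith
  have hb : Integrable (fun t => Real.cosh t * (Real.exp (-(w.re / 2 * Real.cosh t))
      * Real.cosh (ρ * t))) := by
    have h1 := integrable_cosh_mul_exp (ρ + 1) hw2
    have h2 := integrable_cosh_mul_exp (ρ - 1) hw2
    refine ((h1.add h2).div_const 2).congr (.of_forall fun t => ?_)
    simp only [Pi.add_apply, add_mul, sub_mul, one_mul, Real.cosh_add, Real.cosh_sub]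
    ring
  have key := hasDerivAt_integral_of_dominated_loc_of_deriv_le (μ := volume.restrict (Ioi 0))
    (F := fun (z : ℂ) (t : ℝ) => Complex.exp (-z * (Real.cosh t : ℂ)) * (Real.cosh (ρ * t) : ℂ))
    (F' := fun (z : ℂ) (t : ℝ) => (-(Real.cosh t : ℂ)) *
      (Complex.exp (-z * (Real.cosh t : ℂ)) * (Real.cosh (ρ * t) : ℂ)))
    (bound := fun t => Real.cosh t * (Real.exp (-(w.re / 2 * Real.cosh t)) * Real.cosh (ρ * t)))
    (x₀ := w) hs (.of_forall fun z => (hm z).aestronglyMeasurable) ?_ ?_ ?_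
    hb.integrableOn ?_
  · exact key.2.differentiableAt
  · refine Integrable.mono' (integrable_cosh_mul_exp ρ hw).integrableOn (hm w).aestronglyMeasurable
      (.of_forall fun t => (hn w t).le)
  · refine Measurable.aestronglyMeasurable (Measurable.mul ?_ (hm w))
    have h1 : Continuous fun t : ℝ => Real.cosh t := Real.continuous_cosh
    exact Continuous.measurable (by fun_prop)
  · refine .of_forall fun t z hz => ?_
    rw [norm_mul, hn, norm_neg, Complex.norm_real, Real.norm_of_nonneg (Real.cosh_pos _).le]
    have := Real.cosh_pos t
    have h3 : w.re / 2 < z.re := hz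
    have h2 := Real.cosh_pos (ρ * t)
    gcongr
  · refine .of_forall fun t z _ => ?_
    have h1 : HasDerivAt (fun z : ℂ => -z * (Real.cosh t : ℂ)) (-(Real.cosh t : ℂ)) z := by
      simpa using (hasDerivAt_id z).neg.mul_const (Real.cosh t : ℂ)
    convert! h1.cexp.mul_const (Real.cosh (ρ * t) : ℂ) using 1
    ring

/-- Both sides are holomorphic, so it is enough to compare them on the positive real axis. -/
lemma scaledBesselK_eq_cBessel (ρ : ℝ) {w : ℂ} (hw : w ∈ besselDomain) :
    scaledBesselK ρ w = cBessel ρ w := by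
  have h1 : DifferentiableOn ℂ (scaledBesselK ρ) besselDomain := fun z hz => by
    refine DifferentiableAt.differentiableWithinAt ?_
    unfold scaledBesselK
    exact (differentiableAt_id.cpow_const (Or.inl hz.1)).mul (differentiableAt_besselK ρ hz.1)
  have h2 : DifferentiableOn ℂ (cBessel ρ) besselDomain := fun z hz =>
    (hasDerivAt_cBessel ρ hz.2).differentiableAt.differentiableWithinAt
  refine (h1.analyticOnNhd isOpen_besselDomain).eqOn_of_preconnected_of_frequently_eq
    (h2.analyticOnNhd isOpen_besselDomain) convex_besselDomain.isPreconnected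
    (z₀ := 1) (by simpa using ofReal_mem_besselDomain one_pos) ?_ hw
  have hT : Tendsto (fun x : ℝ => (x : ℂ)) (𝓝[>] 1) (𝓝[≠] 1) := by
    refine tendsto_nhdsWithin_iff.2 ⟨?_, ?_⟩
    · exact (Complex.continuous_ofReal.tendsto' 1 1 (by simp)).mono_left nhdsWithin_le_nhds
    · filter_upwards [self_mem_nhdsWithin] with x (hx : 1 < x)
      simpa using hx.ne'
  refine hT.frequently (Eventually.frequently ?_)
  filter_upwards [self_mem_nhdsWithin] with x (hx : 1 < x)
  exact scaledBesselK_ofReal ρ (by linarith)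

/-- The integral that turns a Gaussian density, mixed over time with exponential damping, into a
Bessel function. -/
lemma lintegral_rpow_mul_exp (ρ : ℝ) {a b : ℝ} (ha : 0 < a) (hb : 0 < b) :
    ∫⁻ s in Ioi (0 : ℝ), ENNReal.ofReal (s ^ (-ρ - 1) * Real.exp (-(a / (2 * s)) - s * b / 2))
      = ENNReal.ofReal (2 * a ^ (-ρ) * realBessel ρ (a * b)) := by
  -- The substitution `s = a / (2 v)` gives the Gamma-type integral with `c = a * b`.
  have himg : (fun v : ℝ => a / (2 * v)) '' Ioi 0 = Ioi 0 := by
    ext x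
    simp only [mem_image, mem_Ioi]
    constructor
    · rintro ⟨v, hv, rfl⟩; positivity
    · intro hx
      exact ⟨a / (2 * x), by positivity, by field_simp⟩
  have hd : ∀ v ∈ Ioi (0 : ℝ), HasDerivWithinAt (fun v => a / (2 * v)) (-(a / (2 * v ^ 2)))
      (Ioi 0) v := fun v (hv : 0 < v) => by
    have h := ((hasDerivAt_id v).const_mul 2).fun_inv (by simpa using hv.ne') |>.const_mul a
    simp only [id] at h
    convert! h.hasDerivWithinAt using 1
    field_simp
  have hanti : AntitoneOn (fun v : ℝ => a / (2 * v)) (Ioi 0) := fun x (hx : 0 < x) y _ hxy => by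
    simp only; gcongr
  rw [← himg, lintegral_image_eq_lintegral_deriv_mul_of_antitoneOn measurableSet_Ioi hd hanti]
  have : ∀ v ∈ Ioi (0 : ℝ), ENNReal.ofReal (-(-(a / (2 * v ^ 2)))) * ENNReal.ofReal
      ((a / (2 * v)) ^ (-ρ - 1)
        * Real.exp (-(a / (2 * (a / (2 * v)))) - (a / (2 * v)) * b / 2))
      = ENNReal.ofReal ((a / 2) ^ (-ρ)) * ENNReal.ofReal (besselKernel ρ (a * b) v) := by
    intro v (hv : 0 < v)
    rw [← ENNReal.ofReal_mul (by rw [neg_neg]; positivity), ← ENNReal.ofReal_mul (by positivity)]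
    congr 1
    have h1 : (-(a / (2 * (a / (2 * v)))) - (a / (2 * v)) * b / 2) = -v - a * b / (4 * v) := by
      field_simp; ring
    have h2 : (a / (2 * v)) ^ (-ρ - 1) = (a / 2) ^ (-ρ) * (a / 2)⁻¹ * (v ^ (ρ - 1) * v ^ 2) := by
      rw [show a / (2 * v) = (a / 2) / v by field_simp, Real.div_rpow (by positivity) hv.le,
        Real.rpow_sub_one (by positivity), div_eq_mul_inv _ (v ^ (-ρ - 1)), ← Real.rpow_neg hv.le,
        ← Real.rpow_natCast v 2, ← Real.rpow_add hv]
      rw [div_eq_mul_inv]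
      congr 2
      push_cast; ring
    rw [h1, h2, besselKernel]
    field_simp
  rw [setLIntegral_congr_fun measurableSet_Ioi this, lintegral_const_mul _
    (measurable_besselKernel _ _).ennreal_ofReal, ← ofReal_integral_eq_lintegral_ofReal
    (integrableOn_besselKernel ρ (mul_pos ha hb))
    ((ae_restrict_mem measurableSet_Ioi).mono fun s hs => besselKernel_nonneg hs),
    ← ENNReal.ofReal_mul (by positivity)]
  congr 1
  rw [realBessel, Real.div_rpow ha.le (by norm_num), Real.rpow_sub_one (by norm_num),
    Real.rpow_neg (by norm_num : (0:ℝ) ≤ 2)]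
  field_simp

/-! ### Quadratic forms and determinants of `u ⋄ S` -/

open Matrix in
lemma matInner_eq_dotProduct (M : Matrix (Fin n) (Fin n) ℝ) (x y : EuclideanSpace ℝ (Fin n)) :
    matInner M x y = x.ofLp ⬝ᵥ M *ᵥ y.ofLp := by
  simp only [matInner, dotProduct, mulVec, Finset.mul_sum, mul_assoc]

open Matrix in
lemma matInner_nonneg {M : Matrix (Fin n) (Fin n) ℝ} (hM : M.PosSemidef)
    (x : EuclideanSpace ℝ (Fin n)) : 0 ≤ matInner M x x := by
  rw [matInner_eq_dotProduct]
  simpa using hM.dotProduct_mulVec_nonneg x.ofLp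

open Matrix in
lemma matInner_pos {M : Matrix (Fin n) (Fin n) ℝ} (hM : M.PosDef)
    {x : EuclideanSpace ℝ (Fin n)} (hx : x ≠ 0) : 0 < matInner M x x := by
  rw [matInner_eq_dotProduct]
  simpa using hM.dotProduct_mulVec_pos (x := x.ofLp) (by simpa using hx)

lemma matInner_comm {M : Matrix (Fin n) (Fin n) ℝ} (hM : M.PosSemidef)
    (x y : EuclideanSpace ℝ (Fin n)) : matInner M x y = matInner M y x := by
  unfold matInner
  rw [Finset.sum_comm]
  refine Finset.sum_congr rfl fun k _ => Finset.sum_congr rfl fun l _ => ?_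
  have h : M l k = M k l := by simpa using hM.isHermitian.apply k l
  rw [h]; ring

lemma matInner_sq_le {M : Matrix (Fin n) (Fin n) ℝ} (hM : M.PosSemidef)
    (x y : EuclideanSpace ℝ (Fin n)) :
    matInner M x y ^ 2 ≤ matInner M x x * matInner M y y := by
  have h : ∀ t : ℝ, 0 ≤ matInner M x x * (t * t) + 2 * matInner M x y * t + matInner M y y := by
    intro t
    refine (matInner_nonneg hM (t • x + y)).trans (le_of_eq ?_)
    have h2 : 2 * matInner M x y = matInner M x y + matInner M y x := by
      rw [matInner_comm hM y x]; ring
    rw [h2]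
    simp only [matInner, Finset.sum_mul, ← Finset.sum_add_distrib, PiLp.add_apply,
      PiLp.smul_apply, smul_eq_mul]
    refine Finset.sum_congr rfl fun k _ => Finset.sum_congr rfl fun l _ => ?_
    ring
  have := discrim_le_zero h
  unfold discrim at this
  nlinarith

lemma matNorm_sq {M : Matrix (Fin n) (Fin n) ℝ} (hM : M.PosSemidef)
    (x : EuclideanSpace ℝ (Fin n)) : matNorm M x ^ 2 = matInner M x x :=
  Real.sq_sqrt (matInner_nonneg hM x)

lemma matInner_smul_smul (M : Matrix (Fin n) (Fin n) ℝ) (a b : ℝ)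
    (x y : EuclideanSpace ℝ (Fin n)) : matInner M (a • x) (b • y) = a * b * matInner M x y := by
  simp only [matInner, Finset.mul_sum, PiLp.smul_apply, smul_eq_mul]
  refine Finset.sum_congr rfl fun k _ => Finset.sum_congr rfl fun l _ => ?_
  ring

lemma matNorm_smul (M : Matrix (Fin n) (Fin n) ℝ) {r : ℝ} (hr : 0 ≤ r)
    (x : EuclideanSpace ℝ (Fin n)) : matNorm M (r • x) = r * matNorm M x := by
  rw [matNorm, matInner_smul_smul, ← sq, Real.sqrt_mul (sq_nonneg r), Real.sqrt_sq hr, matNorm]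

open Matrix in
/-- A coordinate is controlled by the inverse quadratic form: Cauchy-Schwarz for `⟨·, ·⟩_N`, applied
to a basis vector and `N⁻¹ x`. -/
lemma sq_apply_le_mul_matInner_inv {N : Matrix (Fin n) (Fin n) ℝ} (hN : N.PosDef)
    (x : EuclideanSpace ℝ (Fin n)) (k : Fin n) : x k ^ 2 ≤ N k k * matInner N⁻¹ x x := by
  set y : EuclideanSpace ℝ (Fin n) := WithLp.toLp 2 (N⁻¹ *ᵥ x.ofLp) with hy
  have hdet : IsUnit N.det := (Matrix.isUnit_iff_isUnit_det _).1 hN.isUnit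
  have hNy : N *ᵥ y.ofLp = x.ofLp := by
    simp [hy, Matrix.mulVec_mulVec, Matrix.mul_nonsing_inv _ hdet]
  have h1 := matInner_sq_le hN.posSemidef (EuclideanSpace.single k (1 : ℝ)) y
  have h2 : matInner N (EuclideanSpace.single k (1 : ℝ)) y = x k := by
    rw [matInner_eq_dotProduct, hNy]; simp [EuclideanSpace.single]
  have h3 : matInner N (EuclideanSpace.single k (1 : ℝ)) (EuclideanSpace.single k (1 : ℝ))
      = N k k := by
    rw [matInner_eq_dotProduct]; simp [EuclideanSpace.single]
  have h4 : matInner N y y = matInner N⁻¹ x x := by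
    rw [matInner_eq_dotProduct, matInner_eq_dotProduct, hNy, dotProduct_comm]
  rwa [h2, h3, h4] at h1

/-- The matrix is a Gram matrix: `min (u k) (u l)` is the length of `[0, u k] ∩ [0, u l]`. -/
lemma posSemidef_min {u : EuclideanSpace ℝ (Fin n)} (hu : u ∈ nonnegOrthant n) :
    (Matrix.of fun k l => min (u k) (u l)).PosSemidef := by
  have : (Matrix.of fun k l => min (u k) (u l))
      = .of fun k l => volume.real ((Icc 0 (u k)) ∩ (Icc 0 (u l))) := by
    ext k l
    simp [Icc_inter_Icc, hu k, hu l]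
  rw [this]
  exact posSemidef_matrix_measure_inter (fun _ ↦ measurableSet_Icc)
    (fun _ ↦ isCompact_Icc.measure_ne_top)

lemma posSemidef_matDiamond {u : EuclideanSpace ℝ (Fin n)} (hu : u ∈ nonnegOrthant n)
    {S : Matrix (Fin n) (Fin n) ℝ} (hS : S.PosSemidef) : (matDiamond u S).PosSemidef :=
  (posSemidef_min hu).hadamard hS

lemma posOrthant_subset_nonnegOrthant : posOrthant n ⊆ nonnegOrthant n := fun _ hu k => (hu k).le

open scoped MatrixOrder Matrix.Norms.L2Operator in
/-- A positive lower bound for the eigenvalues of `S`. -/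
lemma exists_posSemidef_sub_smul_one {S : Matrix (Fin n) (Fin n) ℝ} (hS : S.PosDef) :
    ∃ c : ℝ, 0 < c ∧ (S - c • (1 : Matrix (Fin n) (Fin n) ℝ)).PosSemidef := by
  rcases isEmpty_or_nonempty (Fin n) with hn | hn
  · refine ⟨1, one_pos, ?_⟩
    rw [Subsingleton.elim (S - _) 0]
    exact .zero
  obtain ⟨c, hc, h⟩ := (CFC.exists_pos_algebraMap_le_iff (A := Matrix (Fin n) (Fin n) ℝ)
    hS.isHermitian.isSelfAdjoint).2 (fun x hx =>
      (Matrix.isStrictlyPositive_iff_posDef.2 hS).spectrum_pos hx)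
  exact ⟨c, hc, by simpa [Matrix.le_iff, Algebra.algebraMap_eq_smul_one] using h⟩

/-- The map `u ⋄ ·` is monotone in the Loewner order, and it maps `c • 1` to `c • diag u`. -/
lemma posSemidef_matDiamond_sub {S : Matrix (Fin n) (Fin n) ℝ} {c : ℝ}
    (hc : (S - c • (1 : Matrix (Fin n) (Fin n) ℝ)).PosSemidef)
    {u : EuclideanSpace ℝ (Fin n)} (hu : u ∈ nonnegOrthant n) :
    (matDiamond u S - Matrix.diagonal fun k => c * u k).PosSemidef := by
  convert! posSemidef_matDiamond hu hc using 1
  ext k l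
  by_cases hkl : k = l
  · subst hkl; simp [matDiamond]; ring
  · simp [matDiamond, hkl]

open Matrix in
lemma one_le_det {B : Matrix (Fin n) (Fin n) ℝ} (hB : (B - 1).PosSemidef) : 1 ≤ B.det := by
  have hH : B.IsHermitian := by
    have := hB.isHermitian.add (Matrix.isHermitian_one (n := Fin n) (α := ℝ))
    simpa using this
  rw [hH.det_eq_prod_eigenvalues]
  simp only [RCLike.ofReal_real_eq_id, id_eq]
  refine Finset.one_le_prod fun i => ?_
  rw [hH.eigenvalues_eq i]
  have h1 := hB.dotProduct_mulVec_nonneg (hH.eigenvectorBasis i).ofLp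
  have h2 : (hH.eigenvectorBasis i).ofLp ⬝ᵥ (hH.eigenvectorBasis i).ofLp = 1 := by
    have h := hH.eigenvectorBasis.orthonormal.1 i
    have h3 : ‖hH.eigenvectorBasis i‖ ^ 2 = 1 := by rw [h]; norm_num
    rw [EuclideanSpace.real_norm_sq_eq] at h3
    rw [← h3]
    simp [dotProduct, sq]
  simp only [Matrix.sub_mulVec, dotProduct_sub, one_mulVec, star_trivial, h2] at h1
  simpa using h1

open Matrix in
/-- Monotonicity of the determinant in the Loewner order, above a positive diagonal matrix;
conjugation by `diag (d k) ^ (-1 / 2)` reduces it to `one_le_det`. -/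
lemma prod_le_det {A : Matrix (Fin n) (Fin n) ℝ} {d : Fin n → ℝ} (hd : ∀ k, 0 < d k)
    (hA : (A - Matrix.diagonal d).PosSemidef) : ∏ k, d k ≤ A.det := by
  set R : Matrix (Fin n) (Fin n) ℝ := Matrix.diagonal fun k => (√(d k))⁻¹ with hR
  have hRH : Rᴴ = R := by simp [hR]
  have h1 := hA.conjTranspose_mul_mul_same R
  have h2 : Rᴴ * (A - Matrix.diagonal d) * R = R * A * R - 1 := by
    rw [hRH, Matrix.mul_sub, Matrix.sub_mul]
    congr 1
    rw [hR, Matrix.diagonal_mul_diagonal, Matrix.diagonal_mul_diagonal, ← Matrix.diagonal_one]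
    congr 1
    ext k
    have : √(d k) ≠ 0 := (Real.sqrt_pos.2 (hd k)).ne'
    field_simp
    rw [Real.sq_sqrt (hd k).le]
  rw [h2] at h1
  have h3 := one_le_det h1
  have h4 : R.det * R.det * ∏ k, d k = 1 := by
    rw [hR, Matrix.det_diagonal, ← Finset.prod_mul_distrib, ← Finset.prod_mul_distrib]
    refine Finset.prod_eq_one fun k _ => ?_
    have : √(d k) ≠ 0 := (Real.sqrt_pos.2 (hd k)).ne'
    field_simp
    rw [Real.sq_sqrt (hd k).le]
  rw [Matrix.det_mul, Matrix.det_mul] at h3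
  have hp : 0 < ∏ k, d k := Finset.prod_pos fun k _ => hd k
  calc ∏ k, d k = ∏ k, d k * 1 := by simp
    _ ≤ (∏ k, d k) * (R.det * A.det * R.det) := by
        rw [Finset.prod_mul_distrib, Finset.prod_const_one]
        exact mul_le_mul_of_nonneg_left h3 hp.le
    _ = (R.det * R.det * ∏ k, d k) * A.det := by ring
    _ = A.det := by rw [h4, one_mul]

lemma posDef_matDiamond {S : Matrix (Fin n) (Fin n) ℝ} (hS : S.PosDef)
    {u : EuclideanSpace ℝ (Fin n)} (hu : u ∈ posOrthant n) : (matDiamond u S).PosDef := by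
  obtain ⟨c, hc, h⟩ := exists_posSemidef_sub_smul_one hS
  have h1 := posSemidef_matDiamond_sub h (posOrthant_subset_nonnegOrthant hu)
  have h2 : (Matrix.diagonal fun k => c * u k).PosDef :=
    Matrix.posDef_diagonal_iff.2 fun k => mul_pos hc (hu k)
  simpa using h2.posSemidef_add h1

/-! ### Estimates for the functions `𝔄`, `𝔇`, `𝔈` -/

lemma fA_sq {μ : EuclideanSpace ℝ (Fin n)} {S : Matrix (Fin n) (Fin n) ℝ} (hS : S.PosDef)
    (x : EuclideanSpace ℝ (Fin n)) {u : EuclideanSpace ℝ (Fin n)} (hu : u ∈ posOrthant n) :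
    fA μ S x u ^ 2 = (2 * ‖u‖ ^ 2 + matInner (matDiamond u S)⁻¹ (vecDiamond u μ) (vecDiamond u μ))
      * matInner (matDiamond u S)⁻¹ x x := by
  have hM := (posDef_matDiamond hS hu).posSemidef.inv
  rw [fA, Real.sq_sqrt (by positivity), matNorm_sq hM, matNorm_sq hM]

lemma abs_fE_le_fA {μ : EuclideanSpace ℝ (Fin n)} {S : Matrix (Fin n) (Fin n) ℝ} (hS : S.PosDef)
    (x : EuclideanSpace ℝ (Fin n)) {u : EuclideanSpace ℝ (Fin n)} (hu : u ∈ posOrthant n) :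
    |fE μ S x u| ≤ fA μ S x u := by
  have hM := (posDef_matDiamond hS hu).posSemidef.inv
  refine abs_le_of_sq_le_sq ?_ (Real.sqrt_nonneg _)
  rw [fA_sq hS x hu, fE]
  have h1 := matInner_sq_le hM x (vecDiamond u μ)
  have h2 := matInner_nonneg hM x
  nlinarith [mul_nonneg (sq_nonneg ‖u‖) h2]

lemma apply_le_norm (u : EuclideanSpace ℝ (Fin n)) (k : Fin n) : u k ≤ ‖u‖ :=
  (le_abs_self _).trans (PiLp.norm_apply_le u k)

lemma div_le_matInner {S : Matrix (Fin n) (Fin n) ℝ} (hS : S.PosDef)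
    (x : EuclideanSpace ℝ (Fin n)) {u : EuclideanSpace ℝ (Fin n)} (hu : u ∈ posOrthant n)
    (k : Fin n) : x k ^ 2 / (u k * S k k) ≤ matInner (matDiamond u S)⁻¹ x x := by
  have h := sq_apply_le_mul_matInner_inv (posDef_matDiamond hS hu) x k
  have h2 : matDiamond u S k k = u k * S k k := by simp [matDiamond]
  have h3 : 0 < u k * S k k := mul_pos (hu k) hS.diag_pos
  rw [div_le_iff₀ h3]
  rw [h2] at h
  linarith

/-- `𝔇(x, ·)` is bounded below: a small coordinate `u k` makes `|u ⋄ S|` small, but it makes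
`‖x‖²_{(u ⋄ S)⁻¹} ≥ x k ^ 2 / (u k * S k k)` large, and the two effects balance. -/
lemma exists_le_fD {S : Matrix (Fin n) (Fin n) ℝ} (hS : S.PosDef)
    {x : EuclideanSpace ℝ (Fin n)} (hx : x ∈ nonzeroCoords n) :
    ∃ c, 0 < c ∧ ∀ u ∈ posOrthant n, c ≤ fD S x u := by
  obtain ⟨l, hl, hSl⟩ := exists_posSemidef_sub_smul_one hS
  have hpos : 0 < ∏ k, (x k ^ 2 / S k k * l) := Finset.prod_pos fun k _ =>
    mul_pos (div_pos (pow_pos (abs_pos.2 (hx k)) 2 |>.trans_eq (sq_abs _)) hS.diag_pos) hl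
  refine ⟨√(∏ k, (x k ^ 2 / S k k * l)), Real.sqrt_pos.2 hpos, fun u hu => ?_⟩
  have hM := (posDef_matDiamond hS hu).posSemidef.inv
  have hdet := prod_le_det (fun k => mul_pos hl (hu k))
    (posSemidef_matDiamond_sub hSl (posOrthant_subset_nonnegOrthant hu))
  have hdet0 : 0 ≤ (matDiamond u S).det := (posDef_matDiamond hS hu).det_pos.le
  have hpow : √(matInner (matDiamond u S)⁻¹ x x) ^ n = √(matInner (matDiamond u S)⁻¹ x x ^ n) := by
    rw [eq_comm, Real.sqrt_eq_iff_eq_sq (pow_nonneg (matInner_nonneg hM x) n) (by positivity),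
      ← pow_mul, mul_comm n 2, pow_mul, Real.sq_sqrt (matInner_nonneg hM x)]
  rw [fD, matNorm, hpow, ← Real.sqrt_mul (pow_nonneg (matInner_nonneg hM x) n)]
  refine Real.sqrt_le_sqrt ?_
  have h1 : ∏ k, (x k ^ 2 / (u k * S k k)) ≤ matInner (matDiamond u S)⁻¹ x x ^ n := by
    calc _ ≤ ∏ _k : Fin n, matInner (matDiamond u S)⁻¹ x x :=
          Finset.prod_le_prod (fun k _ => div_nonneg (sq_nonneg _)
            (mul_pos (hu k) hS.diag_pos).le) fun k _ => div_le_matInner hS x hu k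
      _ = _ := by simp
  calc ∏ k, (x k ^ 2 / S k k * l) = (∏ k, (x k ^ 2 / (u k * S k k))) * ∏ k, (l * u k) := by
        rw [← Finset.prod_mul_distrib]
        refine Finset.prod_congr rfl fun k _ => ?_
        have := (hu k).ne'
        field_simp
    _ ≤ _ := mul_le_mul h1 hdet (Finset.prod_nonneg fun k _ => (mul_pos hl (hu k)).le)
        (pow_nonneg (matInner_nonneg hM x) n)

/-- `𝔄(x, u)² ≥ 2 ‖u‖² ‖x‖²_{(u ⋄ S)⁻¹}`, and the last factor is at least a multiple of
`1 / ‖u‖`. -/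
lemma exists_mul_norm_le_fA_sq (hn : 0 < n) (μ : EuclideanSpace ℝ (Fin n))
    {S : Matrix (Fin n) (Fin n) ℝ} (hS : S.PosDef)
    {x : EuclideanSpace ℝ (Fin n)} (hx : x ∈ nonzeroCoords n) :
    ∃ c, 0 < c ∧ ∀ u ∈ posOrthant n, c * ‖u‖ ≤ fA μ S x u ^ 2 := by
  let k : Fin n := ⟨0, hn⟩
  have hk : 0 < x k ^ 2 := (pow_pos (abs_pos.2 (hx k)) 2).trans_eq (sq_abs _)
  have hSk : 0 < S k k := hS.diag_pos
  refine ⟨2 * (x k ^ 2 / S k k), by positivity, fun u hu => ?_⟩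
  have hM := (posDef_matDiamond hS hu).posSemidef.inv
  have hu0 : 0 < ‖u‖ := (hu k).trans_le (apply_le_norm u k)
  rw [fA_sq hS x hu]
  have h1 := div_le_matInner hS x hu k
  have h2 : x k ^ 2 / (‖u‖ * S k k) ≤ x k ^ 2 / (u k * S k k) := by
    have := hu k
    have := apply_le_norm u k
    gcongr
  calc 2 * (x k ^ 2 / S k k) * ‖u‖ = 2 * ‖u‖ ^ 2 * (x k ^ 2 / (‖u‖ * S k k)) := by
        field_simp
    _ ≤ (2 * ‖u‖ ^ 2 + matInner (matDiamond u S)⁻¹ (vecDiamond u μ) (vecDiamond u μ))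
        * matInner (matDiamond u S)⁻¹ x x := by
        refine mul_le_mul ?_ (h2.trans h1) (by positivity) ?_
        · linarith [matInner_nonneg hM (vecDiamond u μ)]
        · have := matInner_nonneg hM (vecDiamond u μ)
          positivity

open Matrix in
/-- `𝔈(x, ·)` is bounded: `(u ⋄ S)⁻¹ (u ⋄ μ) = G⁻¹ μ` for the matrix `G` with entries
`min 1 (u l / u k) * S k l`, which are bounded, and with determinant bounded away from zero. -/
lemma exists_abs_fE_le (μ : EuclideanSpace ℝ (Fin n)) {S : Matrix (Fin n) (Fin n) ℝ}
    (hS : S.PosDef) (x : EuclideanSpace ℝ (Fin n)) :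
    ∃ C, 0 < C ∧ ∀ u ∈ posOrthant n, |fE μ S x u| ≤ C := by
  obtain ⟨l, hl, hSl⟩ := exists_posSemidef_sub_smul_one hS
  set K : ℝ := 1 + ∑ i, ∑ j, |S i j| with hK
  have hK1 : 1 ≤ K := by
    rw [hK]; linarith [Finset.sum_nonneg fun i (_ : i ∈ Finset.univ) =>
      Finset.sum_nonneg fun j (_ : j ∈ Finset.univ) => abs_nonneg (S i j)]
  have hSK : ∀ i j, |S i j| ≤ K := fun i j => by
    have h1 := Finset.single_le_sum (f := fun j => |S i j|) (fun j _ => abs_nonneg _)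
      (Finset.mem_univ j)
    have h2 := Finset.single_le_sum (f := fun i => ∑ j, |S i j|)
      (fun i _ => Finset.sum_nonneg fun j _ => abs_nonneg _) (Finset.mem_univ i)
    exact (h1.trans h2).trans (by linarith)
  set D : ℝ := (l ^ n)⁻¹ * ((Fintype.card (Fin n)).factorial • K ^ (Fintype.card (Fin n))) with hD
  have hD0 : 0 < D := by positivity
  refine ⟨∑ i, ∑ j, |x i| * D * |μ j| + 1, by positivity, fun u hu => ?_⟩
  set N := matDiamond u S with hN
  set G : Matrix (Fin n) (Fin n) ℝ := Matrix.diagonal (fun k => (u k)⁻¹) * N with hG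
  have hNpd := posDef_matDiamond hS hu
  have hdetu : 0 < ∏ k, u k := Finset.prod_pos fun k _ => hu k
  have hdetN := prod_le_det (fun k => mul_pos hl (hu k))
    (posSemidef_matDiamond_sub hSl (posOrthant_subset_nonnegOrthant hu))
  have hdetG : l ^ n ≤ G.det := by
    rw [hG, Matrix.det_mul, Matrix.det_diagonal, Finset.prod_inv_distrib, ← div_eq_inv_mul,
      le_div_iff₀ hdetu]
    simpa [Finset.prod_mul_distrib] using hdetN
  have hGK : ∀ i j, |G i j| ≤ K := fun i j => by
    rw [hG, Matrix.diagonal_mul, hN, matDiamond, Matrix.of_apply, ← mul_assoc, abs_mul]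
    have h1 : |(u i)⁻¹ * min (u i) (u j)| ≤ 1 := by
      have hi := hu i
      have hj := hu j
      rw [abs_of_nonneg (by positivity), ← div_eq_inv_mul, div_le_one hi]
      exact min_le_left _ _
    calc _ ≤ 1 * |S i j| := by gcongr
      _ ≤ K := by rw [one_mul]; exact hSK i j
  have hNG : N = Matrix.diagonal (fun k => u k) * G := by
    rw [hG, ← Matrix.mul_assoc, Matrix.diagonal_mul_diagonal]
    simp [(hu _).ne']
  have hGu : IsUnit G.det := (lt_of_lt_of_le (by positivity) hdetG).ne'.isUnit
  have hNu : IsUnit N.det := hNpd.det_pos.ne'.isUnit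
  have hvec : N⁻¹ *ᵥ (vecDiamond u μ).ofLp = G⁻¹ *ᵥ μ.ofLp := by
    have h1 : (vecDiamond u μ).ofLp = N *ᵥ (G⁻¹ *ᵥ μ.ofLp) := by
      rw [hNG, Matrix.mulVec_mulVec, Matrix.mul_assoc, Matrix.mul_nonsing_inv _ hGu, Matrix.mul_one]
      ext k
      simp [vecDiamond, Matrix.mulVec_diagonal]
    rw [h1, Matrix.mulVec_mulVec, Matrix.nonsing_inv_mul _ hNu, Matrix.one_mulVec]
  -- Cramer's rule bounds the entries of `G⁻¹`.
  have hinv : ∀ i j, |G⁻¹ i j| ≤ D := fun i j => by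
    rw [Matrix.inv_def, Matrix.smul_apply, smul_eq_mul, abs_mul, Ring.inverse_eq_inv', abs_inv,
      abs_of_pos (lt_of_lt_of_le (by positivity) hdetG)]
    refine mul_le_mul (inv_anti₀ (by positivity) hdetG) ?_ (abs_nonneg _) (by positivity)
    rw [Matrix.adjugate_apply]
    refine Matrix.det_le (abv := AbsoluteValue.abs) fun a b => ?_
    rw [Matrix.updateRow_apply]
    split_ifs
    · rcases eq_or_ne b i with rfl | h
      · simpa using hK1
      · simpa [h] using zero_le_one.trans hK1
    · exact hGK a b
  rw [fE, matInner_eq_dotProduct, ← hN, hvec]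
  calc |x.ofLp ⬝ᵥ G⁻¹ *ᵥ μ.ofLp| = |∑ i, ∑ j, x i * G⁻¹ i j * μ j| := by
        simp only [dotProduct, mulVec, Finset.mul_sum, mul_assoc]
    _ ≤ ∑ i, ∑ j, |x i| * D * |μ j| := by
        refine (Finset.abs_sum_le_sum_abs _ _).trans (Finset.sum_le_sum fun i _ =>
          (Finset.abs_sum_le_sum_abs _ _).trans (Finset.sum_le_sum fun j _ => ?_))
        rw [abs_mul, abs_mul]
        gcongr
        exact hinv i j
    _ ≤ _ := by linarith

/-! ### Homogeneity and measurability -/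

lemma fE_smul (μ : EuclideanSpace ℝ (Fin n)) (S : Matrix (Fin n) (Fin n) ℝ) (r : ℝ)
    (x u : EuclideanSpace ℝ (Fin n)) : fE μ S (r • x) u = r * fE μ S x u := by
  have := matInner_smul_smul (matDiamond u S)⁻¹ r 1 x (vecDiamond u μ)
  simpa [fE] using this

lemma fA_smul (μ : EuclideanSpace ℝ (Fin n)) (S : Matrix (Fin n) (Fin n) ℝ) {r : ℝ} (hr : 0 ≤ r)
    (x u : EuclideanSpace ℝ (Fin n)) : fA μ S (r • x) u = r * fA μ S x u := by
  rw [fA, fA, matNorm_smul _ hr, mul_pow, mul_left_comm, Real.sqrt_mul (sq_nonneg r),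
    Real.sqrt_sq hr]

lemma fD_smul (S : Matrix (Fin n) (Fin n) ℝ) {r : ℝ} (hr : 0 ≤ r)
    (x u : EuclideanSpace ℝ (Fin n)) : fD S (r • x) u = r ^ n * fD S x u := by
  rw [fD, fD, matNorm_smul _ hr, mul_pow, mul_assoc]

lemma continuous_matDiamond (S : Matrix (Fin n) (Fin n) ℝ) :
    Continuous fun u : EuclideanSpace ℝ (Fin n) => matDiamond u S := by
  unfold matDiamond
  refine continuous_matrix fun k l => ?_
  simp only [Matrix.of_apply]
  fun_prop

lemma measurable_matDiamond_inv (S : Matrix (Fin n) (Fin n) ℝ) (k l : Fin n) :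
    Measurable fun u : EuclideanSpace ℝ (Fin n) => (matDiamond u S)⁻¹ k l := by
  have hc := continuous_matDiamond S
  simp only [Matrix.inv_def, Ring.inverse_eq_inv', Matrix.smul_apply, smul_eq_mul]
  exact (hc.matrix_det.measurable.inv).mul (hc.matrix_adjugate.matrix_elem k l).measurable

lemma measurable_matInner_inv (S : Matrix (Fin n) (Fin n) ℝ) {α : Type*} [MeasurableSpace α]
    {f g h : α → EuclideanSpace ℝ (Fin n)} (hf : Measurable f) (hg : Measurable g)
    (hh : Measurable h) : Measurable fun a => matInner (matDiamond (f a) S)⁻¹ (g a) (h a) := by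
  have h0 : ∀ k, Measurable fun x : EuclideanSpace ℝ (Fin n) => x k := fun k => by fun_prop
  unfold matInner
  refine Finset.measurable_sum _ fun k _ => Finset.measurable_sum _ fun l _ => ?_
  exact (((h0 k).comp hg).mul ((measurable_matDiamond_inv S k l).comp hf)).mul ((h0 l).comp hh)

lemma measurable_vecDiamond (μ : EuclideanSpace ℝ (Fin n)) :
    Measurable fun u : EuclideanSpace ℝ (Fin n) => vecDiamond u μ := by
  refine Continuous.measurable ?_
  unfold vecDiamond
  fun_prop

lemma measurable_fE (μ : EuclideanSpace ℝ (Fin n)) (S : Matrix (Fin n) (Fin n) ℝ) :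
    Measurable fun p : EuclideanSpace ℝ (Fin n) × EuclideanSpace ℝ (Fin n) => fE μ S p.1 p.2 :=
  measurable_matInner_inv S measurable_snd measurable_fst
    ((measurable_vecDiamond μ).comp measurable_snd)

lemma measurable_fA (μ : EuclideanSpace ℝ (Fin n)) (S : Matrix (Fin n) (Fin n) ℝ) :
    Measurable fun p : EuclideanSpace ℝ (Fin n) × EuclideanSpace ℝ (Fin n) => fA μ S p.1 p.2 := by
  unfold fA matNorm
  have h1 := measurable_matInner_inv S (α := EuclideanSpace ℝ (Fin n) × EuclideanSpace ℝ (Fin n))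
    measurable_snd measurable_fst measurable_fst
  have h2 := measurable_matInner_inv S (α := EuclideanSpace ℝ (Fin n) × EuclideanSpace ℝ (Fin n))
    measurable_snd ((measurable_vecDiamond μ).comp measurable_snd)
    ((measurable_vecDiamond μ).comp measurable_snd)
  exact ((((measurable_snd.norm).pow_const 2).const_mul 2).add (h2.sqrt.pow_const 2)
    |>.mul (h1.sqrt.pow_const 2)).sqrt

lemma measurable_fD (S : Matrix (Fin n) (Fin n) ℝ) :
    Measurable fun p : EuclideanSpace ℝ (Fin n) × EuclideanSpace ℝ (Fin n) => fD S p.1 p.2 := by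
  unfold fD matNorm
  have h1 := measurable_matInner_inv S (α := EuclideanSpace ℝ (Fin n) × EuclideanSpace ℝ (Fin n))
    measurable_snd measurable_fst measurable_fst
  exact (h1.sqrt.pow_const n).mul
    ((continuous_matDiamond S).matrix_det.measurable.comp measurable_snd).sqrt

lemma measurableSet_posOrthant : MeasurableSet (posOrthant n) := by
  unfold posOrthant
  simp only [ofPred_forall]
  exact MeasurableSet.iInter fun k => measurableSet_lt (by fun_prop) (by fun_prop)

lemma measurableSet_nonnegOrthant : MeasurableSet (nonnegOrthant n) := by
  unfold nonnegOrthant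
  simp only [ofPred_forall]
  exact MeasurableSet.iInter fun k => measurableSet_le (by fun_prop) (by fun_prop)

lemma measurableSet_nonzeroCoords : MeasurableSet (nonzeroCoords n) := by
  unfold nonzeroCoords
  simp only [ofPred_forall]
  refine MeasurableSet.iInter fun k => ?_
  have h : Measurable fun x : EuclideanSpace ℝ (Fin n) => x k := by fun_prop
  exact (measurableSet_eq_fun h measurable_const).compl

/-! ### Integrability against a Thorin measure -/

lemma IsThorinMeasure.integrable_min {U : Measure (EuclideanSpace ℝ (Fin n))}
    (hU : IsThorinMeasure U) : Integrable (fun u => min 1 (1 / ‖u‖)) U := by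
  refine ⟨(measurable_const.min (measurable_const.div measurable_norm)).aestronglyMeasurable, ?_⟩
  refine lt_of_le_of_lt ?_ hU.finite
  refine lintegral_mono fun u => ?_
  rw [Real.enorm_eq_ofReal (by positivity)]
  refine ENNReal.ofReal_le_ofReal (min_le_min_right _ ?_)
  linarith [le_max_right (-Real.log ‖u‖) 0]

lemma norm_pos_of_mem_posOrthant (hn : 0 < n) {u : EuclideanSpace ℝ (Fin n)}
    (hu : u ∈ posOrthant n) : 0 < ‖u‖ :=
  (hu ⟨0, hn⟩).trans_le (apply_le_norm u _)

lemma fA_nonneg (μ : EuclideanSpace ℝ (Fin n)) (S : Matrix (Fin n) (Fin n) ℝ)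
    (x u : EuclideanSpace ℝ (Fin n)) : 0 ≤ fA μ S x u := Real.sqrt_nonneg _

lemma fA_pos (hn : 0 < n) {μ : EuclideanSpace ℝ (Fin n)} {S : Matrix (Fin n) (Fin n) ℝ}
    (hS : S.PosDef) {x : EuclideanSpace ℝ (Fin n)} (hx : x ∈ nonzeroCoords n)
    {u : EuclideanSpace ℝ (Fin n)} (hu : u ∈ posOrthant n) : 0 < fA μ S x u := by
  obtain ⟨c, hc, h⟩ := exists_mul_norm_le_fA_sq hn μ hS hx
  have h1 := h u hu
  have h2 := mul_pos hc (norm_pos_of_mem_posOrthant hn hu)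
  exact lt_of_le_of_ne (fA_nonneg _ _ _ _) fun h0 => by rw [← h0] at h1; norm_num at h1; linarith

lemma fD_pos {S : Matrix (Fin n) (Fin n) ℝ} (hS : S.PosDef) {x : EuclideanSpace ℝ (Fin n)}
    (hx : x ∈ nonzeroCoords n) {u : EuclideanSpace ℝ (Fin n)} (hu : u ∈ posOrthant n) :
    0 < fD S x u := by
  obtain ⟨c, hc, h⟩ := exists_le_fD hS hx
  exact hc.trans_le (h u hu)

lemma sq_mul_ofReal_re (w : ℂ) (a : ℝ) : ((w * (a : ℂ)) ^ 2).re = a ^ 2 * (w ^ 2).re := by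
  rw [mul_pow, ← Complex.ofReal_pow, Complex.re_mul_ofReal, mul_comm]

lemma besselTerm_eq (hn : 0 < n) {μ : EuclideanSpace ℝ (Fin n)} {S : Matrix (Fin n) (Fin n) ℝ}
    (hS : S.PosDef) {z : EuclideanSpace ℝ (Fin n)} (hz : z ∈ nonzeroCoords n) (ρ : ℝ) {w : ℂ}
    (hw : w ∈ besselDomain) {u : EuclideanSpace ℝ (Fin n)} (hu : u ∈ posOrthant n) :
    besselTerm ρ μ S z w u
      = Complex.exp (w * (fE μ S z u : ℂ)) * cBessel ρ (w * (fA μ S z u : ℂ)) / (fD S z u : ℂ) := by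
  rw [besselTerm, scaledBesselK_eq_cBessel ρ (mul_ofReal_mem_besselDomain hw (fA_pos hn hS hz hu))]

lemma besselTerm_ofReal (hn : 0 < n) {μ : EuclideanSpace ℝ (Fin n)}
    {S : Matrix (Fin n) (Fin n) ℝ} (hS : S.PosDef) {z : EuclideanSpace ℝ (Fin n)}
    (hz : z ∈ nonzeroCoords n) (ρ : ℝ) {r : ℝ} (hr : 0 < r) {u : EuclideanSpace ℝ (Fin n)}
    (hu : u ∈ posOrthant n) :
    besselTerm ρ μ S z r u = ((Real.exp (r * fE μ S z u)
      * realBessel ρ ((r * fA μ S z u) ^ 2) / fD S z u : ℝ) : ℂ) := by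
  rw [besselTerm_eq hn hS hz ρ (ofReal_mem_besselDomain hr) hu, ← Complex.ofReal_mul,
    ← Complex.ofReal_mul, cBessel_ofReal]
  push_cast
  rfl

lemma aestronglyMeasurable_besselTerm (hn : 0 < n) (μ : EuclideanSpace ℝ (Fin n))
    {S : Matrix (Fin n) (Fin n) ℝ} (hS : S.PosDef) {z : EuclideanSpace ℝ (Fin n)}
    (hz : z ∈ nonzeroCoords n) (ρ : ℝ) {w : ℂ} (hw : w ∈ besselDomain)
    (U : Measure (EuclideanSpace ℝ (Fin n))) :
    AEStronglyMeasurable (besselTerm ρ μ S z w) (U.restrict (posOrthant n)) := by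
  have hE := (measurable_fE μ S).comp (measurable_prodMk_left (x := z))
  have hA := (measurable_fA μ S).comp (measurable_prodMk_left (x := z))
  have hD := (measurable_fD S).comp (measurable_prodMk_left (x := z))
  have h1 : Measurable fun u => Complex.exp (w * (fE μ S z u : ℂ))
      * cBessel ρ (w * (fA μ S z u : ℂ)) / (fD S z u : ℂ) :=
    ((Complex.measurable_exp.comp ((Complex.measurable_ofReal.comp hE).const_mul w)).mul
      ((measurable_cBessel ρ).comp ((Complex.measurable_ofReal.comp hA).const_mul w))).div
      (Complex.measurable_ofReal.comp hD)
  refine h1.aestronglyMeasurable.congr ?_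
  filter_upwards [ae_restrict_mem measurableSet_posOrthant] with u hu
  rw [besselTerm_eq hn hS hz ρ hw hu]

/-- Locally uniform domination: `𝔈` is bounded, `𝔇` is bounded below, and the decay of `𝔎_ρ`
together with `𝔄² ≥ c ‖u‖` supplies the factor `1 / ‖u‖`. The case `p = 1` serves the second term
of the derivative, where `ρ = (n - 2) / 2` may vanish. -/
lemma exists_norm_besselTerm_le (hn : 0 < n) (μ : EuclideanSpace ℝ (Fin n))
    {S : Matrix (Fin n) (Fin n) ℝ} (hS : S.PosDef) {z : EuclideanSpace ℝ (Fin n)}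
    (hz : z ∈ nonzeroCoords n) {ρ : ℝ} {p : ℕ} (hρ : 0 < ρ + p) {κ : ℝ} (hκ : 0 < κ) (R : ℝ) :
    ∃ C, 0 < C ∧ ∀ w ∈ besselDomain, κ ≤ (w ^ 2).re → ‖w‖ ≤ R → ∀ u ∈ posOrthant n,
      (fA μ S z u ^ 2) ^ p * ‖besselTerm ρ μ S z w u‖ ≤ C * min 1 (1 / ‖u‖) := by
  obtain ⟨CE, hCE, hE⟩ := exists_abs_fE_le μ hS z
  obtain ⟨cA, hcA, hA⟩ := exists_mul_norm_le_fA_sq hn μ hS hz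
  obtain ⟨cD, hcD, hD⟩ := exists_le_fD hS hz
  obtain ⟨C1, hC1, h1⟩ := exists_rpow_mul_realBessel_le (ρ := ρ) (p := p) (by positivity) hρ
  obtain ⟨C2, hC2, h2⟩ := exists_rpow_mul_realBessel_le (ρ := ρ) (p := (p + 1 : ℕ))
    (by positivity) (by push_cast; linarith)
  simp only [Real.rpow_natCast] at h1 h2
  set K := max (C1 / κ ^ p) (C2 / (κ ^ (p + 1) * cA)) with hK
  have hK0 : 0 < K := lt_max_of_lt_left (by positivity)
  have hR : Real.exp (R * CE) ≠ 0 := (Real.exp_pos _).ne'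
  refine ⟨Real.exp (R * CE) * K / cD, by positivity, fun w hw hwκ hwR u hu => ?_⟩
  have hu0 := norm_pos_of_mem_posOrthant hn hu
  have hApos := fA_pos hn (μ := μ) hS hz hu
  have hDpos := fD_pos hS hz hu
  set a := fA μ S z u ^ 2 with ha
  have ha0 : 0 < a := by positivity
  have hAu := hA u hu
  have hB : ‖cBessel ρ (w * (fA μ S z u : ℂ))‖ ≤ realBessel ρ (a * κ) := by
    refine (norm_cBessel_le _ _).trans (realBessel_anti _ (by positivity) ?_)
    rw [sq_mul_ofReal_re]
    gcongr
  have hexp : ‖Complex.exp (w * (fE μ S z u : ℂ))‖ ≤ Real.exp (R * CE) := by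
    rw [Complex.norm_exp, Complex.re_mul_ofReal]
    refine Real.exp_le_exp.2 ((le_abs_self _).trans ?_)
    rw [abs_mul]
    exact mul_le_mul ((Complex.abs_re_le_norm w).trans hwR) (hE u hu) (abs_nonneg _)
      ((norm_nonneg w).trans hwR)
  -- Decay of order `p` gives the bound by `1`, decay of order `p + 1` the bound by `1 / ‖u‖`.
  have hmain : a ^ p * realBessel ρ (a * κ) ≤ K * min 1 (1 / ‖u‖) := by
    have h1' := h1 (a * κ) (by positivity)
    have h2' := h2 (a * κ) (by positivity)
    rw [mul_pow] at h1' h2'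
    have hx1 : a ^ p * realBessel ρ (a * κ) ≤ C1 / κ ^ p := by
      rw [le_div_iff₀ (by positivity)]; linarith
    have hx2 : a ^ p * realBessel ρ (a * κ) ≤ C2 / (κ ^ (p + 1) * cA) * (1 / ‖u‖) := by
      rw [div_mul_div_comm, mul_one, le_div_iff₀ (by positivity)]
      calc a ^ p * realBessel ρ (a * κ) * (κ ^ (p + 1) * cA * ‖u‖)
          = a ^ p * realBessel ρ (a * κ) * κ ^ (p + 1) * (cA * ‖u‖) := by ring
        _ ≤ a ^ p * realBessel ρ (a * κ) * κ ^ (p + 1) * a := by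
            have := realBessel_nonneg ρ (a * κ)
            gcongr
        _ = a ^ (p + 1) * κ ^ (p + 1) * realBessel ρ (a * κ) := by ring
        _ ≤ C2 := h2'
    rcases le_total 1 (1 / ‖u‖) with h | h
    · rw [min_eq_left h, mul_one]; exact hx1.trans (le_max_left _ _)
    · rw [min_eq_right h]
      exact hx2.trans (mul_le_mul_of_nonneg_right (le_max_right _ _) (by positivity))
  rw [besselTerm_eq hn hS hz ρ hw hu, norm_div, norm_mul, Complex.norm_real,
    Real.norm_of_nonneg hDpos.le]
  calc a ^ p * (‖Complex.exp (w * (fE μ S z u : ℂ))‖ * ‖cBessel ρ (w * (fA μ S z u : ℂ))‖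
        / fD S z u)
      ≤ a ^ p * (Real.exp (R * CE) * realBessel ρ (a * κ) / cD) := by
        have := hD u hu
        gcongr
        exact mul_nonneg (Real.exp_pos _).le (realBessel_nonneg _ _)
    _ = Real.exp (R * CE) * (a ^ p * realBessel ρ (a * κ)) / cD := by ring
    _ ≤ Real.exp (R * CE) * (K * min 1 (1 / ‖u‖)) / cD := by gcongr
    _ = _ := by ring

section Derivative

variable (hn : 2 ≤ n) (μ : EuclideanSpace ℝ (Fin n)) {S : Matrix (Fin n) (Fin n) ℝ}
  (hS : S.PosDef) {z : EuclideanSpace ℝ (Fin n)} (hz : z ∈ nonzeroCoords n)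
  {U : Measure (EuclideanSpace ℝ (Fin n))} (hU : IsThorinMeasure U)
include hn hS hz hU

lemma integrableOn_besselTerm {w : ℂ} (hw : w ∈ besselDomain) :
    IntegrableOn (besselTerm ((n : ℝ) / 2) μ S z w) (posOrthant n) U := by
  have hn0 : 0 < n := by omega
  have hρ : 0 < (n : ℝ) / 2 + (0 : ℕ) := by
    have : (0 : ℝ) < n := by exact_mod_cast hn0
    push_cast; linarith
  obtain ⟨C, hC, h⟩ := exists_norm_besselTerm_le hn0 μ hS hz hρ hw.2 ‖w‖
  refine Integrable.mono' (hU.integrable_min.const_mul C).integrableOn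
    (aestronglyMeasurable_besselTerm hn0 μ hS hz _ hw U) ?_
  filter_upwards [ae_restrict_mem measurableSet_posOrthant] with u hu
  simpa using h w hw le_rfl le_rfl u hu

lemma integrableOn_fE_mul_besselTerm {w : ℂ} (hw : w ∈ besselDomain) :
    IntegrableOn (fun u => (fE μ S z u : ℂ) * besselTerm ((n : ℝ) / 2) μ S z w u)
      (posOrthant n) U := by
  obtain ⟨C, hC, h⟩ := exists_abs_fE_le μ hS z
  have hE := (measurable_fE μ S).comp (measurable_prodMk_left (x := z))
  refine Integrable.bdd_mul (integrableOn_besselTerm hn μ hS hz hU hw)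
    (Complex.measurable_ofReal.comp hE).aestronglyMeasurable (c := C) ?_
  filter_upwards [ae_restrict_mem measurableSet_posOrthant] with u hu
  simpa using h u hu

lemma integrableOn_fA_sq_mul_besselTerm {w : ℂ} (hw : w ∈ besselDomain) :
    IntegrableOn (fun u => (fA μ S z u : ℂ) ^ 2 * besselTerm (((n : ℝ) - 2) / 2) μ S z w u)
      (posOrthant n) U := by
  have hn0 : 0 < n := by omega
  have hρ : 0 < ((n : ℝ) - 2) / 2 + (1 : ℕ) := by
    have : (0 : ℝ) < n := by exact_mod_cast hn0
    push_cast; linarith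
  obtain ⟨C, hC, h⟩ := exists_norm_besselTerm_le hn0 μ hS hz hρ hw.2 ‖w‖
  have hA := (measurable_fA μ S).comp (measurable_prodMk_left (x := z))
  refine Integrable.mono' (hU.integrable_min.const_mul C).integrableOn
    (((Complex.measurable_ofReal.comp hA).pow_const 2).aestronglyMeasurable.mul
      (aestronglyMeasurable_besselTerm hn0 μ hS hz _ hw U)) ?_
  filter_upwards [ae_restrict_mem measurableSet_posOrthant] with u hu
  simpa using h w hw le_rfl le_rfl u hu

/-- Differentiation under the integral, using `𝔎_ρ' (w) = -w 𝔎_{ρ - 1} (w)`. -/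
lemma hasDerivAt_fH {w : ℂ} (hw : w ∈ besselDomain) :
    HasDerivAt (fH μ S U z)
      ((cConst n : ℂ) * (∫ u in posOrthant n, (fE μ S z u : ℂ)
          * besselTerm ((n : ℝ) / 2) μ S z w u ∂U)
        - (cConst n : ℂ) * w * (∫ u in posOrthant n, (fA μ S z u : ℂ) ^ 2
          * besselTerm (((n : ℝ) - 2) / 2) μ S z w u ∂U)) w := by
  have hn0 : 0 < n := by omega
  have hnR : (0 : ℝ) < n := by exact_mod_cast hn0
  have hρ : 0 < (n : ℝ) / 2 + (0 : ℕ) := by push_cast; linarith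
  have hρ' : 0 < ((n : ℝ) - 2) / 2 + (1 : ℕ) := by push_cast; linarith
  set s : Set ℂ := {v | v ∈ besselDomain ∧ (w ^ 2).re / 2 < (v ^ 2).re ∧ ‖v‖ < ‖w‖ + 1} with hsdef
  have hs : s ∈ 𝓝 w := by
    have h1 : IsOpen {v : ℂ | (w ^ 2).re / 2 < (v ^ 2).re} := isOpen_lt (by fun_prop) (by fun_prop)
    have h2 : IsOpen {v : ℂ | ‖v‖ < ‖w‖ + 1} := isOpen_lt (by fun_prop) (by fun_prop)
    exact (isOpen_besselDomain.inter (h1.inter h2)).mem_nhds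
      ⟨hw, half_lt_self hw.2, lt_add_one ‖w‖⟩
  have hw2 : 0 < (w ^ 2).re / 2 := half_pos hw.2
  obtain ⟨CE, hCE, hE⟩ := exists_abs_fE_le μ hS z
  obtain ⟨C, hC, h⟩ := exists_norm_besselTerm_le hn0 μ hS hz hρ hw2 (‖w‖ + 1)
  obtain ⟨C', hC', h'⟩ := exists_norm_besselTerm_le hn0 μ hS hz hρ' hw2 (‖w‖ + 1)
  have hi1 := integrableOn_fE_mul_besselTerm hn μ hS hz hU hw
  have hi2 := integrableOn_fA_sq_mul_besselTerm hn μ hS hz hU hw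
  have key := hasDerivAt_integral_of_dominated_loc_of_deriv_le (μ := U.restrict (posOrthant n))
    (F := fun (v : ℂ) u => besselTerm ((n : ℝ) / 2) μ S z v u)
    (F' := fun (v : ℂ) u => (fE μ S z u : ℂ) * besselTerm ((n : ℝ) / 2) μ S z v u
      - v * ((fA μ S z u : ℂ) ^ 2 * besselTerm (((n : ℝ) - 2) / 2) μ S z v u))
    (bound := fun u => (CE * C + (‖w‖ + 1) * C') * min 1 (1 / ‖u‖))
    (x₀ := w) hs ?_ (integrableOn_besselTerm hn μ hS hz hU hw)
    (hi1.sub (hi2.const_mul w)).aestronglyMeasurable ?_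
    (hU.integrable_min.const_mul _).integrableOn ?_
  · have h2 := key.2.const_mul (cConst n : ℂ)
    rw [integral_sub hi1 (hi2.const_mul w), integral_const_mul, mul_sub, ← mul_assoc] at h2
    exact h2
  · filter_upwards [isOpen_besselDomain.mem_nhds hw] with v hv
    exact aestronglyMeasurable_besselTerm hn0 μ hS hz _ hv U
  · filter_upwards [ae_restrict_mem measurableSet_posOrthant] with u hu v hv
    have b1 := h v hv.1 hv.2.1.le hv.2.2.le u hu
    have b2 := h' v hv.1 hv.2.1.le hv.2.2.le u hu
    simp only [pow_zero, one_mul, pow_one] at b1 b2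
    refine (norm_sub_le _ _).trans ?_
    rw [norm_mul, norm_mul, norm_mul, norm_pow, Complex.norm_real, Complex.norm_real,
      Real.norm_eq_abs, Real.norm_eq_abs, sq_abs, add_mul, mul_assoc, mul_assoc]
    exact add_le_add (mul_le_mul (hE u hu) b1 (norm_nonneg _) hCE.le)
      (mul_le_mul hv.2.2.le b2 (by positivity) (by positivity))
  · filter_upwards [ae_restrict_mem measurableSet_posOrthant] with u hu v hv
    have hA := fA_pos hn0 (μ := μ) hS hz hu
    have hvA := mul_ofReal_mem_besselDomain hv.1 hA
    have d1 : HasDerivAt (fun v : ℂ => v * (fA μ S z u : ℂ)) (fA μ S z u : ℂ) v := by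
      simpa using (hasDerivAt_id v).mul_const (fA μ S z u : ℂ)
    have d2 : HasDerivAt (fun v : ℂ => v * (fE μ S z u : ℂ)) (fE μ S z u : ℂ) v := by
      simpa using (hasDerivAt_id v).mul_const (fE μ S z u : ℂ)
    have d3 := (hasDerivAt_cBessel ((n : ℝ) / 2) hvA.2).comp v d1
    have d4 := (d2.cexp.mul d3).div_const (fD S z u : ℂ)
    have d5 := d4.congr_of_eventuallyEq (f₁ := fun v => besselTerm ((n : ℝ) / 2) μ S z v u) (by
      filter_upwards [isOpen_besselDomain.mem_nhds hv.1] with v' hv'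
      exact besselTerm_eq hn0 hS hz _ hv' hu)
    convert! d5 using 1
    rw [besselTerm_eq hn0 hS hz _ hv.1 hu, besselTerm_eq hn0 hS hz _ hv.1 hu,
      show ((n : ℝ) - 2) / 2 = (n : ℝ) / 2 - 1 by ring]
    simp only [Function.comp]
    ring

end Derivative

lemma fH_ofReal (hn : 0 < n) (μ : EuclideanSpace ℝ (Fin n)) {S : Matrix (Fin n) (Fin n) ℝ}
    (hS : S.PosDef) {z : EuclideanSpace ℝ (Fin n)} (hz : z ∈ nonzeroCoords n)
    (U : Measure (EuclideanSpace ℝ (Fin n))) {r : ℝ} (hr : 0 < r) :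
    fH μ S U z r = ((cConst n * ∫ u in posOrthant n, Real.exp (r * fE μ S z u)
      * realBessel ((n : ℝ) / 2) ((r * fA μ S z u) ^ 2) / fD S z u ∂U : ℝ) : ℂ) := by
  rw [fH, Complex.ofReal_mul, ← integral_complex_ofReal]
  congr 1
  exact setIntegral_congr_fun measurableSet_posOrthant fun u hu =>
    besselTerm_ofReal hn hS hz _ hr hu

lemma cConst_nonneg (n : ℕ) : 0 ≤ cConst n := by unfold cConst; positivity

lemma fH_ofReal_im_re (hn : 0 < n) (μ : EuclideanSpace ℝ (Fin n))
    {S : Matrix (Fin n) (Fin n) ℝ} (hS : S.PosDef) {z : EuclideanSpace ℝ (Fin n)}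
    (hz : z ∈ nonzeroCoords n) (U : Measure (EuclideanSpace ℝ (Fin n))) {r : ℝ} (hr : 0 < r) :
    (fH μ S U z r).im = 0 ∧ 0 ≤ (fH μ S U z r).re := by
  rw [fH_ofReal hn μ hS hz U hr]
  refine ⟨Complex.ofReal_im _, ?_⟩
  rw [Complex.ofReal_re]
  refine mul_nonneg (cConst_nonneg n) (setIntegral_nonneg measurableSet_posOrthant fun u hu => ?_)
  exact div_nonneg (mul_nonneg (Real.exp_pos _).le (realBessel_nonneg _ _)) (fD_pos hS hz hu).le

/-! ### The derivative at the origin -/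

lemma lintegral_fE_div_fD_le (μ : EuclideanSpace ℝ (Fin n)) {S : Matrix (Fin n) (Fin n) ℝ}
    (hS : S.PosDef) {z : EuclideanSpace ℝ (Fin n)} (hz : z ∈ nonzeroCoords n)
    (U : Measure (EuclideanSpace ℝ (Fin n))) :
    ∫⁻ u in posOrthant n, ENNReal.ofReal (|fE μ S z u| / fD S z u) ∂U
      ≤ ∫⁻ u in posOrthant n, ENNReal.ofReal (fA μ S z u / fD S z u) ∂U := by
  refine setLIntegral_mono' measurableSet_posOrthant fun u hu => ENNReal.ofReal_le_ofReal ?_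
  have := fD_pos hS hz hu
  have := abs_fE_le_fA (μ := μ) hS z hu
  gcongr

/-- The first term of the derivative converges by dominated convergence with majorant
`|𝔈| / 𝔇`, the second one vanishes in the limit with majorant `𝔄 / 𝔇`. -/
lemma tendsto_deriv_fH (hn : 2 ≤ n) (μ : EuclideanSpace ℝ (Fin n))
    {S : Matrix (Fin n) (Fin n) ℝ} (hS : S.PosDef) {z : EuclideanSpace ℝ (Fin n)}
    (hz : z ∈ nonzeroCoords n) {U : Measure (EuclideanSpace ℝ (Fin n))} (hU : IsThorinMeasure U)
    (hfin : ∫⁻ u in posOrthant n, ENNReal.ofReal (fA μ S z u / fD S z u) ∂U < ∞) :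
    Tendsto (fun r : ℝ => deriv (fun x : ℝ => fH μ S U z (x : ℂ)) r) (𝓝[>] (0 : ℝ))
      (𝓝 ((cConst n * (2 : ℝ) ^ (((n : ℝ) - 2) / 2) * Real.Gamma ((n : ℝ) / 2)
        * ∫ u in posOrthant n, fE μ S z u / fD S z u ∂U : ℝ) : ℂ)) := by
  have hn0 : 0 < n := by omega
  have hnR : (2 : ℝ) ≤ n := by exact_mod_cast hn
  have hEm := (measurable_fE μ S).comp (measurable_prodMk_left (x := z))
  have hAm := (measurable_fA μ S).comp (measurable_prodMk_left (x := z))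
  have hDm := (measurable_fD S).comp (measurable_prodMk_left (x := z))
  have hIA : IntegrableOn (fun u => fA μ S z u / fD S z u) (posOrthant n) U := by
    refine ⟨(hAm.div hDm).aestronglyMeasurable, ?_⟩
    refine lt_of_le_of_lt (le_of_eq ?_) hfin
    refine setLIntegral_congr_fun measurableSet_posOrthant fun u hu => ?_
    exact Real.enorm_eq_ofReal (div_nonneg (fA_nonneg _ _ _ _) (fD_pos hS hz hu).le)
  obtain ⟨CE, hCE, hE⟩ := exists_abs_fE_le μ hS z
  obtain ⟨C1, hC1, h1⟩ := exists_rpow_mul_realBessel_le (ρ := (n : ℝ) / 2) (p := 0) le_rfl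
    (by linarith)
  obtain ⟨C2, hC2, h2⟩ := exists_rpow_mul_realBessel_le (ρ := ((n : ℝ) - 2) / 2) (p := 1 / 2)
    (by norm_num) (by linarith)
  simp only [Real.rpow_zero, one_mul] at h1
  have hexp : ∀ u ∈ posOrthant n, ∀ r ∈ Ioo (0 : ℝ) 1, Real.exp (r * fE μ S z u) ≤ Real.exp CE := by
    intro u hu r hr
    refine Real.exp_le_exp.2 ((le_abs_self _).trans ?_)
    rw [abs_mul, abs_of_pos hr.1]
    nlinarith [hE u hu, abs_nonneg (fE μ S z u), hr.1, hr.2]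
  have hIoo : ∀ᶠ r : ℝ in 𝓝[>] 0, r ∈ Ioo (0 : ℝ) 1 := Ioo_mem_nhdsGT one_pos
  have hsq : ∀ u ∈ posOrthant n, Tendsto (fun r => (r * fA μ S z u) ^ 2) (𝓝[>] 0) (𝓝[>] 0) := by
    intro u hu
    refine tendsto_nhdsWithin_iff.2 ⟨?_, ?_⟩
    · exact (Continuous.tendsto' (by fun_prop) 0 0 (by simp)).mono_left nhdsWithin_le_nhds
    · filter_upwards [self_mem_nhdsWithin] with r (hr : 0 < r)
      exact pow_pos (mul_pos hr (fA_pos hn0 hS hz hu)) 2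
  have hexp0 : ∀ u, Tendsto (fun r => Real.exp (r * fE μ S z u)) (𝓝[>] 0) (𝓝 1) := fun u =>
    (Continuous.tendsto' (by fun_prop) 0 1 (by simp)).mono_left nhdsWithin_le_nhds
  have hm : ∀ (ρ r : ℝ), r ∈ Ioo (0 : ℝ) 1 →
      AEStronglyMeasurable (besselTerm ρ μ S z r) (U.restrict (posOrthant n)) := fun ρ r hr =>
    aestronglyMeasurable_besselTerm hn0 μ hS hz ρ (ofReal_mem_besselDomain hr.1) U
  have T1 : Tendsto (fun r : ℝ => ∫ u in posOrthant n,
      (fE μ S z u : ℂ) * besselTerm ((n : ℝ) / 2) μ S z r u ∂U) (𝓝[>] 0)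
      (𝓝 (∫ u in posOrthant n, ((fE μ S z u * (1 * (2 ^ ((n : ℝ) / 2 - 1)
        * Real.Gamma ((n : ℝ) / 2)) / fD S z u) : ℝ) : ℂ) ∂U)) := by
    refine tendsto_integral_filter_of_dominated_convergence
      (fun u => Real.exp CE * C1 * (fA μ S z u / fD S z u)) ?_ ?_ (hIA.const_mul _) ?_
    · filter_upwards [hIoo] with r hr
      exact (Complex.measurable_ofReal.comp hEm).aestronglyMeasurable.mul (hm _ r hr)
    · filter_upwards [hIoo] with r hr
      filter_upwards [ae_restrict_mem measurableSet_posOrthant] with u hu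
      have hD := fD_pos hS hz hu
      have hA := fA_pos hn0 (μ := μ) hS hz hu
      have hB := h1 ((r * fA μ S z u) ^ 2) (pow_pos (mul_pos hr.1 hA) 2)
      have hB0 := realBessel_nonneg ((n : ℝ) / 2) ((r * fA μ S z u) ^ 2)
      rw [besselTerm_ofReal hn0 hS hz _ hr.1 hu, ← Complex.ofReal_mul, Complex.norm_real,
        norm_mul, Real.norm_eq_abs, Real.norm_of_nonneg (by positivity)]
      calc |fE μ S z u| * (Real.exp (r * fE μ S z u)
            * realBessel ((n : ℝ) / 2) ((r * fA μ S z u) ^ 2) / fD S z u)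
          ≤ fA μ S z u * (Real.exp CE * C1 / fD S z u) := by
            have := hexp u hu r hr
            have := abs_fE_le_fA (μ := μ) hS z hu
            gcongr
        _ = _ := by ring
    · filter_upwards [ae_restrict_mem measurableSet_posOrthant] with u hu
      have hlim := ((hexp0 u).mul ((tendsto_realBessel (ρ := (n : ℝ) / 2) (by linarith)).comp
        (hsq u hu))).div_const (fD S z u) |>.const_mul (fE μ S z u)
      refine ((Complex.continuous_ofReal.tendsto _).comp hlim).congr' ?_
      filter_upwards [hIoo] with r hr
      rw [besselTerm_ofReal hn0 hS hz _ hr.1 hu, ← Complex.ofReal_mul]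
      rfl
  have T2 : Tendsto (fun r : ℝ => ∫ u in posOrthant n, (r : ℂ) * ((fA μ S z u : ℂ) ^ 2
      * besselTerm (((n : ℝ) - 2) / 2) μ S z r u) ∂U) (𝓝[>] 0)
      (𝓝 (∫ u in posOrthant n, ((fA μ S z u * (1 * 0 / fD S z u) : ℝ) : ℂ) ∂U)) := by
    -- One factor `r 𝔄` goes with `𝔎_{(n-2)/2}(r 𝔄)`, and the product tends to `0`.
    have hrew : ∀ u ∈ posOrthant n, ∀ r ∈ Ioo (0 : ℝ) 1,
        (r : ℂ) * ((fA μ S z u : ℂ) ^ 2 * besselTerm (((n : ℝ) - 2) / 2) μ S z r u)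
        = ((fA μ S z u * (Real.exp (r * fE μ S z u) * (((r * fA μ S z u) ^ 2) ^ (1 / 2 : ℝ)
          * realBessel (((n : ℝ) - 2) / 2) ((r * fA μ S z u) ^ 2)) / fD S z u) : ℝ) : ℂ) := by
      intro u hu r hr
      have hA := fA_pos hn0 (μ := μ) hS hz hu
      rw [besselTerm_ofReal hn0 hS hz _ hr.1 hu, ← Real.sqrt_eq_rpow,
        Real.sqrt_sq (mul_pos hr.1 hA).le]
      push_cast
      ring
    refine tendsto_integral_filter_of_dominated_convergence
      (fun u => Real.exp CE * C2 * (fA μ S z u / fD S z u)) ?_ ?_ (hIA.const_mul _) ?_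
    · filter_upwards [hIoo] with r hr
      exact (((Complex.measurable_ofReal.comp hAm).pow_const 2).aestronglyMeasurable.mul
        (hm _ r hr)).const_mul _
    · filter_upwards [hIoo] with r hr
      filter_upwards [ae_restrict_mem measurableSet_posOrthant] with u hu
      have hD := fD_pos hS hz hu
      have hA := fA_pos hn0 (μ := μ) hS hz hu
      have hB := h2 ((r * fA μ S z u) ^ 2) (pow_pos (mul_pos hr.1 hA) 2)
      have hB0 := realBessel_nonneg (((n : ℝ) - 2) / 2) ((r * fA μ S z u) ^ 2)
      rw [hrew u hu r hr, Complex.norm_real, Real.norm_of_nonneg (by positivity)]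
      calc fA μ S z u * (Real.exp (r * fE μ S z u) * (((r * fA μ S z u) ^ 2) ^ (1 / 2 : ℝ)
          * realBessel (((n : ℝ) - 2) / 2) ((r * fA μ S z u) ^ 2)) / fD S z u)
          ≤ fA μ S z u * (Real.exp CE * C2 / fD S z u) := by
            have := hexp u hu r hr
            gcongr
        _ = _ := by ring
    · filter_upwards [ae_restrict_mem measurableSet_posOrthant] with u hu
      have hlim := ((hexp0 u).mul ((tendsto_sqrt_mul_realBessel (ρ := ((n : ℝ) - 2) / 2)
        (by linarith)).comp (hsq u hu))).div_const (fD S z u) |>.const_mul (fA μ S z u)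
      refine ((Complex.continuous_ofReal.tendsto _).comp hlim).congr' ?_
      filter_upwards [hIoo] with r hr
      rw [hrew u hu r hr]
      rfl
  have T := (T1.const_mul (cConst n : ℂ)).sub (T2.const_mul (cConst n : ℂ))
  refine (T.congr' ?_).trans_eq ?_
  · filter_upwards [hIoo] with r hr
    have hd := (hasDerivAt_fH hn μ hS hz hU (ofReal_mem_besselDomain hr.1)).comp_ofReal
    rw [hd.deriv, integral_const_mul, mul_assoc]
  · congr 1
    simp only [mul_zero, zero_div, Complex.ofReal_zero, integral_zero, sub_zero]
    rw [integral_complex_ofReal, ← Complex.ofReal_mul, Complex.ofReal_inj,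
      show ((n : ℝ) - 2) / 2 = (n : ℝ) / 2 - 1 by ring, mul_assoc (cConst n), mul_assoc (cConst n)]
    congr 1
    rw [← integral_const_mul]
    refine integral_congr_ae (.of_forall fun u => ?_)
    simp only
    ring

/-! ### Uniqueness of the Lévy measure -/

/-- A density that is positive and finite on `C` determines the measure on `C`. -/
lemma restrict_eq_of_withDensity_eq {α : Type*} [MeasurableSpace α] {ν₁ ν₂ : Measure α}
    {f : α → ℝ≥0∞} (hf : Measurable f) {C : Set α} (hC : MeasurableSet C)
    (hf0 : ∀ x ∈ C, f x ≠ 0) (hf1 : ∀ x, f x ≠ ∞)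
    (h : ∀ A, MeasurableSet A → A ⊆ C → ν₁.withDensity f A = ν₂.withDensity f A) :
    ν₁.restrict C = ν₂.restrict C := by
  have h1 : (ν₁.restrict C).withDensity f = (ν₂.restrict C).withDensity f := by
    rw [← restrict_withDensity hC, ← restrict_withDensity hC]
    ext A hA
    rw [Measure.restrict_apply hA, Measure.restrict_apply hA]
    exact h _ (hA.inter hC) inter_subset_right
  have h2 (ν : Measure α) : ((ν.restrict C).withDensity f).withDensity f⁻¹ = ν.restrict C :=
    withDensity_inv_same hf ((ae_restrict_mem hC).mono hf0) (.of_forall hf1)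
  rw [← h2 ν₁, h1, h2]

/-- Comparison of the derivatives at `t = 0` avoids complex logarithms. -/
lemma eq_of_forall_exp_mul_eq {a b : ℂ}
    (h : ∀ t : ℝ≥0, Complex.exp ((t : ℝ) * a) = Complex.exp ((t : ℝ) * b)) : a = b := by
  have hd : ∀ c : ℂ, HasDerivWithinAt (fun t : ℝ => Complex.exp (t * c)) c (Ici 0) 0 := fun c => by
    have h1 : HasDerivAt (fun t : ℂ => Complex.exp (t * c)) c ((0 : ℝ) : ℂ) := by
      simpa using ((hasDerivAt_id ((0 : ℝ) : ℂ)).mul_const c).cexp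
    exact h1.comp_ofReal.hasDerivWithinAt
  refine (uniqueDiffWithinAt_Ici (0 : ℝ)).eq_deriv _ (hd a) ((hd b).congr (fun t ht => ?_) ?_)
  · exact h ⟨t, ht⟩
  · simp

/-- The integrand of the Lévy-Khintchine formula. -/
def levyIntegrand (θ x : EuclideanSpace ℝ (Fin n)) : ℂ :=
  Complex.exp (Complex.I * (inner ℝ θ x : ℝ)) - 1
    - Complex.I * (inner ℝ θ x : ℝ)
      * (Metric.closedBall (0 : EuclideanSpace ℝ (Fin n)) 1).indicator (fun _ => (1 : ℂ)) x

lemma measurable_levyIntegrand (θ : EuclideanSpace ℝ (Fin n)) :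
    Measurable (levyIntegrand θ) := by
  unfold levyIntegrand
  have h1 : Measurable fun x : EuclideanSpace ℝ (Fin n) => Complex.I * (inner ℝ θ x : ℝ) :=
    Continuous.measurable (by fun_prop)
  exact ((Complex.measurable_exp.comp h1).sub_const 1).sub
    (h1.mul (measurable_const.indicator Metric.isClosed_closedBall.measurableSet))

lemma norm_exp_I_mul_sub_one_le (y : ℝ) : ‖Complex.exp (Complex.I * y) - 1‖ ≤ 2 := by
  refine (norm_sub_le _ _).trans ?_
  rw [mul_comm, Complex.norm_exp_ofReal_mul_I]; norm_num

lemma norm_exp_I_mul_sub_one_sub_le (y : ℝ) :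
    ‖Complex.exp (Complex.I * y) - 1 - Complex.I * y‖ ≤ 3 * y ^ 2 := by
  have hy : ‖Complex.I * (y : ℂ)‖ = |y| := by simp
  rcases le_total |y| 1 with h | h
  · have := Complex.norm_exp_sub_one_sub_id_le (x := Complex.I * y) (by rwa [hy])
    rw [hy, sq_abs] at this
    nlinarith [sq_nonneg y]
  · refine (norm_sub_le _ _).trans ?_
    rw [hy]
    have := norm_exp_I_mul_sub_one_le y
    nlinarith [sq_abs y]

lemma IsLevyMeasure.integrable_min {ν : Measure (EuclideanSpace ℝ (Fin n))}
    (hν : IsLevyMeasure ν) : Integrable (fun x => min 1 (‖x‖ ^ 2)) ν := by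
  refine ⟨by fun_prop, lt_of_le_of_lt (le_of_eq ?_) hν.finite⟩
  exact lintegral_congr fun x => Real.enorm_eq_ofReal (by positivity)

lemma integrable_levyIntegrand {ν : Measure (EuclideanSpace ℝ (Fin n))}
    (hν : IsLevyMeasure ν) (θ : EuclideanSpace ℝ (Fin n)) : Integrable (levyIntegrand θ) ν := by
  refine Integrable.mono' (hν.integrable_min.const_mul (2 + 3 * ‖θ‖ ^ 2))
    (measurable_levyIntegrand θ).aestronglyMeasurable (.of_forall fun x => ?_)
  unfold levyIntegrand
  by_cases hx : x ∈ Metric.closedBall (0 : EuclideanSpace ℝ (Fin n)) 1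
  · rw [indicator_of_mem hx, mul_one]
    have hx1 : ‖x‖ ≤ 1 := by simpa using hx
    rw [min_eq_right (by nlinarith [norm_nonneg x])]
    refine (norm_exp_I_mul_sub_one_sub_le _).trans ?_
    have h2 : (inner ℝ θ x : ℝ) ^ 2 ≤ ‖θ‖ ^ 2 * ‖x‖ ^ 2 := by
      rw [← mul_pow, ← sq_abs]
      exact pow_le_pow_left₀ (abs_nonneg _) (abs_real_inner_le_norm θ x) 2
    nlinarith [sq_nonneg ‖x‖]
  · rw [indicator_of_notMem hx, mul_zero, sub_zero]
    have hx1 : 1 < ‖x‖ := by simpa using hx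
    rw [min_eq_left (by nlinarith)]
    refine (norm_exp_I_mul_sub_one_le _).trans ?_
    nlinarith [sq_nonneg ‖θ‖]

lemma levyExponent_eq (b : EuclideanSpace ℝ (Fin n)) (Q : Matrix (Fin n) (Fin n) ℝ)
    (ν : Measure (EuclideanSpace ℝ (Fin n))) (θ : EuclideanSpace ℝ (Fin n)) :
    levyExponent b Q ν θ = Complex.I * (inner ℝ b θ : ℝ) - (1 / 2 : ℂ) * (matInner Q θ θ : ℝ)
      + ∫ x, levyIntegrand θ x ∂ν := rfl

/-- The second difference `ψ(θ) - (ψ(θ + h) + ψ(θ - h)) / 2` of the characteristic exponent `ψ` in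
the direction `h` is the characteristic function of this finite measure. -/
def secondDifferenceMeasure (Q : Matrix (Fin n) (Fin n) ℝ)
    (ν : Measure (EuclideanSpace ℝ (Fin n))) (h : EuclideanSpace ℝ (Fin n)) :
    Measure (EuclideanSpace ℝ (Fin n)) :=
  ν.withDensity (fun x => ENNReal.ofReal (1 - Real.cos (inner ℝ h x)))
    + ENNReal.ofReal (matInner Q h h / 2) • Measure.dirac 0

lemma secondDifference_levyIntegrand (θ h x : EuclideanSpace ℝ (Fin n)) :
    levyIntegrand θ x - (levyIntegrand (θ + h) x + levyIntegrand (θ - h) x) / 2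
      = (1 - Real.cos (inner ℝ h x) : ℝ) * Complex.exp ((inner ℝ x θ : ℝ) * Complex.I) := by
  unfold levyIntegrand
  rw [real_inner_comm θ x]
  simp only [inner_add_left, inner_sub_left]
  push_cast
  rw [Complex.cos, show Complex.I * ((inner ℝ θ x : ℂ) + (inner ℝ h x : ℂ))
      = (inner ℝ θ x : ℂ) * Complex.I + (inner ℝ h x : ℂ) * Complex.I by ring,
    show Complex.I * ((inner ℝ θ x : ℂ) - (inner ℝ h x : ℂ))
      = (inner ℝ θ x : ℂ) * Complex.I + -(inner ℝ h x : ℂ) * Complex.I by ring,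
    Complex.exp_add, Complex.exp_add, mul_comm Complex.I]
  ring

lemma integrable_one_sub_cos {ν : Measure (EuclideanSpace ℝ (Fin n))}
    (hν : IsLevyMeasure ν) (h : EuclideanSpace ℝ (Fin n)) :
    Integrable (fun x => 1 - Real.cos (inner ℝ h x)) ν := by
  have h1 := ((integrable_levyIntegrand hν 0).sub (((integrable_levyIntegrand hν (0 + h)).add
    (integrable_levyIntegrand hν (0 - h))).div_const 2)).re
  refine h1.congr (.of_forall fun x => ?_)
  simp only [Pi.sub_apply, Pi.add_apply]
  rw [secondDifference_levyIntegrand]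
  simp [-Complex.ofReal_sub]

lemma isFiniteMeasure_secondDifferenceMeasure (Q : Matrix (Fin n) (Fin n) ℝ)
    {ν : Measure (EuclideanSpace ℝ (Fin n))} (hν : IsLevyMeasure ν)
    (h : EuclideanSpace ℝ (Fin n)) : IsFiniteMeasure (secondDifferenceMeasure Q ν h) := by
  unfold secondDifferenceMeasure
  have h1 : IsFiniteMeasure (ν.withDensity fun x => ENNReal.ofReal (1 - Real.cos (inner ℝ h x))) :=
    isFiniteMeasure_withDensity_ofReal (integrable_one_sub_cos hν h).2
  have h2 : IsFiniteMeasure (ENNReal.ofReal (matInner Q h h / 2) •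
    (Measure.dirac 0 : Measure (EuclideanSpace ℝ (Fin n)))) :=
    Measure.smul_finite _ ENNReal.ofReal_ne_top
  infer_instance

lemma charFun_secondDifferenceMeasure {b : EuclideanSpace ℝ (Fin n)}
    {Q : Matrix (Fin n) (Fin n) ℝ} (hQ : Q.PosSemidef)
    {ν : Measure (EuclideanSpace ℝ (Fin n))} (hν : IsLevyMeasure ν)
    (h θ : EuclideanSpace ℝ (Fin n)) :
    charFun (secondDifferenceMeasure Q ν h) θ = levyExponent b Q ν θ
      - (levyExponent b Q ν (θ + h) + levyExponent b Q ν (θ - h)) / 2 := by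
  have hi := integrable_levyIntegrand hν
  have hfin := isFiniteMeasure_secondDifferenceMeasure Q hν h
  have hf2 : IsFiniteMeasure (ENNReal.ofReal (matInner Q h h / 2) •
    (Measure.dirac 0 : Measure (EuclideanSpace ℝ (Fin n)))) :=
    Measure.smul_finite _ ENNReal.ofReal_ne_top
  have hf1 : IsFiniteMeasure (ν.withDensity fun x => ENNReal.ofReal (1 - Real.cos (inner ℝ h x))) :=
    isFiniteMeasure_withDensity_ofReal (integrable_one_sub_cos hν h).2
  have hcos : ∀ x : EuclideanSpace ℝ (Fin n), 0 ≤ 1 - Real.cos (inner ℝ h x) := fun x => by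
    linarith [Real.cos_le_one (inner ℝ h x)]
  have hexpm : Measurable fun x : EuclideanSpace ℝ (Fin n) =>
      Complex.exp ((inner ℝ x θ : ℝ) * Complex.I) := Continuous.measurable (by fun_prop)
  have hexpi : ∀ m : Measure (EuclideanSpace ℝ (Fin n)), IsFiniteMeasure m →
      Integrable (fun x => Complex.exp ((inner ℝ x θ : ℝ) * Complex.I)) m := fun m _ =>
    Integrable.mono' (integrable_const (1 : ℝ)) hexpm.aestronglyMeasurable
      (.of_forall fun x => by rw [Complex.norm_exp_ofReal_mul_I])
  have hcm : Measurable fun x : EuclideanSpace ℝ (Fin n) =>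
      ENNReal.ofReal (1 - Real.cos (inner ℝ h x)) := by
    have : Continuous fun x : EuclideanSpace ℝ (Fin n) => 1 - Real.cos (inner ℝ h x) := by fun_prop
    exact this.measurable.ennreal_ofReal
  have hQh : 0 ≤ matInner Q h h / 2 := by linarith [matInner_nonneg hQ h]
  rw [charFun_apply, secondDifferenceMeasure, integral_add_measure (hexpi _ hf1) (hexpi _ hf2),
    integral_smul_measure, integral_dirac, integral_withDensity_eq_integral_toReal_smul hcm
      (.of_forall fun x => ENNReal.ofReal_lt_top), ENNReal.toReal_ofReal hQh]
  have e1 : ∫ x, (ENNReal.ofReal (1 - Real.cos (inner ℝ h x))).toReal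
        • Complex.exp ((inner ℝ x θ : ℝ) * Complex.I) ∂ν
      = ∫ x, levyIntegrand θ x ∂ν
        - (∫ x, levyIntegrand (θ + h) x ∂ν + ∫ x, levyIntegrand (θ - h) x ∂ν) / 2 := by
    have hi2 : Integrable (fun x => (levyIntegrand (θ + h) x + levyIntegrand (θ - h) x) / 2) ν :=
      ((hi _).add (hi _)).div_const 2
    rw [← integral_add (hi _) (hi _), ← integral_div, ← integral_sub (hi _) hi2]
    refine integral_congr_ae (.of_forall fun x => ?_)
    simp only
    rw [secondDifference_levyIntegrand, ENNReal.toReal_ofReal (hcos x), Complex.real_smul]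
  have e2 : matInner Q (θ + h) (θ + h) + matInner Q (θ - h) (θ - h)
      = 2 * matInner Q θ θ + 2 * matInner Q h h := by
    simp only [matInner, Finset.mul_sum, ← Finset.sum_add_distrib, PiLp.add_apply, PiLp.sub_apply]
    refine Finset.sum_congr rfl fun k _ => Finset.sum_congr rfl fun l _ => ?_
    ring
  have e3 : (matInner Q (θ + h) (θ + h) : ℂ) + (matInner Q (θ - h) (θ - h) : ℂ)
      = 2 * (matInner Q θ θ : ℂ) + 2 * (matInner Q h h : ℂ) := by exact_mod_cast e2
  rw [e1, levyExponent_eq, levyExponent_eq, levyExponent_eq, inner_add_right, inner_sub_right]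
  simp only [inner_zero_left, Complex.ofReal_zero, zero_mul, Complex.exp_zero, Complex.real_smul,
    mul_one]
  push_cast
  linear_combination (-1 / 4 : ℂ) * e3

/-- The laws of `X t` for small `t` determine the characteristic exponent, and its second
differences determine the measure. -/
lemma HasTriplet.levyMeasure_unique {Ω : Type*} [MeasurableSpace Ω] {P : Measure Ω}
    {X : ℝ≥0 → Ω → EuclideanSpace ℝ (Fin n)} {b₁ b₂ : EuclideanSpace ℝ (Fin n)}
    {Q₁ Q₂ : Matrix (Fin n) (Fin n) ℝ} {ν₁ ν₂ : Measure (EuclideanSpace ℝ (Fin n))}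
    (h₁ : HasTriplet P X b₁ Q₁ ν₁) (h₂ : HasTriplet P X b₂ Q₂ ν₂) : ν₁ = ν₂ := by
  have hψ : ∀ θ, levyExponent b₁ Q₁ ν₁ θ = levyExponent b₂ Q₂ ν₂ θ := fun θ =>
    eq_of_forall_exp_mul_eq fun t => by rw [← h₁.charFun_eq, ← h₂.charFun_eq]
  have hm : ∀ h, secondDifferenceMeasure Q₁ ν₁ h = secondDifferenceMeasure Q₂ ν₂ h := fun h => by
    have i1 := isFiniteMeasure_secondDifferenceMeasure Q₁ h₁.isLevyMeasure h
    have i2 := isFiniteMeasure_secondDifferenceMeasure Q₂ h₂.isLevyMeasure h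
    refine Measure.ext_of_charFun (funext fun θ => ?_)
    rw [charFun_secondDifferenceMeasure (b := b₁) h₁.posSemidef h₁.isLevyMeasure,
      charFun_secondDifferenceMeasure (b := b₂) h₂.posSemidef h₂.isLevyMeasure, hψ, hψ, hψ]
  -- On the set where `cos (x k / (m + 1)) ≠ 1` the density `1 - cos (x k / (m + 1))` is positive.
  let C : Fin n × ℕ → Set (EuclideanSpace ℝ (Fin n)) := fun p =>
    {x | Real.cos (x p.1 / (p.2 + 1)) ≠ 1}
  have hC : ∀ p, MeasurableSet (C p) := fun p => by
    have : Measurable fun x : EuclideanSpace ℝ (Fin n) => Real.cos (x p.1 / (p.2 + 1)) := by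
      fun_prop
    exact (measurableSet_eq_fun this measurable_const).compl
  have hC0 : ∀ p, (0 : EuclideanSpace ℝ (Fin n)) ∉ C p := fun p => by simp [C]
  have hres : ∀ p, ν₁.restrict (C p) = ν₂.restrict (C p) := fun p => by
    set h : EuclideanSpace ℝ (Fin n) := EuclideanSpace.single p.1 (1 / ((p.2 : ℝ) + 1)) with hh
    have hin : ∀ x, inner ℝ h x = x p.1 / (p.2 + 1) := fun x => by
      rw [hh, EuclideanSpace.inner_single_left]; simp [div_eq_mul_inv, mul_comm]
    refine restrict_eq_of_withDensity_eq
      (f := fun x => ENNReal.ofReal (1 - Real.cos (inner ℝ h x))) ?_ (hC p) ?_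
      (fun x => ENNReal.ofReal_ne_top) fun A hA hAC => ?_
    · have : Continuous fun x : EuclideanSpace ℝ (Fin n) => 1 - Real.cos (inner ℝ h x) := by
        fun_prop
      exact this.measurable.ennreal_ofReal
    · intro x hx
      rw [hin]
      have h1 : Real.cos (x p.1 / (p.2 + 1)) < 1 := lt_of_le_of_ne (Real.cos_le_one _) hx
      exact (ENNReal.ofReal_pos.2 (by linarith)).ne'
    · have h0 : (0 : EuclideanSpace ℝ (Fin n)) ∉ A := fun h0 => hC0 p (hAC h0)
      have := congrArg (fun m : Measure (EuclideanSpace ℝ (Fin n)) => m A) (hm h)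
      simpa [secondDifferenceMeasure, Measure.dirac_apply' _ hA, h0] using this
  have hunion : ⋃ p, C p = {0}ᶜ := by
    ext x
    simp only [mem_iUnion, mem_compl_iff, mem_singleton_iff]
    constructor
    · rintro ⟨p, hp⟩ rfl
      exact hC0 p hp
    · intro hx
      obtain ⟨k, hk⟩ : ∃ k, x k ≠ 0 := by
        by_contra! hcon
        exact hx (by ext k; simpa using hcon k)
      obtain ⟨m, hmx⟩ := exists_nat_gt |x k|
      refine ⟨(k, m), fun hcos => ?_⟩
      have hm0 : (0 : ℝ) < (m : ℝ) + 1 := by positivity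
      have hlt : |x k / ((m : ℝ) + 1)| < 1 := by
        rw [abs_div, abs_of_pos hm0, div_lt_one hm0]; linarith
      rw [abs_lt] at hlt
      have hpi := Real.pi_gt_three
      have := (Real.cos_eq_one_iff_of_lt_of_lt (by linarith) (by linarith)).1 hcos
      exact div_ne_zero hk hm0.ne' this
  have hr := Measure.restrict_iUnion_congr.2 hres
  rw [hunion] at hr
  have hfull : ∀ ν : Measure (EuclideanSpace ℝ (Fin n)), IsLevyMeasure ν → ν.restrict {0}ᶜ = ν :=
    fun ν hν => Measure.restrict_eq_self_of_ae_mem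
      (by rw [ae_iff]; simpa using hν.zero)
  rw [← hfull _ h₁.isLevyMeasure, hr, hfull _ h₂.isLevyMeasure]

/-! ### The Laplace exponent of a subordinator -/

lemma norm_exp_neg_sub_one_le {w : ℂ} (hw : 0 ≤ w.re) :
    ‖Complex.exp (-w) - 1‖ ≤ 2 * min 1 ‖w‖ := by
  rcases le_total ‖w‖ 1 with h | h
  · rw [min_eq_right h]
    simpa using Complex.norm_exp_sub_one_le (x := -w) (by simpa using h)
  · rw [min_eq_left h]
    refine (norm_sub_le _ _).trans ?_
    rw [Complex.norm_exp]
    have : Real.exp (-w).re ≤ 1 := Real.exp_le_one_iff.2 (by simpa using hw)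
    simp only [norm_one]
    linarith

lemma norm_exp_neg_mul_sub_one_le {z : ℂ} (hz : 0 ≤ z.re) {y : ℝ} (hy : 0 ≤ y) :
    ‖Complex.exp (-z * y) - 1‖ ≤ 2 * (1 + ‖z‖) * min 1 y := by
  have h1 : 0 ≤ (z * (y : ℂ)).re := by rw [Complex.re_mul_ofReal]; positivity
  have h2 := norm_exp_neg_sub_one_le h1
  rw [← neg_mul, norm_mul, Complex.norm_real, Real.norm_of_nonneg hy] at h2
  refine h2.trans ?_
  rw [mul_assoc]
  refine mul_le_mul_of_nonneg_left ?_ (by norm_num)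
  have hz0 := norm_nonneg z
  rcases le_total 1 y with h | h
  · rw [min_eq_left h]
    exact (min_le_left _ _).trans (by linarith)
  · rw [min_eq_right h]
    exact (min_le_right _ _).trans (by nlinarith)

lemma closure_right_half_plane : closure {z : ℂ | 0 < z.re} = {z : ℂ | 0 ≤ z.re} :=
  Complex.closure_setOfPred_lt_re 0

section LaplaceExponent

variable {α : Type*} [MeasurableSpace α] {m : Measure α} {Y : α → ℝ}

lemma measurable_exp_neg_mul_sub_one (hY : Measurable Y) (z : ℂ) :
    Measurable fun a => Complex.exp (-z * Y a) - 1 :=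
  (Complex.measurable_exp.comp ((Complex.measurable_ofReal.comp hY).const_mul (-z))).sub_const 1

lemma integrable_exp_neg_mul_sub_one (hY : Measurable Y) (hY0 : ∀ᵐ a ∂m, 0 ≤ Y a)
    (hint : Integrable (fun a => min 1 (Y a)) m) {z : ℂ} (hz : 0 ≤ z.re) :
    Integrable (fun a => Complex.exp (-z * Y a) - 1) m := by
  refine Integrable.mono' (hint.const_mul (2 * (1 + ‖z‖)))
    (measurable_exp_neg_mul_sub_one hY z).aestronglyMeasurable ?_
  filter_upwards [hY0] with a ha using norm_exp_neg_mul_sub_one_le hz ha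

/-- The Laplace exponent of a measure on `[0, ∞)` integrating `min 1 y` is holomorphic in the open
right half plane and continuous up to the boundary. -/
lemma diffContOnCl_integral_exp_neg_mul_sub_one (hY : Measurable Y) (hY0 : ∀ᵐ a ∂m, 0 ≤ Y a)
    (hint : Integrable (fun a => min 1 (Y a)) m) :
    DiffContOnCl ℂ (fun z : ℂ => ∫ a, (Complex.exp (-z * Y a) - 1) ∂m) {z | 0 < z.re} := by
  constructor
  · intro z hz
    refine DifferentiableAt.differentiableWithinAt ?_
    have hz' : 0 < z.re := hz
    have hs : {v : ℂ | z.re / 2 < v.re} ∈ 𝓝 z := by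
      have h1 : IsOpen {v : ℂ | z.re / 2 < v.re} := isOpen_lt (by fun_prop) (by fun_prop)
      exact h1.mem_nhds (half_lt_self hz')
    have key := hasDerivAt_integral_of_dominated_loc_of_deriv_le (μ := m)
      (F := fun (v : ℂ) a => Complex.exp (-v * Y a) - 1)
      (F' := fun (v : ℂ) a => -(Y a : ℂ) * Complex.exp (-v * Y a))
      (bound := fun a => (1 + 1 / (z.re / 2)) * min 1 (Y a)) (x₀ := z) hs
      (.of_forall fun v => (measurable_exp_neg_mul_sub_one hY v).aestronglyMeasurable)
      (integrable_exp_neg_mul_sub_one hY hY0 hint hz'.le) ?_ ?_ (hint.const_mul _) ?_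
    · exact key.2.differentiableAt
    · exact ((Complex.measurable_ofReal.comp hY).neg.mul (Complex.measurable_exp.comp
        ((Complex.measurable_ofReal.comp hY).const_mul (-z)))).aestronglyMeasurable
    · filter_upwards [hY0] with a ha v (hv : z.re / 2 < v.re)
      rw [norm_mul, norm_neg, Complex.norm_real, Real.norm_of_nonneg ha, Complex.norm_exp,
        Complex.re_mul_ofReal, Complex.neg_re]
      have hδ : 0 < z.re / 2 := half_pos hz'
      have h1 : Real.exp (-v.re * Y a) ≤ Real.exp (-(z.re / 2 * Y a)) := by
        apply Real.exp_le_exp.2; nlinarith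
      have h2 : Real.exp (-(z.re / 2 * Y a)) ≤ 1 := Real.exp_le_one_iff.2 (by
        have := mul_nonneg hδ.le ha; linarith)
      have h3 : z.re / 2 * Y a * Real.exp (-(z.re / 2 * Y a)) ≤ 1 := by
        rw [Real.exp_neg, ← div_eq_mul_inv, div_le_one (Real.exp_pos _)]
        linarith [Real.add_one_le_exp (z.re / 2 * Y a)]
      have h4 : Y a * Real.exp (-(z.re / 2 * Y a)) ≤ 1 / (z.re / 2) := by
        rw [le_div_iff₀ hδ]; linarith
      have h5 : 0 < 1 / (z.re / 2) := by positivity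
      calc Y a * Real.exp (-v.re * Y a) ≤ Y a * Real.exp (-(z.re / 2 * Y a)) := by gcongr
        _ ≤ (1 + 1 / (z.re / 2)) * min 1 (Y a) := by
          rcases le_total 1 (Y a) with h | h
          · rw [min_eq_left h]; linarith
          · rw [min_eq_right h]; nlinarith
    · refine .of_forall fun a v _ => ?_
      have h1 : HasDerivAt (fun v : ℂ => -v * (Y a : ℂ)) (-(Y a : ℂ)) v := by
        simpa using (hasDerivAt_id v).neg.mul_const (Y a : ℂ)
      convert! h1.cexp.sub_const 1 using 1
      ring
  · rw [closure_right_half_plane]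
    intro z hz
    refine continuousWithinAt_of_dominated (bound := fun a => 2 * (1 + (‖z‖ + 1)) * min 1 (Y a))
      (.of_forall fun v => (measurable_exp_neg_mul_sub_one hY v).aestronglyMeasurable) ?_
      (hint.const_mul _) (.of_forall fun a => ?_)
    · have h1 : {v : ℂ | ‖v‖ < ‖z‖ + 1} ∈ 𝓝[{z : ℂ | 0 ≤ z.re}] z := by
        have : IsOpen {v : ℂ | ‖v‖ < ‖z‖ + 1} := isOpen_lt (by fun_prop) (by fun_prop)
        exact mem_nhdsWithin_of_mem_nhds (this.mem_nhds (lt_add_one ‖z‖))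
      filter_upwards [h1, self_mem_nhdsWithin] with v (hv : ‖v‖ < ‖z‖ + 1) (hv0 : 0 ≤ v.re)
      filter_upwards [hY0] with a ha
      refine (norm_exp_neg_mul_sub_one_le hv0 ha).trans ?_
      have : 0 ≤ min 1 (Y a) := le_min zero_le_one ha
      gcongr
    · exact Continuous.continuousWithinAt (by fun_prop)

lemma re_integral_exp_neg_mul_sub_one_nonpos (hY : Measurable Y) (hY0 : ∀ᵐ a ∂m, 0 ≤ Y a)
    (hint : Integrable (fun a => min 1 (Y a)) m) {z : ℂ} (hz : 0 ≤ z.re) :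
    (∫ a, (Complex.exp (-z * Y a) - 1) ∂m).re ≤ 0 := by
  have h := integral_re (integrable_exp_neg_mul_sub_one hY hY0 hint hz)
  simp only [RCLike.re_to_complex] at h
  rw [← h]
  refine integral_nonpos_of_ae ?_
  filter_upwards [hY0] with a ha
  have h1 : ‖Complex.exp (-z * Y a)‖ ≤ 1 := by
    rw [Complex.norm_exp, Complex.re_mul_ofReal, Complex.neg_re]
    exact Real.exp_le_one_iff.2 (by nlinarith)
  have h2 := (Complex.re_le_norm (Complex.exp (-z * Y a))).trans h1
  simpa using h2

end LaplaceExponent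

/-- Two bounded holomorphic functions on the right half plane that are continuous up to the
boundary and agree on the imaginary axis are equal. -/
lemma eqOn_right_half_plane_of_bounded {f g : ℂ → ℂ} (hf : DiffContOnCl ℂ f {z | 0 < z.re})
    (hg : DiffContOnCl ℂ g {z | 0 < z.re}) (hf1 : ∀ z : ℂ, 0 ≤ z.re → ‖f z‖ ≤ 1)
    (hg1 : ∀ z : ℂ, 0 ≤ z.re → ‖g z‖ ≤ 1) (him : ∀ y : ℝ, f (y * Complex.I) = g (y * Complex.I))
    {z : ℂ} (hz : 0 ≤ z.re) : f z = g z := by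
  have hb : ∀ v : ℂ, 0 ≤ v.re → ‖f v - g v‖ ≤ 2 := fun v hv =>
    (norm_sub_le _ _).trans (by linarith [hf1 v hv, hg1 v hv])
  have := PhragmenLindelof.right_half_plane_of_bounded_on_real (f := fun v => f v - g v) (C := 0)
    (hf.sub hg) ⟨0, by norm_num, 0, ?_⟩ ?_ (fun y => by simp [him y]) hz
  · exact sub_eq_zero.1 (norm_le_zero_iff.1 this)
  · simp only [zero_mul, Real.exp_zero]
    refine Asymptotics.IsBigO.of_bound 2 ?_
    filter_upwards [mem_inf_of_right (mem_principal_self _)] with v hv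
    simpa using hb v (le_of_lt hv)
  · refine ⟨2, ?_⟩
    rw [eventually_map]
    filter_upwards [eventually_ge_atTop 0] with x hx
    exact hb x (by simpa using hx)

lemma inner_nonneg_of_mem_nonnegOrthant {x y : EuclideanSpace ℝ (Fin n)}
    (hx : x ∈ nonnegOrthant n) (hy : y ∈ nonnegOrthant n) : 0 ≤ inner ℝ x y := by
  rw [PiLp.inner_apply]
  exact Finset.sum_nonneg fun k _ => by simpa using mul_nonneg (hy k) (hx k)

lemma min_one_inner_le (l x : EuclideanSpace ℝ (Fin n)) :
    min 1 (inner ℝ l x) ≤ (1 + ‖l‖) * min 1 ‖x‖ := by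
  have h := real_inner_le_norm l x
  have hl := norm_nonneg l
  rcases le_total 1 ‖x‖ with h1 | h1
  · rw [min_eq_left h1]; exact (min_le_left _ _).trans (by linarith)
  · rw [min_eq_right h1]; exact (min_le_right _ _).trans (by nlinarith [norm_nonneg x])

section Subordinator

variable {Ω : Type*} [MeasurableSpace Ω] {P : Measure Ω}
  {T : ℝ≥0 → Ω → EuclideanSpace ℝ (Fin n)} {d : EuclideanSpace ℝ (Fin n)}
  {τ : Measure (EuclideanSpace ℝ (Fin n))} (h : IsSubordinator P T d τ)
include h

lemma IsSubordinator.ae_mem : ∀ᵐ x ∂τ, x ∈ nonnegOrthant n := by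
  rw [ae_iff]; exact h.support

lemma IsSubordinator.integrable_min : Integrable (fun x => min 1 ‖x‖) τ := by
  have hL := h.triplet.isLevyMeasure
  have h1 : IntegrableOn (fun x => ‖x‖) (Metric.closedBall 0 1) τ := h.integrable.norm
  have h2 : Integrable ((Metric.closedBall (0 : EuclideanSpace ℝ (Fin n)) 1).indicator
      fun x => ‖x‖) τ := h1.integrable_indicator Metric.isClosed_closedBall.measurableSet
  refine Integrable.mono' (h2.add hL.integrable_min) (by fun_prop) (.of_forall fun x => ?_)
  rw [Real.norm_of_nonneg (by positivity)]
  by_cases hx : x ∈ Metric.closedBall (0 : EuclideanSpace ℝ (Fin n)) 1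
  · simp only [Pi.add_apply, indicator_of_mem hx]
    have : 0 ≤ min 1 (‖x‖ ^ 2) := by positivity
    linarith [min_le_right 1 ‖x‖]
  · simp only [Pi.add_apply, indicator_of_notMem hx, zero_add]
    have hx1 : 1 < ‖x‖ := by simpa using hx
    rw [min_eq_left hx1.le, min_eq_left (by nlinarith)]

lemma IsSubordinator.integrable_min_inner {l : EuclideanSpace ℝ (Fin n)}
    (hl : l ∈ nonnegOrthant n) : Integrable (fun x => min 1 (inner ℝ l x)) τ := by
  refine Integrable.mono' (h.integrable_min.const_mul (1 + ‖l‖)) (by fun_prop) ?_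
  filter_upwards [h.ae_mem] with x hx
  rw [Real.norm_of_nonneg (le_min zero_le_one (inner_nonneg_of_mem_nonnegOrthant hl hx))]
  exact min_one_inner_le l x

/-- For a subordinator the compensating term is integrable, and it cancels against the shift in the
first entry of the triplet. -/
lemma IsSubordinator.levyExponent_eq (θ : EuclideanSpace ℝ (Fin n)) :
    levyExponent (d + ∫ x in Metric.closedBall 0 1, x ∂τ) 0 τ θ
      = Complex.I * (inner ℝ d θ : ℝ)
        + ∫ x, (Complex.exp (Complex.I * (inner ℝ θ x : ℝ)) - 1) ∂τ := by
  have hL := h.triplet.isLevyMeasure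
  have hI := integrable_levyIntegrand hL θ
  have hb : MeasurableSet (Metric.closedBall (0 : EuclideanSpace ℝ (Fin n)) 1) :=
    Metric.isClosed_closedBall.measurableSet
  have hin : IntegrableOn (fun x => inner ℝ θ x) (Metric.closedBall 0 1) τ :=
    h.integrable.const_inner θ
  have hlin : Integrable (fun x => Complex.I * (inner ℝ θ x : ℝ)
      * (Metric.closedBall (0 : EuclideanSpace ℝ (Fin n)) 1).indicator (fun _ => (1 : ℂ)) x) τ := by
    refine ((hin.integrable_indicator hb).ofReal (𝕜 := ℂ) |>.const_mul Complex.I).congr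
      (.of_forall fun x => ?_)
    by_cases hx : x ∈ Metric.closedBall (0 : EuclideanSpace ℝ (Fin n)) 1
    · simp [indicator_of_mem hx]
    · simp [indicator_of_notMem hx]
  have e1 : ∫ x, (Complex.exp (Complex.I * (inner ℝ θ x : ℝ)) - 1) ∂τ
      = ∫ x, levyIntegrand θ x ∂τ + ∫ x, Complex.I * (inner ℝ θ x : ℝ)
      * (Metric.closedBall (0 : EuclideanSpace ℝ (Fin n)) 1).indicator (fun _ => (1 : ℂ)) x ∂τ := by
    rw [← integral_add hI hlin]
    refine integral_congr_ae (.of_forall fun x => ?_)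
    simp [levyIntegrand]
  have e2 : ∫ x, Complex.I * (inner ℝ θ x : ℝ)
      * (Metric.closedBall (0 : EuclideanSpace ℝ (Fin n)) 1).indicator (fun _ => (1 : ℂ)) x ∂τ
      = Complex.I * ((inner ℝ (∫ x in Metric.closedBall 0 1, x ∂τ) θ : ℝ) : ℂ) := by
    rw [real_inner_comm, ← integral_inner h.integrable θ, ← integral_complex_ofReal,
      ← integral_const_mul, ← integral_indicator hb]
    refine integral_congr_ae (.of_forall fun x => ?_)
    by_cases hx : x ∈ Metric.closedBall (0 : EuclideanSpace ℝ (Fin n)) 1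
    · simp [indicator_of_mem hx]
    · simp [indicator_of_notMem hx]
  rw [WVGG.levyExponent_eq, e1, e2, inner_add_left]
  simp only [matInner, Matrix.zero_apply, mul_zero, zero_mul, Finset.sum_const_zero,
    Complex.ofReal_zero, sub_zero]
  push_cast
  ring

lemma IsSubordinator.ae_nonneg : ∀ᵐ ω ∂P, T 1 ω ∈ nonnegOrthant n := by
  filter_upwards [h.mono, (HasTriplet.isLevyProcess h.triplet).start] with ω h1 h2 k
  simpa [h2] using h1 0 1 zero_le_one k

/-- The Laplace transform of a subordinator follows from its characteristic function by
continuation from the imaginary axis into the right half plane. -/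
lemma IsSubordinator.laplace {l : EuclideanSpace ℝ (Fin n)} (hl : l ∈ nonnegOrthant n) :
    -Real.log (∫ ω, Real.exp (-inner ℝ l (T 1 ω)) ∂P)
      = inner ℝ d l + ∫ x, (1 - Real.exp (-inner ℝ l x)) ∂τ := by
  have hP := (HasTriplet.isLevyProcess h.triplet).isProbabilityMeasure
  have hTm : Measurable (T 1) := (HasTriplet.isLevyProcess h.triplet).measurable 1
  have hY : Measurable fun ω => inner ℝ l (T 1 ω) := by fun_prop
  have hY0 : ∀ᵐ ω ∂P, 0 ≤ inner ℝ l (T 1 ω) := by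
    filter_upwards [h.ae_nonneg] with ω hω using inner_nonneg_of_mem_nonnegOrthant hl hω
  have hYi : Integrable (fun ω => min 1 (inner ℝ l (T 1 ω))) P := by
    refine Integrable.mono' (integrable_const (1 : ℝ))
      (measurable_const.min hY).aestronglyMeasurable ?_
    filter_upwards [hY0] with ω hω
    rw [Real.norm_of_nonneg (le_min zero_le_one hω)]
    exact min_le_left _ _
  have hZ : Measurable fun x : EuclideanSpace ℝ (Fin n) => inner ℝ l x := by fun_prop
  have hZ0 : ∀ᵐ x ∂τ, 0 ≤ inner ℝ l x := by
    filter_upwards [h.ae_mem] with x hx using inner_nonneg_of_mem_nonnegOrthant hl hx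
  have hZi := h.integrable_min_inner hl
  have hdl := inner_nonneg_of_mem_nonnegOrthant h.drift_nonneg hl
  -- `f z = 𝔼 exp (-z ⟨l, T(1)⟩)`; subtracting and adding `1` allows the integral over `P` to be
  -- treated by the same lemma as the integral over `τ`.
  set f : ℂ → ℂ := fun z => ∫ ω, (Complex.exp (-z * (inner ℝ l (T 1 ω) : ℝ)) - 1) ∂P + 1 with hf
  set g : ℂ → ℂ := fun z => Complex.exp (-z * (inner ℝ d l : ℝ)
    + ∫ x, (Complex.exp (-z * (inner ℝ l x : ℝ)) - 1) ∂τ) with hg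
  have hf' : ∀ z : ℂ, 0 ≤ z.re → f z = ∫ ω, Complex.exp (-z * (inner ℝ l (T 1 ω) : ℝ)) ∂P := by
    intro z hz
    have hi := integrable_exp_neg_mul_sub_one hY hY0 hYi hz
    have : ∫ ω, Complex.exp (-z * (inner ℝ l (T 1 ω) : ℝ)) ∂P
        = ∫ ω, ((Complex.exp (-z * (inner ℝ l (T 1 ω) : ℝ)) - 1) + 1) ∂P := by simp
    rw [this, integral_add hi (integrable_const _)]
    simp [hf]
  have hfg : f 1 = g 1 := by
    refine eqOn_right_half_plane_of_bounded (f := f) (g := g) ?_ ?_ ?_ ?_ ?_ (by simp)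
    · exact (diffContOnCl_integral_exp_neg_mul_sub_one hY hY0 hYi).add_const 1
    · have h1 := diffContOnCl_integral_exp_neg_mul_sub_one hZ hZ0 hZi
      have h2 : DiffContOnCl ℂ (fun z : ℂ => -z * ((inner ℝ d l : ℝ) : ℂ)) {z | 0 < z.re} :=
        Differentiable.diffContOnCl (by fun_prop)
      exact ⟨(h2.add h1).differentiableOn.cexp, (h2.add h1).continuousOn.cexp⟩
    · intro z hz
      rw [hf' z hz]
      refine (norm_integral_le_of_norm_le_const (C := 1) ?_).trans (by simp)
      filter_upwards [hY0] with ω hω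
      rw [Complex.norm_exp, Complex.re_mul_ofReal, Complex.neg_re]
      exact Real.exp_le_one_iff.2 (by nlinarith)
    · intro z hz
      rw [hg, Complex.norm_exp, Complex.add_re, Complex.re_mul_ofReal, Complex.neg_re]
      refine Real.exp_le_one_iff.2 ?_
      have := re_integral_exp_neg_mul_sub_one_nonpos hZ hZ0 hZi hz
      nlinarith
    -- On the imaginary axis both sides are the characteristic function of `T(1)`.
    · intro y
      have hc := h.triplet.charFun_eq 1 (-(y • l))
      rw [charFun_apply, integral_map hTm.aemeasurable
        (Continuous.aestronglyMeasurable (by fun_prop)), h.levyExponent_eq] at hc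
      rw [hf' _ (by simp), hg]
      convert! hc using 1
      · refine integral_congr_ae (.of_forall fun ω => ?_)
        simp only [inner_neg_right, inner_smul_right, real_inner_comm l (T 1 ω)]
        congr 1; push_cast; ring
      · have e : ∫ x, (Complex.exp (Complex.I * (inner ℝ (-(y • l)) x : ℝ)) - 1) ∂τ
            = ∫ x, (Complex.exp (-(y * Complex.I) * (inner ℝ l x : ℝ)) - 1) ∂τ := by
          refine integral_congr_ae (.of_forall fun x => ?_)
          simp only [inner_neg_left, real_inner_smul_left]
          congr 2; push_cast; ring
        rw [e, inner_neg_right, inner_smul_right]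
        push_cast
        congr 1
        ring
  have hreal : ∫ ω, Real.exp (-inner ℝ l (T 1 ω)) ∂P
      = Real.exp (-(inner ℝ d l) + ∫ x, (Real.exp (-inner ℝ l x) - 1) ∂τ) := by
    have h1 : f 1 = ((∫ ω, Real.exp (-inner ℝ l (T 1 ω)) ∂P : ℝ) : ℂ) := by
      rw [hf' 1 (by simp), ← integral_complex_ofReal]
      push_cast
      simp
    have h2 : g 1
        = ((Real.exp (-(inner ℝ d l) + ∫ x, (Real.exp (-inner ℝ l x) - 1) ∂τ) : ℝ) : ℂ) := by
      rw [hg]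
      push_cast
      rw [← integral_complex_ofReal]
      push_cast
      simp
    rw [h1, h2] at hfg
    exact_mod_cast hfg
  rw [hreal, Real.log_exp, neg_add, neg_neg, ← integral_neg]
  congr 1
  refine integral_congr_ae (.of_forall fun x => ?_)
  simp

lemma IsSubordinator.integrable_one_sub_exp {l : EuclideanSpace ℝ (Fin n)}
    (hl : l ∈ nonnegOrthant n) : Integrable (fun x => 1 - Real.exp (-inner ℝ l x)) τ := by
  refine Integrable.mono' (h.integrable_min_inner hl) (by fun_prop) ?_
  filter_upwards [h.ae_mem] with x hx
  have h0 := inner_nonneg_of_mem_nonnegOrthant hl hx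
  have h1 : Real.exp (-inner ℝ l x) ≤ 1 := Real.exp_le_one_iff.2 (by linarith)
  have h2 := Real.add_one_le_exp (-inner ℝ l x)
  rw [Real.norm_of_nonneg (by linarith)]
  exact le_min (by linarith [Real.exp_pos (-inner ℝ l x)]) (by linarith)

end Subordinator

/-! ### Uniqueness of Laplace transforms on the orthant -/

open BoundedContinuousFunction in
/-- The exponential `x ↦ exp (-⟨l, x⟩)` as a bounded continuous function on the orthant. -/
def expOrthant (l : Fin n → ℝ≥0) : nonnegOrthant n →ᵇ ℝ :=
  ofNormedAddCommGroup
    (fun x => Real.exp (-∑ k, (l k : ℝ) * (x : EuclideanSpace ℝ (Fin n)) k)) (by fun_prop) 1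
    fun x => by
      rw [Real.norm_of_nonneg (Real.exp_pos _).le]
      refine Real.exp_le_one_iff.2 (neg_nonpos.2 (Finset.sum_nonneg fun k _ => ?_))
      exact mul_nonneg (l k).2 (x.2 k)

lemma expOrthant_apply (l : Fin n → ℝ≥0) (x : nonnegOrthant n) : expOrthant l x
    = Real.exp (-∑ k, (l k : ℝ) * (x : EuclideanSpace ℝ (Fin n)) k) := rfl

open BoundedContinuousFunction in
/-- The exponentials form a multiplicative submonoid. -/
def expOrthantHom (n : ℕ) : Multiplicative (Fin n → ℝ≥0) →* (nonnegOrthant n →ᵇ ℝ) where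
  toFun l := expOrthant l.toAdd
  map_one' := by ext x; simp [expOrthant_apply]
  map_mul' l l' := by
    ext x
    simp only [expOrthant_apply, BoundedContinuousFunction.mul_apply, ← Real.exp_add, toAdd_mul,
      Pi.add_apply, NNReal.coe_add, add_mul, Finset.sum_add_distrib, neg_add]

open BoundedContinuousFunction in
/-- The algebra spanned by the exponentials on the orthant. -/
def expAlgebra (n : ℕ) : StarSubalgebra ℝ (nonnegOrthant n →ᵇ ℝ) where
  toSubalgebra := Algebra.adjoin ℝ (MonoidHom.mrange (expOrthantHom n) : Set (nonnegOrthant n →ᵇ ℝ))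
  star_mem' {f} hf := by
    have : star f = f := by ext x; simp
    exact this ▸ hf

lemma isClosed_nonnegOrthant : IsClosed (nonnegOrthant n) := by
  unfold nonnegOrthant
  simp only [ofPred_forall]
  exact isClosed_iInter fun k => isClosed_le (by fun_prop) (by fun_prop)

/-- Finite measures on the orthant are determined by their Laplace transforms, because the
exponentials span an algebra that separates points. -/
lemma ext_of_laplace {m₁ m₂ : Measure (EuclideanSpace ℝ (Fin n))} [IsFiniteMeasure m₁]
    [IsFiniteMeasure m₂] (h₁ : ∀ᵐ x ∂m₁, x ∈ nonnegOrthant n) (h₂ : ∀ᵐ x ∂m₂, x ∈ nonnegOrthant n)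
    (h : ∀ l ∈ nonnegOrthant n,
      ∫ x, Real.exp (-inner ℝ l x) ∂m₁ = ∫ x, Real.exp (-inner ℝ l x) ∂m₂) : m₁ = m₂ := by
  have hO : MeasurableSet (nonnegOrthant n) := measurableSet_nonnegOrthant
  have hemb := MeasurableEmbedding.subtype_coe hO
  have hpol : PolishSpace (nonnegOrthant n) := isClosed_nonnegOrthant.polishSpace
  have hfin : ∀ m : Measure (EuclideanSpace ℝ (Fin n)), IsFiniteMeasure m →
      IsFiniteMeasure (m.comap ((↑) : nonnegOrthant n → EuclideanSpace ℝ (Fin n))) := fun m _ =>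
    ⟨by rw [hemb.comap_apply]; exact measure_lt_top _ _⟩
  have i1 := hfin m₁ inferInstance
  have i2 := hfin m₂ inferInstance
  have hmap : ∀ m : Measure (EuclideanSpace ℝ (Fin n)), (∀ᵐ x ∂m, x ∈ nonnegOrthant n) →
      (m.comap ((↑) : nonnegOrthant n → EuclideanSpace ℝ (Fin n))).map (↑) = m := fun m hm => by
    rw [hemb.map_comap, Subtype.range_coe, Measure.restrict_eq_self_of_ae_mem hm]
  have hexp : ∀ l : Fin n → ℝ≥0,
      ∫ x, expOrthant l x ∂(m₁.comap ((↑) : nonnegOrthant n → EuclideanSpace ℝ (Fin n)))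
      = ∫ x, expOrthant l x ∂(m₂.comap ((↑) : nonnegOrthant n → EuclideanSpace ℝ (Fin n))) := by
    intro l
    have hl := h (WithLp.toLp 2 fun k => (l k : ℝ)) fun k => (l k).2
    rw [← hmap m₁ h₁, ← hmap m₂ h₂, hemb.integral_map, hemb.integral_map] at hl
    convert! hl using 3 with x
    all_goals
      rw [expOrthant_apply, PiLp.inner_apply]
      simp [mul_comm]
  suffices hc : m₁.comap ((↑) : nonnegOrthant n → EuclideanSpace ℝ (Fin n))
      = m₂.comap ((↑) : nonnegOrthant n → EuclideanSpace ℝ (Fin n)) by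
    rw [← hmap m₁ h₁, hc, hmap m₂ h₂]
  refine ext_of_forall_mem_subalgebra_integral_eq_of_polish (𝕜 := ℝ) (A := expAlgebra n) ?_ ?_
  · intro x y hxy
    obtain ⟨k, hk⟩ : ∃ k, (x : EuclideanSpace ℝ (Fin n)) k ≠ (y : EuclideanSpace ℝ (Fin n)) k := by
      by_contra! hcon
      exact hxy (Subtype.ext (by ext k; exact hcon k))
    let e := expOrthant (n := n) (Pi.single k 1)
    have he : ∀ x : nonnegOrthant n, e x = Real.exp (-(x : EuclideanSpace ℝ (Fin n)) k) := by
      intro x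
      rw [expOrthant_apply]
      congr 2
      rw [Finset.sum_eq_single k]
      · simp
      · intro b _ hb; simp [hb]
      · simp
    refine ⟨_, ⟨BoundedContinuousFunction.toContinuousMapStarₐ ℝ e, ⟨e, ?_, rfl⟩, rfl⟩, ?_⟩
    · exact Algebra.subset_adjoin ⟨Multiplicative.ofAdd (Pi.single k 1), rfl⟩
    · change e x ≠ e y
      rw [he, he]
      exact fun h => hk (by simpa using Real.exp_injective h)
  · intro f hf
    -- The exponentials are closed under products, so that the algebra is their linear span.
    have hf' : f ∈ Submodule.span ℝ (MonoidHom.mrange (expOrthantHom n) :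
        Set (BoundedContinuousFunction (nonnegOrthant n) ℝ)) := by
      have : f ∈ Subalgebra.toSubmodule (Algebra.adjoin ℝ (MonoidHom.mrange (expOrthantHom n) :
          Set (BoundedContinuousFunction (nonnegOrthant n) ℝ))) := hf
      rwa [Algebra.adjoin_eq_span, Submonoid.closure_eq] at this
    clear hf
    induction hf' using Submodule.span_induction with
    | mem f hf =>
      obtain ⟨l, rfl⟩ := hf
      exact hexp _
    | zero => simp
    | add f g _ _ hf hg =>
      simp only [BoundedContinuousFunction.coe_add, Pi.add_apply]
      rw [integral_add (f.integrable _) (g.integrable _),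
        integral_add (f.integrable _) (g.integrable _)]
      rw [hf, hg]
    | smul c f _ hf =>
      simp only [BoundedContinuousFunction.coe_smul, smul_eq_mul, integral_const_mul]
      rw [hf]

/-- The vector with all coordinates equal to one. -/
def onesVec (n : ℕ) : EuclideanSpace ℝ (Fin n) := WithLp.toLp 2 fun _ => 1

lemma onesVec_mem : onesVec n ∈ nonnegOrthant n := fun _ => zero_le_one

lemma inner_onesVec (x : EuclideanSpace ℝ (Fin n)) : inner ℝ (onesVec n) x = ∑ k, x k := by
  rw [PiLp.inner_apply]; simp [onesVec]

lemma inner_onesVec_pos {x : EuclideanSpace ℝ (Fin n)} (hx : x ∈ nonnegOrthant n) (hx0 : x ≠ 0) :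
    0 < inner ℝ (onesVec n) x := by
  rw [inner_onesVec]
  obtain ⟨k, hk⟩ : ∃ k, x k ≠ 0 := by
    by_contra! hcon
    exact hx0 (by ext k; simpa using hcon k)
  exact Finset.sum_pos' (fun k _ => hx k) ⟨k, Finset.mem_univ k, lt_of_le_of_ne (hx k) hk.symm⟩

/-- A Lévy measure on the orthant is determined by its Laplace exponent: the second difference of
the exponent in the direction of `onesVec` is, up to sign, the Laplace transform of the finite
measure `(1 - exp (-⟨onesVec, x⟩)) ^ 2 τ(dx)`, and the drift drops out. -/
lemma restrict_eq_of_laplaceExponent_eq {τ₁ τ₂ : Measure (EuclideanSpace ℝ (Fin n))}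
    (h₁ : ∀ᵐ x ∂τ₁, x ∈ nonnegOrthant n) (h₂ : ∀ᵐ x ∂τ₂, x ∈ nonnegOrthant n)
    (hi₁ : ∀ l ∈ nonnegOrthant n, Integrable (fun x => 1 - Real.exp (-inner ℝ l x)) τ₁)
    (hi₂ : ∀ l ∈ nonnegOrthant n, Integrable (fun x => 1 - Real.exp (-inner ℝ l x)) τ₂)
    {d₁ d₂ : EuclideanSpace ℝ (Fin n)}
    (h : ∀ l ∈ nonnegOrthant n, inner ℝ d₁ l + ∫ x, (1 - Real.exp (-inner ℝ l x)) ∂τ₁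
      = inner ℝ d₂ l + ∫ x, (1 - Real.exp (-inner ℝ l x)) ∂τ₂) :
    τ₁.restrict {0}ᶜ = τ₂.restrict {0}ᶜ := by
  set e := onesVec n with he
  have hadd : ∀ {l l' : EuclideanSpace ℝ (Fin n)}, l ∈ nonnegOrthant n → l' ∈ nonnegOrthant n →
      l + l' ∈ nonnegOrthant n := fun hl hl' k => add_nonneg (hl k) (hl' k)
  have hwm : Measurable fun x : EuclideanSpace ℝ (Fin n) =>
      ENNReal.ofReal ((1 - Real.exp (-inner ℝ e x)) ^ 2) := by
    have : Continuous fun x : EuclideanSpace ℝ (Fin n) => (1 - Real.exp (-inner ℝ e x)) ^ 2 := by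
      fun_prop
    exact this.measurable.ennreal_ofReal
  -- The pointwise second difference of `l ↦ 1 - exp (-⟨l, x⟩)`.
  have hpt : ∀ l x : EuclideanSpace ℝ (Fin n),
      2 * (1 - Real.exp (-inner ℝ (l + e) x)) - (1 - Real.exp (-inner ℝ (l + e + e) x))
        - (1 - Real.exp (-inner ℝ l x))
      = (1 - Real.exp (-inner ℝ e x)) ^ 2 * Real.exp (-inner ℝ l x) := by
    intro l x
    simp only [inner_add_left, neg_add, Real.exp_add]
    ring
  have hint : ∀ τ : Measure (EuclideanSpace ℝ (Fin n)),
      (∀ l ∈ nonnegOrthant n, Integrable (fun x => 1 - Real.exp (-inner ℝ l x)) τ) →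
      ∀ l ∈ nonnegOrthant n,
      Integrable (fun x => (1 - Real.exp (-inner ℝ e x)) ^ 2 * Real.exp (-inner ℝ l x)) τ := by
    intro τ hi l hl
    refine ((((hi _ (hadd hl onesVec_mem)).const_mul 2).sub
      (hi _ (hadd (hadd hl onesVec_mem) onesVec_mem))).sub (hi l hl)).congr (.of_forall fun x => ?_)
    exact hpt l x
  have hfin : ∀ τ : Measure (EuclideanSpace ℝ (Fin n)),
      (∀ l ∈ nonnegOrthant n, Integrable (fun x => 1 - Real.exp (-inner ℝ l x)) τ) →
      IsFiniteMeasure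
        (τ.withDensity fun x => ENNReal.ofReal ((1 - Real.exp (-inner ℝ e x)) ^ 2)) := by
    intro τ hi
    refine isFiniteMeasure_withDensity_ofReal ?_
    have := (hint τ hi 0 fun _ => le_rfl).2
    simpa using this
  have hval : ∀ τ : Measure (EuclideanSpace ℝ (Fin n)),
      (∀ l ∈ nonnegOrthant n, Integrable (fun x => 1 - Real.exp (-inner ℝ l x)) τ) →
      ∀ l ∈ nonnegOrthant n, ∫ x, Real.exp (-inner ℝ l x)
        ∂(τ.withDensity fun x => ENNReal.ofReal ((1 - Real.exp (-inner ℝ e x)) ^ 2))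
      = 2 * ∫ x, (1 - Real.exp (-inner ℝ (l + e) x)) ∂τ
        - ∫ x, (1 - Real.exp (-inner ℝ (l + e + e) x)) ∂τ
        - ∫ x, (1 - Real.exp (-inner ℝ l x)) ∂τ := by
    intro τ hi l hl
    have i1 := (hi _ (hadd hl onesVec_mem)).const_mul 2
    have i2 := hi _ (hadd (hadd hl onesVec_mem) onesVec_mem)
    have i12 : Integrable (fun x => 2 * (1 - Real.exp (-inner ℝ (l + e) x))
      - (1 - Real.exp (-inner ℝ (l + e + e) x))) τ := i1.sub i2
    rw [integral_withDensity_eq_integral_toReal_smul hwm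
        (.of_forall fun x => ENNReal.ofReal_lt_top),
      ← integral_const_mul, ← integral_sub i1 i2, ← integral_sub i12 (hi l hl)]
    refine integral_congr_ae (.of_forall fun x => ?_)
    simp only
    rw [ENNReal.toReal_ofReal (sq_nonneg _), smul_eq_mul]
    exact (hpt l x).symm
  have f1 := hfin τ₁ hi₁
  have f2 := hfin τ₂ hi₂
  have hm := ext_of_laplace (m₁ := τ₁.withDensity _) (m₂ := τ₂.withDensity _)
    ((withDensity_absolutelyContinuous τ₁
      (fun x => ENNReal.ofReal ((1 - Real.exp (-inner ℝ e x)) ^ 2))).ae_le h₁)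
    ((withDensity_absolutelyContinuous τ₂
      (fun x => ENNReal.ofReal ((1 - Real.exp (-inner ℝ e x)) ^ 2))).ae_le h₂) fun l hl => by
      have e1 := h _ (hadd hl onesVec_mem)
      have e2 := h _ (hadd (hadd hl onesVec_mem) onesVec_mem)
      have e3 := h l hl
      rw [hval τ₁ hi₁ l hl, hval τ₂ hi₂ l hl]
      simp only [inner_add_right] at e1 e2
      linarith
  have hO : MeasurableSet (nonnegOrthant n) := measurableSet_nonnegOrthant
  have hres := restrict_eq_of_withDensity_eq (ν₁ := τ₁) (ν₂ := τ₂) hwm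
    (C := nonnegOrthant n ∩ {0}ᶜ) (hO.inter (measurableSet_singleton 0).compl)
    (fun x hx => by
      have h0 := inner_onesVec_pos hx.1 hx.2
      have h1 : Real.exp (-inner ℝ e x) < 1 := by
        rw [← Real.exp_zero, he]
        exact Real.exp_lt_exp.2 (by linarith)
      exact (ENNReal.ofReal_pos.2 (pow_pos (by linarith) 2)).ne') (fun x => ENNReal.ofReal_ne_top)
    (fun A _ _ => by rw [hm])
  have hr : ∀ τ : Measure (EuclideanSpace ℝ (Fin n)), (∀ᵐ x ∂τ, x ∈ nonnegOrthant n) →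
      τ.restrict {0}ᶜ = τ.restrict (nonnegOrthant n ∩ {0}ᶜ) := fun τ hτ =>
    Measure.restrict_congr_set (by
      filter_upwards [hτ] with x hx
      change (x ∈ ({0}ᶜ : Set _)) = (x ∈ nonnegOrthant n ∩ {0}ᶜ)
      simp [hx])
  rw [hr τ₁ h₁, hres, ← hr τ₂ h₂]

/-! ### The Lévy measure of a Thorin subordinator -/

/-- The positive function `min 1 (1 / ‖u‖)` is integrable. -/
lemma IsThorinMeasure.sigmaFinite {U : Measure (EuclideanSpace ℝ (Fin n))}
    (hU : IsThorinMeasure U) : SigmaFinite U := by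
  have hi := hU.integrable_min
  have hm : Measurable fun u : EuclideanSpace ℝ (Fin n) => ENNReal.ofReal (min 1 (1 / ‖u‖)) :=
    (measurable_const.min (measurable_const.div measurable_norm)).ennreal_ofReal
  have hne : ∀ᵐ u ∂U, ENNReal.ofReal (min 1 (1 / ‖u‖)) ≠ 0 := by
    have h0 : ∀ᵐ u ∂U, u ≠ 0 := by
      rw [ae_iff]; simpa using hU.zero
    filter_upwards [h0] with u hu
    have := norm_pos_iff.2 hu
    exact (ENNReal.ofReal_pos.2 (by positivity)).ne'
  have hf : IsFiniteMeasure (U.withDensity fun u => ENNReal.ofReal (min 1 (1 / ‖u‖))) :=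
    isFiniteMeasure_withDensity_ofReal hi.2
  rw [← withDensity_inv_same hm hne (.of_forall fun _ => ENNReal.ofReal_ne_top)]
  refine SigmaFinite.withDensity_of_ne_top ?_
  exact (withDensity_absolutelyContinuous U _).ae_le (hne.mono fun u hu => ENNReal.inv_ne_top.2 hu)

/-- The density `exp (-r ‖u‖²) / r` of the Lévy measure of a Thorin subordinator along the ray
through `u`. -/
def thorinDensity (p : EuclideanSpace ℝ (Fin n) × ℝ) : ℝ≥0∞ :=
  ENNReal.ofReal (Real.exp (-(p.2 * ‖p.1‖ ^ 2)) / p.2)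

lemma measurable_thorinDensity : Measurable (thorinDensity (n := n)) := by
  unfold thorinDensity; fun_prop

/-- The Lévy measure of a Thorin subordinator with Thorin measure `U`: the image under
`(u, r) ↦ r • u` of `exp (-r ‖u‖²) / r dr U(du)`. -/
def thorinLevyMeasure (U : Measure (EuclideanSpace ℝ (Fin n))) :
    Measure (EuclideanSpace ℝ (Fin n)) :=
  ((U.prod (volume.restrict (Ioi 0))).withDensity thorinDensity).map fun p => p.2 • p.1

lemma measurable_smul_swap :
    Measurable fun p : EuclideanSpace ℝ (Fin n) × ℝ => p.2 • p.1 := by fun_prop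

lemma lintegral_thorinLevyMeasure (U : Measure (EuclideanSpace ℝ (Fin n)))
    {f : EuclideanSpace ℝ (Fin n) → ℝ≥0∞} (hf : Measurable f) :
    ∫⁻ x, f x ∂(thorinLevyMeasure U) = ∫⁻ u, (∫⁻ r in Ioi (0 : ℝ),
      thorinDensity (u, r) * f (r • u)) ∂U := by
  have hfm : Measurable fun p : EuclideanSpace ℝ (Fin n) × ℝ => f (p.2 • p.1) :=
    hf.comp measurable_smul_swap
  rw [thorinLevyMeasure, lintegral_map hf measurable_smul_swap,
    lintegral_withDensity_eq_lintegral_mul _ measurable_thorinDensity hfm, lintegral_prod _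
      (measurable_thorinDensity.mul hfm).aemeasurable]
  rfl

/-- A Frullani integral: `exp (-r b) (1 - exp (-r a)) / r = ∫₀ᵃ exp (-(b + v) r) dv`, and the order
of integration is exchanged. -/
lemma lintegral_frullani {a b : ℝ} (ha : 0 ≤ a) (hb : 0 < b) :
    ∫⁻ r in Ioi (0 : ℝ), ENNReal.ofReal (Real.exp (-(r * b)) / r)
        * ENNReal.ofReal (1 - Real.exp (-(r * a)))
      = ENNReal.ofReal (Real.log ((b + a) / b)) := by
  have h1 : ∀ r ∈ Ioi (0 : ℝ), ENNReal.ofReal (Real.exp (-(r * b)) / r)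
        * ENNReal.ofReal (1 - Real.exp (-(r * a)))
      = ∫⁻ v in Ioc 0 a, ENNReal.ofReal (Real.exp (-(b + v) * r)) := by
    intro r (hr : 0 < r)
    have hd : ∀ v ∈ uIcc 0 a, HasDerivAt (fun v => -Real.exp (-(b + v) * r) / r)
        (Real.exp (-(b + v) * r)) v := fun v _ => by
      have h := ((((hasDerivAt_id v).const_add b).neg.mul_const r).exp.neg).div_const r
      simp only [id] at h
      convert! h using 1
      simp only [Pi.neg_apply]
      field_simp
    have hint := intervalIntegral.integral_eq_sub_of_hasDerivAt hd
      (Continuous.intervalIntegrable (by fun_prop) _ _)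
    rw [intervalIntegral.integral_of_le ha] at hint
    rw [← ofReal_integral_eq_lintegral_ofReal
      ((Continuous.integrableOn_Icc (by fun_prop)).mono_set Ioc_subset_Icc_self)
      (.of_forall fun v => (Real.exp_pos _).le), hint, ← ENNReal.ofReal_mul (by positivity)]
    congr 1
    rw [show -(b + a) * r = -(r * b) + -(r * a) by ring, Real.exp_add,
      show -(b + 0) * r = -(r * b) by ring]
    field_simp
    ring
  have h2 : ∀ v ∈ Ioc 0 a, ∫⁻ r in Ioi (0 : ℝ), ENNReal.ofReal (Real.exp (-(b + v) * r))
      = ENNReal.ofReal (1 / (b + v)) := by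
    intro v hv
    have hbv : 0 < b + v := by linarith [hv.1]
    rw [← ofReal_integral_eq_lintegral_ofReal (integrableOn_exp_mul_Ioi (by linarith) 0)
      (.of_forall fun r => (Real.exp_pos _).le), integral_exp_mul_Ioi (by linarith)]
    congr 1
    rw [mul_zero, Real.exp_zero, neg_div_neg_eq]
  rw [setLIntegral_congr_fun measurableSet_Ioi h1, lintegral_lintegral_swap
    (by
      refine Measurable.aemeasurable ?_
      refine Measurable.ennreal_ofReal ?_
      fun_prop),
    setLIntegral_congr_fun measurableSet_Ioc h2]
  have hc : ContinuousOn (fun v => 1 / (b + v)) (Icc 0 a) := by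
    refine ContinuousOn.div continuousOn_const (by fun_prop) fun v hv => ?_
    have := hv.1
    positivity
  have hd : ∀ v ∈ uIcc 0 a, HasDerivAt (fun v => Real.log (b + v)) (1 / (b + v)) v := fun v hv => by
    rw [uIcc_of_le ha] at hv
    have : b + v ≠ 0 := by have := hv.1; positivity
    simpa using ((hasDerivAt_id v).const_add b).log this
  have hint := intervalIntegral.integral_eq_sub_of_hasDerivAt hd
    ((by rwa [uIcc_of_le ha] : ContinuousOn (fun v => 1 / (b + v)) (uIcc 0 a)).intervalIntegrable)
  rw [intervalIntegral.integral_of_le ha] at hint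
  rw [← ofReal_integral_eq_lintegral_ofReal (hc.integrableOn_Icc.mono_set Ioc_subset_Icc_self)
    ((ae_restrict_mem measurableSet_Ioc).mono fun v hv => by
      have := hv.1
      simp only [Pi.zero_apply]
      positivity), hint, add_zero, Real.log_div (by positivity) hb.ne']

lemma log_one_add_div_le {L t : ℝ} (hL : 0 ≤ L) (ht : 0 < t) :
    Real.log (1 + L / t) ≤ (1 + L) * min (1 + max (-Real.log t) 0) (1 / t) := by
  rcases le_total 1 t with h | h
  · have h1 : min (1 + max (-Real.log t) 0) (1 / t) = 1 / t := by
      rw [max_eq_right (by simpa using Real.log_nonneg h), add_zero, min_eq_right]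
      rw [div_le_one ht]; exact h
    rw [h1]
    have h2 := Real.log_le_sub_one_of_pos (x := 1 + L / t) (by positivity)
    calc _ ≤ L / t := by linarith
      _ ≤ (1 + L) / t := by gcongr; linarith
      _ = _ := by ring
  · have hl : 0 ≤ -Real.log t := by have := Real.log_nonpos ht.le h; linarith
    have h0 := Real.log_le_sub_one_of_pos (x := 1 / t) (by positivity)
    rw [one_div, Real.log_inv] at h0
    rw [max_eq_left hl, one_div, min_eq_left (by linarith)]
    have h2 : 1 + L / t ≤ (1 + L) / t := by
      rw [add_div]
      have : 1 ≤ 1 / t := (one_le_div ht).2 h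
      linarith
    have h3 := Real.log_le_log (by positivity) h2
    rw [Real.log_div (by positivity) ht.ne'] at h3
    have h4 := Real.log_le_sub_one_of_pos (x := 1 + L) (by positivity)
    nlinarith [mul_nonneg hL hl]

section Thorin

variable {U : Measure (EuclideanSpace ℝ (Fin n))} (hU : IsThorinMeasure U)
include hU

lemma IsThorinMeasure.ae_mem : ∀ᵐ u ∂U, u ∈ nonnegOrthant n ∧ u ≠ 0 := by
  have h1 : ∀ᵐ u ∂U, u ∈ nonnegOrthant n := by rw [ae_iff]; exact hU.support
  have h2 : ∀ᵐ u ∂U, u ≠ 0 := by rw [ae_iff]; simpa using hU.zero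
  filter_upwards [h1, h2] with u h1 h2 using ⟨h1, h2⟩

lemma IsThorinMeasure.thorinLevyMeasure_ae_mem :
    ∀ᵐ x ∂(thorinLevyMeasure U), x ∈ nonnegOrthant n ∧ x ≠ 0 := by
  have hms : MeasurableSet {x : EuclideanSpace ℝ (Fin n) | x ∈ nonnegOrthant n ∧ x ≠ 0} :=
    measurableSet_nonnegOrthant.inter (measurableSet_singleton 0).compl
  rw [ae_iff, ← compl_ofPred, ← lintegral_indicator_one hms.compl, lintegral_thorinLevyMeasure U
    (measurable_one.indicator hms.compl)]
  rw [← lintegral_zero (μ := U)]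
  refine lintegral_congr_ae ?_
  filter_upwards [hU.ae_mem] with u hu
  rw [← lintegral_zero (μ := volume.restrict (Ioi (0 : ℝ)))]
  refine setLIntegral_congr_fun measurableSet_Ioi fun r (hr : 0 < r) => ?_
  have : r • u ∈ {x : EuclideanSpace ℝ (Fin n) | x ∈ nonnegOrthant n ∧ x ≠ 0} :=
    ⟨fun k => mul_nonneg hr.le (hu.1 k), smul_ne_zero hr.ne' hu.2⟩
  rw [indicator_of_notMem (by simpa using this), mul_zero]

lemma IsThorinMeasure.lintegral_one_sub_exp {l : EuclideanSpace ℝ (Fin n)}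
    (hl : l ∈ nonnegOrthant n) :
    ∫⁻ x, ENNReal.ofReal (1 - Real.exp (-inner ℝ l x)) ∂(thorinLevyMeasure U)
      = ∫⁻ u, ENNReal.ofReal (Real.log ((‖u‖ ^ 2 + inner ℝ l u) / ‖u‖ ^ 2)) ∂U := by
  have hm : Measurable fun x : EuclideanSpace ℝ (Fin n) =>
      ENNReal.ofReal (1 - Real.exp (-inner ℝ l x)) := by fun_prop
  rw [lintegral_thorinLevyMeasure U hm]
  refine lintegral_congr_ae ?_
  filter_upwards [hU.ae_mem] with u hu
  have hu0 : 0 < ‖u‖ ^ 2 := pow_pos (norm_pos_iff.2 hu.2) 2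
  rw [← lintegral_frullani (inner_nonneg_of_mem_nonnegOrthant hl hu.1) hu0]
  refine lintegral_congr fun r => ?_
  rw [thorinDensity, inner_smul_right]

lemma IsThorinMeasure.log_nonneg_le {l : EuclideanSpace ℝ (Fin n)} (hl : l ∈ nonnegOrthant n) :
    ∀ᵐ u ∂U, 0 ≤ Real.log ((‖u‖ ^ 2 + inner ℝ l u) / ‖u‖ ^ 2) ∧
      Real.log ((‖u‖ ^ 2 + inner ℝ l u) / ‖u‖ ^ 2)
        ≤ (1 + ‖l‖) * min (1 + max (-Real.log ‖u‖) 0) (1 / ‖u‖) := by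
  filter_upwards [hU.ae_mem] with u hu
  have hu0 : 0 < ‖u‖ := norm_pos_iff.2 hu.2
  have hin := inner_nonneg_of_mem_nonnegOrthant hl hu.1
  constructor
  · refine Real.log_nonneg ?_
    rw [one_le_div (by positivity)]; linarith
  · refine le_trans (Real.log_le_log (by positivity) ?_) (log_one_add_div_le (norm_nonneg l) hu0)
    rw [add_div, div_self (by positivity)]
    have h1 : inner ℝ l u / ‖u‖ ^ 2 ≤ ‖l‖ * ‖u‖ / ‖u‖ ^ 2 := by
      gcongr; exact real_inner_le_norm l u
    have h2 : ‖l‖ * ‖u‖ / ‖u‖ ^ 2 = ‖l‖ / ‖u‖ := by field_simp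
    linarith

lemma IsThorinMeasure.integrable_log {l : EuclideanSpace ℝ (Fin n)} (hl : l ∈ nonnegOrthant n) :
    Integrable (fun u => Real.log ((‖u‖ ^ 2 + inner ℝ l u) / ‖u‖ ^ 2)) U := by
  refine ⟨Measurable.aestronglyMeasurable (by fun_prop), ?_⟩
  have h1 : ∫⁻ u, ‖Real.log ((‖u‖ ^ 2 + inner ℝ l u) / ‖u‖ ^ 2)‖ₑ ∂U
      ≤ ∫⁻ u, ENNReal.ofReal (1 + ‖l‖)
        * ENNReal.ofReal (min (1 + max (-Real.log ‖u‖) 0) (1 / ‖u‖)) ∂U := by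
    refine lintegral_mono_ae ?_
    filter_upwards [hU.log_nonneg_le hl] with u hu
    rw [Real.enorm_eq_ofReal hu.1, ← ENNReal.ofReal_mul (by positivity)]
    exact ENNReal.ofReal_le_ofReal hu.2
  rw [lintegral_const_mul' _ _ ENNReal.ofReal_ne_top] at h1
  exact h1.trans_lt (ENNReal.mul_lt_top ENNReal.ofReal_lt_top hU.finite)

lemma IsThorinMeasure.integrable_one_sub_exp {l : EuclideanSpace ℝ (Fin n)}
    (hl : l ∈ nonnegOrthant n) :
    Integrable (fun x => 1 - Real.exp (-inner ℝ l x)) (thorinLevyMeasure U) ∧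
    ∫ x, (1 - Real.exp (-inner ℝ l x)) ∂(thorinLevyMeasure U)
      = ∫ u, Real.log ((‖u‖ ^ 2 + inner ℝ l u) / ‖u‖ ^ 2) ∂U := by
  have h0 : ∀ᵐ x ∂(thorinLevyMeasure U), 0 ≤ 1 - Real.exp (-inner ℝ l x) := by
    filter_upwards [hU.thorinLevyMeasure_ae_mem] with x hx
    have := inner_nonneg_of_mem_nonnegOrthant hl hx.1
    linarith [Real.exp_le_one_iff.2 (neg_nonpos.2 this)]
  have hlog := hU.integrable_log hl
  have hlog0 := (hU.log_nonneg_le hl).mono fun u hu => hu.1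
  have hL := hU.lintegral_one_sub_exp hl
  have hm : AEStronglyMeasurable (fun x : EuclideanSpace ℝ (Fin n) => 1 - Real.exp (-inner ℝ l x))
      (thorinLevyMeasure U) := Continuous.aestronglyMeasurable (by fun_prop)
  constructor
  · refine ⟨hm, ?_⟩
    rw [hasFiniteIntegral_iff_ofReal h0, hL]
    exact (hasFiniteIntegral_iff_ofReal hlog0).1 hlog.2
  · rw [integral_eq_lintegral_of_nonneg_ae h0 hm, hL,
      integral_eq_lintegral_of_nonneg_ae hlog0 hlog.1]

end Thorin

/-- The two measures have the same Laplace exponent, up to a drift. -/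
lemma levyMeasure_eq_thorinLevyMeasure {Ω : Type*} [MeasurableSpace Ω] {P : Measure Ω}
    {T : ℝ≥0 → Ω → EuclideanSpace ℝ (Fin n)} {d d' : EuclideanSpace ℝ (Fin n)}
    {U τ : Measure (EuclideanSpace ℝ (Fin n))} (hT : IsThorinSubordinator P T d U)
    (hτ : IsSubordinator P T d' τ) : τ = thorinLevyMeasure U := by
  have hU := hT.isThorinMeasure
  have h := restrict_eq_of_laplaceExponent_eq (d₁ := d') (d₂ := d) hτ.ae_mem
    (hU.thorinLevyMeasure_ae_mem.mono fun x hx => hx.1)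
    (fun l hl => hτ.integrable_one_sub_exp hl) (fun l hl => (hU.integrable_one_sub_exp hl).1)
    (fun l hl => by
      rw [← hτ.laplace hl, hT.laplace 1 l hl, (hU.integrable_one_sub_exp hl).2]
      simp)
  rwa [Measure.restrict_eq_self_of_ae_mem (s := {0}ᶜ) (by
      rw [ae_iff]; simpa using hτ.triplet.isLevyMeasure.zero),
    Measure.restrict_eq_self_of_ae_mem (s := {0}ᶜ)
      (hU.thorinLevyMeasure_ae_mem.mono fun x hx => hx.2)] at h

/-! ### The law of Brownian motion at a vector of times -/

/-- Finitely many times are values of a nondecreasing sequence of times that starts at `0`. The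
index `i k` rather than the time `τ k` records which increments contribute to coordinate `k`, so
that ties need no treatment. -/
theorem exists_monotone_enumeration (τ : Fin n → ℝ≥0) :
    ∃ (s : ℕ → ℝ≥0) (i : Fin n → ℕ), Monotone s ∧ s 0 = 0 ∧ (∀ k, s (i k) = τ k) ∧
      ∀ k, i k ≤ n := by
  rcases Nat.eq_zero_or_pos n with rfl | hn
  · exact ⟨fun _ => 0, fun _ => 0, monotone_const, rfl, fun k => k.elim0, fun k => k.elim0⟩
  · let σ := Tuple.sort τ
    have hσ : Monotone (τ ∘ σ) := Tuple.monotone_sort τ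
    let s : ℕ → ℝ≥0 := fun j =>
      match j with
      | 0 => 0
      | j + 1 => τ (σ ⟨min j (n - 1), by omega⟩)
    refine ⟨s, fun k => (σ.symm k : ℕ) + 1, ?_, rfl, fun k => ?_, fun k => ?_⟩
    · refine monotone_nat_of_le_succ fun j => ?_
      cases j with
      | zero => exact zero_le
      | succ j => exact hσ (by simp only [Fin.mk_le_mk]; omega)
    · have : (⟨min (σ.symm k : ℕ) (n - 1), by omega⟩ : Fin n) = σ.symm k := by
        ext; simp only; omega
      simp only [s, this, Equiv.apply_symm_apply]
    · exact (σ.symm k).2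

theorem sum_range_ite_sub {G : Type*} [AddCommGroup G] (g : ℕ → G) {i m : ℕ} (him : i ≤ m) :
    ∑ j ∈ Finset.range m, (if j < i then g (j + 1) - g j else 0) = g i - g 0 := by
  rw [← Finset.sum_filter, ← Finset.sum_range_sub]
  refine Finset.sum_congr ?_ fun _ _ => rfl
  ext j; simp only [Finset.mem_filter, Finset.mem_range]; omega

/-- The coordinates `k` of `x` with `j < i k`; the remaining ones are replaced by `0`. -/
def truncCoords (i : Fin n → ℕ) (j : ℕ) (x : EuclideanSpace ℝ (Fin n)) :
    EuclideanSpace ℝ (Fin n) :=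
  WithLp.toLp 2 fun k => if j < i k then x k else 0

theorem measurable_truncCoords (i : Fin n → ℕ) (j : ℕ) : Measurable (truncCoords i j) := by
  refine (PiLp.continuous_toLp 2 _).measurable.comp (measurable_pi_lambda _ fun k => ?_)
  split_ifs
  · fun_prop
  · exact measurable_const

theorem inner_truncCoords (i : Fin n → ℕ) (j : ℕ) (x y : EuclideanSpace ℝ (Fin n)) :
    inner ℝ (truncCoords i j x) y = inner ℝ x (truncCoords i j y) := by
  simp only [PiLp.inner_apply, truncCoords]
  refine Finset.sum_congr rfl fun k _ => ?_
  split_ifs <;> simp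

theorem sum_sub_mul_inner_truncCoords {s : ℕ → ℝ} (h0 : s 0 = 0) {i : Fin n → ℕ} {m : ℕ}
    (him : ∀ k, i k ≤ m) {t : EuclideanSpace ℝ (Fin n)} (ht : ∀ k, s (i k) = t k)
    (μ θ : EuclideanSpace ℝ (Fin n)) :
    ∑ j ∈ Finset.range m, (s (j + 1) - s j) * inner ℝ μ (truncCoords i j θ)
      = inner ℝ (vecDiamond t μ) θ := by
  simp only [PiLp.inner_apply, truncCoords, vecDiamond, Finset.mul_sum]
  rw [Finset.sum_comm]
  refine Finset.sum_congr rfl fun k _ => ?_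
  have := sum_range_ite_sub s (him k)
  rw [h0, sub_zero, ht] at this
  simp only [RCLike.inner_apply, conj_trivial]
  rw [← this, Finset.sum_mul, Finset.mul_sum]
  refine Finset.sum_congr rfl fun j _ => ?_
  split_ifs <;> ring

theorem sum_sub_mul_matInner_truncCoords {s : ℕ → ℝ} (hs : Monotone s) (h0 : s 0 = 0)
    {i : Fin n → ℕ} {m : ℕ} (him : ∀ k, i k ≤ m) {t : EuclideanSpace ℝ (Fin n)}
    (ht : ∀ k, s (i k) = t k) (S : Matrix (Fin n) (Fin n) ℝ) (θ : EuclideanSpace ℝ (Fin n)) :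
    ∑ j ∈ Finset.range m, (s (j + 1) - s j)
        * matInner S (truncCoords i j θ) (truncCoords i j θ)
      = matInner (matDiamond t S) θ θ := by
  simp only [matInner, truncCoords, matDiamond, Finset.mul_sum, Matrix.of_apply]
  rw [Finset.sum_comm]
  refine Finset.sum_congr rfl fun k _ => ?_
  rw [Finset.sum_comm]
  refine Finset.sum_congr rfl fun l _ => ?_
  have := sum_range_ite_sub s (i := min (i k) (i l)) (m := m) (min_le_of_left_le (him k))
  rw [h0, sub_zero, hs.map_min, ht, ht] at this
  rw [← this, Finset.sum_mul, Finset.mul_sum, Finset.sum_mul]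
  refine Finset.sum_congr rfl fun j _ => ?_
  by_cases h1 : j < i k <;> by_cases h2 : j < i l <;> simp [h1, h2]; ring

section

variable {Ω : Type*} [MeasurableSpace Ω] {P : Measure Ω}
  {B : ℝ≥0 → Ω → EuclideanSpace ℝ (Fin n)} {μ : EuclideanSpace ℝ (Fin n)}
  {S : Matrix (Fin n) (Fin n) ℝ}

theorem measurable_atTimes (hB : ∀ t, Measurable (B t)) (t : EuclideanSpace ℝ (Fin n)) :
    Measurable (atTimes B t) := by
  refine (PiLp.continuous_toLp 2 _).measurable.comp (measurable_pi_lambda _ fun k => ?_)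
  have := hB (t k).toNNReal
  fun_prop

/-- Along an enumeration of the times, `B(t)` is a sum of independent increments, each with the
coordinates removed whose time has already elapsed. -/
theorem charFun_map_atTimes (hB : IsBrownianMotion P B μ S) {t : EuclideanSpace ℝ (Fin n)}
    (ht : t ∈ nonnegOrthant n) (θ : EuclideanSpace ℝ (Fin n)) :
    charFun (P.map (atTimes B t)) θ
      = Complex.exp (Complex.I * (inner ℝ (vecDiamond t μ) θ : ℝ)
          - (1 / 2 : ℂ) * (matInner (matDiamond t S) θ θ : ℝ)) := by
  obtain ⟨s, i, hs, h0, hsi, hin⟩ := exists_monotone_enumeration fun k => (t k).toNNReal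
  have hL := hB.isLevyProcess
  have hP := hL.isProbabilityMeasure
  have hmΔ : ∀ j, Measurable fun ω => B (s (j + 1)) ω - B (s j) ω := fun j =>
    (hL.measurable _).sub (hL.measurable _)
  have hind := (hL.indep.nat hs).comp (fun j => truncCoords i j)
    fun j => measurable_truncCoords i j
  have hae : atTimes B t =ᵐ[P] fun ω => ∑ j ∈ Finset.range n,
      (truncCoords i j ∘ fun ω => B (s (j + 1)) ω - B (s j) ω) ω := by
    filter_upwards [hL.start] with ω hω
    ext k
    have := sum_range_ite_sub (fun j => B (s j) ω k) (hin k)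
    simp only [h0, hω, PiLp.zero_apply, sub_zero, hsi] at this
    simp only [atTimes, WithLp.ofLp_sum, Finset.sum_apply, Function.comp_apply, truncCoords,
      PiLp.sub_apply, this]
  rw [Measure.map_congr hae, iIndepFun.charFun_map_fun_finsetSum_eq_prod
    (fun j _ => ((measurable_truncCoords i j).comp (hmΔ j)).aemeasurable) (hind.restrict _),
    Finset.prod_apply]
  have hfac : ∀ j, charFun (P.map (truncCoords i j ∘ fun ω => B (s (j + 1)) ω - B (s j) ω)) θ
      = Complex.exp (((s (j + 1) - s j : ℝ) : ℂ)
        * (Complex.I * (inner ℝ μ (truncCoords i j θ) : ℝ)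
          - (1 / 2 : ℂ) * (matInner S (truncCoords i j θ) (truncCoords i j θ) : ℝ))) := by
    intro j
    have hle : s j ≤ s (j + 1) := hs (Nat.le_succ j)
    have h1 : P.map (fun ω => B (s (j + 1)) ω - B (s j) ω) = P.map (B (s (j + 1) - s j)) := by
      rw [← hL.stationary (s j) (s (j + 1) - s j), add_tsub_cancel_of_le hle]
    rw [← Measure.map_map (measurable_truncCoords i j) (hmΔ j), h1, charFun_apply,
      integral_map (measurable_truncCoords i j).aemeasurable
        (by fun_prop : Continuous _).aestronglyMeasurable]
    simp only [inner_truncCoords]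
    rw [← charFun_apply, hB.charFun_eq, NNReal.coe_sub hle]
    simp [levyExponent]
  simp only [hfac]
  have hti : ∀ k, ((s (i k) : ℝ≥0) : ℝ) = t k := fun k => by
    rw [hsi, Real.coe_toNNReal _ (ht k)]
  rw [← Complex.exp_sum, ← sum_sub_mul_inner_truncCoords (s := fun j => (s j : ℝ)) (by simp [h0])
      hin hti,
    ← sum_sub_mul_matInner_truncCoords (s := fun j => (s j : ℝ)) (fun a b h => hs h)
      (by simp [h0]) hin hti]
  push_cast
  rw [Finset.mul_sum, Finset.mul_sum, ← Finset.sum_sub_distrib]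
  congr 1
  refine Finset.sum_congr rfl fun j _ => ?_
  ring

theorem map_atTimes_eq_multivariateGaussian (hB : IsBrownianMotion P B μ S)
    {t : EuclideanSpace ℝ (Fin n)} (ht : t ∈ nonnegOrthant n) :
    P.map (atTimes B t) = multivariateGaussian (vecDiamond t μ) (matDiamond t S) := by
  have hP := hB.isLevyProcess.isProbabilityMeasure
  have := Measure.isProbabilityMeasure_map (μ := P)
    (measurable_atTimes hB.isLevyProcess.measurable t).aemeasurable
  refine Measure.ext_of_charFun ?_
  ext θ
  rw [charFun_map_atTimes hB ht,
    charFun_multivariateGaussian (posSemidef_matDiamond ht hB.posSemidef),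
    matInner_eq_dotProduct, real_inner_comm]
  congr 1
  push_cast
  ring

/-- A Brownian motion with a coordinate evaluated at time `0` charges no set of vectors with nonzero
coordinates. -/
theorem map_atTimes_apply_eq_zero (hB : IsBrownianMotion P B μ S)
    {t : EuclideanSpace ℝ (Fin n)} (ht : t ∈ nonnegOrthant n) (ht' : t ∉ posOrthant n)
    {A : Set (EuclideanSpace ℝ (Fin n))} (hA : MeasurableSet A) (hA' : A ⊆ nonzeroCoords n) :
    P.map (atTimes B t) A = 0 := by
  obtain ⟨k, hk⟩ : ∃ k, ¬ 0 < t k := by simpa [posOrthant] using ht'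
  have hk0 : t k = 0 := le_antisymm (not_lt.1 hk) (ht k)
  rw [Measure.map_apply (measurable_atTimes hB.isLevyProcess.measurable t) hA]
  refine measure_mono_null (fun ω hω => ?_) (ae_iff.1 hB.isLevyProcess.start)
  intro h0
  exact hA' hω k (by simp [atTimes, hk0, h0])

end

/-! ### Densities of Gaussian laws -/

/-- Both sides have the characteristic function `exp (-‖θ‖ ^ 2 / 2)`. -/
theorem stdGaussian_eq_withDensity :
    stdGaussian (EuclideanSpace ℝ (Fin n)) = volume.withDensity fun x =>
      ENNReal.ofReal ((2 * Real.pi) ^ (-(n : ℝ) / 2) * Real.exp (-‖x‖ ^ 2 / 2)) := by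
  set c : ℝ := (2 * Real.pi) ^ (-(n : ℝ) / 2) with hc
  have hc0 : 0 < c := by positivity
  have hint : Integrable fun x : EuclideanSpace ℝ (Fin n) => c * Real.exp (-‖x‖ ^ 2 / 2) := by
    refine Integrable.const_mul (Integrable.of_integral_ne_zero ?_) c
    have := GaussianFourier.integral_rexp_neg_mul_sq_norm
      (V := EuclideanSpace ℝ (Fin n)) (b := 1 / 2) (by norm_num)
    rw [show (fun x : EuclideanSpace ℝ (Fin n) => Real.exp (-‖x‖ ^ 2 / 2))
      = fun x => Real.exp (-(1 / 2) * ‖x‖ ^ 2) by funext x; ring_nf, this]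
    positivity
  have : IsFiniteMeasure (volume.withDensity fun x : EuclideanSpace ℝ (Fin n) =>
      ENNReal.ofReal (c * Real.exp (-‖x‖ ^ 2 / 2))) := isFiniteMeasure_withDensity_ofReal hint.2
  refine Measure.ext_of_charFun ?_
  ext θ
  rw [charFun_stdGaussian, charFun_apply, integral_withDensity_eq_integral_toReal_smul
    (by fun_prop) (by simp)]
  have h1 : ∀ x : EuclideanSpace ℝ (Fin n),
      (ENNReal.ofReal (c * Real.exp (-‖x‖ ^ 2 / 2))).toReal
        • Complex.exp ((inner ℝ x θ : ℝ) * Complex.I)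
      = c * Complex.exp (-(1 / 2 : ℂ) * ‖x‖ ^ 2 + Complex.I * (inner ℝ θ x : ℝ)) := by
    intro x
    rw [ENNReal.toReal_ofReal (by positivity), Complex.real_smul, Complex.ofReal_mul,
      Complex.ofReal_exp, mul_assoc, ← Complex.exp_add, real_inner_comm]
    push_cast
    ring_nf
  have h2 := GaussianFourier.integral_cexp_neg_mul_sq_norm_add
      (V := EuclideanSpace ℝ (Fin n)) (b := 1 / 2) (by norm_num) Complex.I θ
  simp only [h1]
  rw [integral_const_mul]
  erw [h2]
  have h3 : (c : ℂ) * ((Real.pi : ℂ) / (1 / 2))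
      ^ ((Module.finrank ℝ (EuclideanSpace ℝ (Fin n)) : ℂ) / 2) = 1 := by
    rw [finrank_euclideanSpace_fin, show (Real.pi : ℂ) / (1 / 2) = ((2 * Real.pi : ℝ) : ℂ) by
        push_cast; ring,
      show (n : ℂ) / 2 = (((n : ℝ) / 2 : ℝ) : ℂ) by push_cast; ring,
      ← Complex.ofReal_cpow (by positivity), ← Complex.ofReal_mul, hc, neg_div,
      Real.rpow_neg (by positivity), inv_mul_cancel₀ (by positivity), Complex.ofReal_one]
  rw [← mul_assoc, h3, one_mul, Complex.I_sq]
  congr 1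
  ring

theorem det_toEuclideanLin (R : Matrix (Fin n) (Fin n) ℝ) :
    LinearMap.det (Matrix.toEuclideanLin R) = R.det := by
  rw [Matrix.toEuclideanLin_eq_toLin_orthonormal, LinearMap.det_toLin]

/-- The square root of the covariance matrix `N` maps the norm to `‖·‖_{N⁻¹}`. -/
theorem matInner_inv_sqrt {N R : Matrix (Fin n) (Fin n) ℝ} (hN : N.det ≠ 0) (hR : R * R = N)
    (hRs : R.IsHermitian) (x : EuclideanSpace ℝ (Fin n)) :
    matInner N⁻¹ (Matrix.toEuclideanCLM (𝕜 := ℝ) R x) (Matrix.toEuclideanCLM (𝕜 := ℝ) R x)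
      = ‖x‖ ^ 2 := by
  have hRd : IsUnit R.det := by
    rw [isUnit_iff_ne_zero]; rintro h; apply hN; rw [← hR, Matrix.det_mul, h, zero_mul]
  rw [matInner_eq_dotProduct, Matrix.ofLp_toEuclideanCLM, Matrix.mulVec_mulVec, ← hR,
    Matrix.mul_inv_rev, Matrix.nonsing_inv_mul_cancel_right _ _ hRd,
    ← Matrix.vecMul_transpose, ← Matrix.dotProduct_mulVec, Matrix.mulVec_mulVec,
    show R.transpose = R from hRs, Matrix.mul_nonsing_inv _ hRd, Matrix.one_mulVec,
    EuclideanSpace.real_norm_sq_eq]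
  simp [dotProduct, sq]

open scoped MatrixOrder Matrix.Norms.L2Operator in
/-- The affine change of variables `x ↦ m + N ^ (1 / 2) x` in the standard Gaussian density. -/
theorem multivariateGaussian_eq_withDensity (m : EuclideanSpace ℝ (Fin n))
    {N : Matrix (Fin n) (Fin n) ℝ} (hN : N.PosDef) :
    multivariateGaussian m N = volume.withDensity fun x =>
      ENNReal.ofReal ((2 * Real.pi) ^ (-(n : ℝ) / 2) * (Real.sqrt N.det)⁻¹
        * Real.exp (-matInner N⁻¹ (x - m) (x - m) / 2)) := by
  set R := CFC.sqrt N with hRdef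
  have hR : R * R = N := CFC.sqrt_mul_sqrt_self N hN.posSemidef.nonneg
  have hRs : R.IsHermitian := (Matrix.nonneg_iff_posSemidef.1 (CFC.sqrt_nonneg N)).1
  have hRd : R.det = Real.sqrt N.det := by
    rw [hRdef, hN.posSemidef.det_sqrt, RCLike.sqrt_of_nonneg hN.det_pos.le]
    rfl
  have hd : 0 < Real.sqrt N.det := Real.sqrt_pos.2 hN.det_pos
  set f := Matrix.toEuclideanCLM (𝕜 := ℝ) R with hf
  set F : EuclideanSpace ℝ (Fin n) → EuclideanSpace ℝ (Fin n) := fun x => m + f x with hF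
  have hFm : Measurable F := by fun_prop
  have hvol : (volume : Measure (EuclideanSpace ℝ (Fin n))).map F
      = ENNReal.ofReal (Real.sqrt N.det)⁻¹ • volume := by
    have hdet : LinearMap.det (f : EuclideanSpace ℝ (Fin n) →ₗ[ℝ] EuclideanSpace ℝ (Fin n))
        = Real.sqrt N.det := by
      rw [hf, Matrix.coe_toEuclideanCLM_eq_toEuclideanLin, det_toEuclideanLin, hRd]
    rw [show F = (fun x => m + x) ∘ f from rfl, ← Measure.map_map (measurable_const_add m)
      f.measurable]
    have := Measure.map_linearMap_addHaar_eq_smul_addHaar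
      (volume : Measure (EuclideanSpace ℝ (Fin n))) (f := f.toLinearMap) (hdet ▸ hd.ne')
    rw [hdet, abs_of_pos (inv_pos.2 hd)] at this
    erw [this]
    rw [Measure.map_smul, map_add_left_eq_self]
  set c : ℝ := (2 * Real.pi) ^ (-(n : ℝ) / 2) with hc
  have hc0 : 0 < c := by positivity
  have hmeas : Measurable fun x : EuclideanSpace ℝ (Fin n) =>
      matInner N⁻¹ (x - m) (x - m) := by
    unfold matInner
    fun_prop
  ext A hA
  rw [multivariateGaussian, Measure.map_apply hFm hA, stdGaussian_eq_withDensity,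
    withDensity_apply _ (hFm hA), withDensity_apply _ hA]
  have h1 : ∀ x, ‖x‖ ^ 2 = matInner N⁻¹ (F x - m) (F x - m) := fun x => by
    rw [hF, add_sub_cancel_left, matInner_inv_sqrt hN.det_pos.ne' hR hRs]
  have h2 : ∫⁻ x in F ⁻¹' A, ENNReal.ofReal (c * Real.exp (-‖x‖ ^ 2 / 2))
      = ∫⁻ y in A, ENNReal.ofReal (c * Real.exp (-matInner N⁻¹ (y - m) (y - m) / 2))
        ∂(volume.map F) := by
    rw [setLIntegral_map hA (by fun_prop) hFm]
    simp only [h1]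
  rw [h2, hvol, Measure.restrict_smul, lintegral_smul_measure, smul_eq_mul,
    ← lintegral_const_mul _ (by fun_prop)]
  refine lintegral_congr fun x => ?_
  rw [← ENNReal.ofReal_mul (by positivity)]
  congr 1
  ring

/-! ### The density of the Lévy measure -/

/-- The density of the law of `B(t)` for `t ∈ (0, ∞)ⁿ`, as a function of the pair `(t, x)`. -/
def gaussDensity (μ : EuclideanSpace ℝ (Fin n)) (S : Matrix (Fin n) (Fin n) ℝ)
    (p : EuclideanSpace ℝ (Fin n) × EuclideanSpace ℝ (Fin n)) : ℝ≥0∞ :=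
  ENNReal.ofReal ((2 * Real.pi) ^ (-(n : ℝ) / 2) * (Real.sqrt (matDiamond p.1 S).det)⁻¹
    * Real.exp (-matInner (matDiamond p.1 S)⁻¹ (p.2 - vecDiamond p.1 μ) (p.2 - vecDiamond p.1 μ)
      / 2))

theorem measurable_gaussDensity (μ : EuclideanSpace ℝ (Fin n)) (S : Matrix (Fin n) (Fin n) ℝ) :
    Measurable (gaussDensity μ S) := by
  have h0 : Measurable fun p : EuclideanSpace ℝ (Fin n) × EuclideanSpace ℝ (Fin n) => p.1 :=
    measurable_fst
  have h1 := (measurable_vecDiamond μ).comp h0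
  have h2 := measurable_matInner_inv S h0 (measurable_snd.sub h1) (measurable_snd.sub h1)
  have h3 := (continuous_matDiamond S).matrix_det.measurable.comp h0
  exact ((h3.sqrt.inv.const_mul _).mul (h2.neg.div_const 2).exp).ennreal_ofReal

theorem map_atTimes_apply {Ω : Type*} [MeasurableSpace Ω] {P : Measure Ω}
    {B : ℝ≥0 → Ω → EuclideanSpace ℝ (Fin n)} {μ : EuclideanSpace ℝ (Fin n)}
    {S : Matrix (Fin n) (Fin n) ℝ} (hB : IsBrownianMotion P B μ S) (hS : S.PosDef)
    {t : EuclideanSpace ℝ (Fin n)} (ht : t ∈ nonnegOrthant n)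
    {A : Set (EuclideanSpace ℝ (Fin n))} (hA : MeasurableSet A) (hA' : A ⊆ nonzeroCoords n) :
    P.map (atTimes B t) A
      = (posOrthant n).indicator (fun t => ∫⁻ x in A, gaussDensity μ S (t, x)) t := by
  by_cases htp : t ∈ posOrthant n
  · rw [indicator_of_mem htp, map_atTimes_eq_multivariateGaussian hB ht,
      multivariateGaussian_eq_withDensity _ (posDef_matDiamond hS htp), withDensity_apply _ hA]
    rfl
  · rw [indicator_of_notMem htp, map_atTimes_apply_eq_zero hB ht htp hA hA']

theorem matDiamond_smul {r : ℝ} (hr : 0 ≤ r) (u : EuclideanSpace ℝ (Fin n))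
    (S : Matrix (Fin n) (Fin n) ℝ) : matDiamond (r • u) S = r • matDiamond u S := by
  ext k l
  simp only [matDiamond, PiLp.smul_apply, smul_eq_mul, Matrix.of_apply, Matrix.smul_apply,
    ← mul_min_of_nonneg _ _ hr]
  ring

theorem vecDiamond_smul (r : ℝ) (u μ : EuclideanSpace ℝ (Fin n)) :
    vecDiamond (r • u) μ = r • vecDiamond u μ := by
  ext k
  simp only [vecDiamond, PiLp.smul_apply, smul_eq_mul]
  ring

theorem smul_mem_posOrthant_iff {r : ℝ} (hr : 0 < r) {u : EuclideanSpace ℝ (Fin n)} :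
    r • u ∈ posOrthant n ↔ u ∈ posOrthant n := by
  simp [posOrthant, hr]

/-- The exponent of the Gaussian density at time `r • u`. -/
theorem matInner_inv_smul_sub_smul {N : Matrix (Fin n) (Fin n) ℝ} (hN : N.PosDef) {r : ℝ}
    (hr : r ≠ 0) (x m : EuclideanSpace ℝ (Fin n)) :
    matInner (r • N)⁻¹ (x - r • m) (x - r • m)
      = matInner N⁻¹ x x / r - 2 * matInner N⁻¹ x m + r * matInner N⁻¹ m m := by
  have hc := matInner_comm hN.posSemidef.inv x m
  have : (r • N)⁻¹ = r⁻¹ • N⁻¹ := by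
    have := Matrix.inv_smul' N (Units.mk0 r hr) (isUnit_iff_ne_zero.2 hN.det_pos.ne')
    simpa [Units.smul_def] using this
  rw [this]
  have h : matInner (r⁻¹ • N⁻¹) (x - r • m) (x - r • m)
      = r⁻¹ * (matInner N⁻¹ x x - r * matInner N⁻¹ x m - r * matInner N⁻¹ m x
        + r ^ 2 * matInner N⁻¹ m m) := by
    simp only [matInner, Finset.mul_sum, ← Finset.sum_add_distrib, ← Finset.sum_sub_distrib]
    refine Finset.sum_congr rfl fun k _ => Finset.sum_congr rfl fun l _ => ?_
    simp only [PiLp.sub_apply, PiLp.smul_apply, smul_eq_mul, Matrix.smul_apply]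
    ring
  rw [h, ← hc]
  field_simp
  ring

/-- Integration of the Gaussian density along the ray through `u` gives a Bessel function, with
order `n / 2` and squared argument `𝔄(x, u)²`. -/
theorem lintegral_thorinDensity_mul_gaussDensity (μ : EuclideanSpace ℝ (Fin n))
    {S : Matrix (Fin n) (Fin n) ℝ} (hS : S.PosDef) (hn : 0 < n) {x : EuclideanSpace ℝ (Fin n)}
    (hx : x ∈ nonzeroCoords n) {u : EuclideanSpace ℝ (Fin n)} (hu : u ∈ posOrthant n) :
    ∫⁻ r in Ioi (0 : ℝ), thorinDensity (u, r) * gaussDensity μ S (r • u, x)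
      = ENNReal.ofReal (cConst n * (Real.exp (fE μ S x u)
        * realBessel ((n : ℝ) / 2) (fA μ S x u ^ 2) / fD S x u)) := by
  have hN := posDef_matDiamond hS hu
  set N := matDiamond u S with hNdef
  set m := vecDiamond u μ with hm
  have hx0 : x ≠ 0 := fun h => hx ⟨0, hn⟩ (by simp [h])
  have ha : 0 < matInner N⁻¹ x x := matInner_pos hN.inv hx0
  set a := matInner N⁻¹ x x with hadef
  have hq : 0 ≤ matInner N⁻¹ m m := matInner_nonneg hN.posSemidef.inv m
  have hu0 := norm_pos_of_mem_posOrthant hn hu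
  set b := 2 * ‖u‖ ^ 2 + matInner N⁻¹ m m with hb
  have hb0 : 0 < b := by positivity
  have hd : 0 < N.det := hN.det_pos
  have hE : fE μ S x u = matInner N⁻¹ x m := rfl
  set K : ℝ := (2 * Real.pi) ^ (-(n : ℝ) / 2) * (Real.sqrt N.det)⁻¹ * Real.exp (fE μ S x u)
    with hK
  have hK0 : 0 ≤ K := by positivity
  have hint : ∀ r ∈ Ioi (0 : ℝ), thorinDensity (u, r) * gaussDensity μ S (r • u, x)
      = ENNReal.ofReal K * ENNReal.ofReal (r ^ (-((n : ℝ) / 2) - 1)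
        * Real.exp (-(a / (2 * r)) - r * b / 2)) := by
    intro r hr
    have hr : 0 < r := hr
    simp only [thorinDensity, gaussDensity]
    rw [matDiamond_smul hr.le, vecDiamond_smul, matInner_inv_smul_sub_smul hN hr.ne',
      Matrix.det_smul, Fintype.card_fin, ← ENNReal.ofReal_mul (by positivity),
      ← ENNReal.ofReal_mul hK0, ← hNdef, ← hm, ← hadef]
    congr 1
    have hs : Real.sqrt (r ^ n * N.det) = r ^ ((n : ℝ) / 2) * Real.sqrt N.det := by
      rw [Real.sqrt_mul (by positivity), Real.sqrt_eq_rpow (r ^ n), ← Real.rpow_natCast,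
        ← Real.rpow_mul hr.le]
      ring_nf
    have he : Real.exp (-(r * ‖u‖ ^ 2))
          * Real.exp (-(a / r - 2 * matInner N⁻¹ x m + r * matInner N⁻¹ m m) / 2)
        = Real.exp (fE μ S x u) * Real.exp (-(a / (2 * r)) - r * b / 2) := by
      rw [← Real.exp_add, ← Real.exp_add, hE, hb]
      congr 1
      field_simp
      ring
    rw [hs, hK, Real.rpow_sub hr, Real.rpow_neg hr.le, Real.rpow_one, mul_inv]
    linear_combination (2 * Real.pi) ^ (-(n : ℝ) / 2) * (Real.sqrt N.det)⁻¹
      * (r ^ ((n : ℝ) / 2))⁻¹ * r⁻¹ * he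
  rw [setLIntegral_congr_fun measurableSet_Ioi hint, lintegral_const_mul' _ _ ENNReal.ofReal_ne_top,
    lintegral_rpow_mul_exp _ ha hb0, ← ENNReal.ofReal_mul hK0, fA_sq hS x hu, ← hNdef, ← hm, ← hb,
    ← hadef, mul_comm b a]
  congr 1
  have hD : fD S x u = a ^ ((n : ℝ) / 2) * Real.sqrt N.det := by
    rw [fD, ← hNdef, matNorm, ← hadef, Real.sqrt_eq_rpow, ← Real.rpow_natCast,
      ← Real.rpow_mul ha.le]
    ring_nf
  rw [hD, hK, cConst, neg_div, Real.rpow_neg (by positivity), Real.rpow_neg ha.le]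
  field_simp

/-! ### Polar coordinates -/

theorem lintegral_eq_lintegral_toSphere (hn : 0 < n) {f : EuclideanSpace ℝ (Fin n) → ℝ≥0∞}
    (hf : Measurable f) :
    ∫⁻ x, f x = ∫⁻ s : Metric.sphere (0 : EuclideanSpace ℝ (Fin n)) 1,
      (∫⁻ r in Ioi (0 : ℝ), ENNReal.ofReal (r ^ (n - 1))
        * f (r • (s : EuclideanSpace ℝ (Fin n)))) ∂(volume : Measure
          (EuclideanSpace ℝ (Fin n))).toSphere := by
  have : Nontrivial (EuclideanSpace ℝ (Fin n)) := by
    have : Nonempty (Fin n) := ⟨⟨0, hn⟩⟩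
    infer_instance
  have hmp := Measure.measurePreserving_homeomorphUnitSphereProd
    (volume : Measure (EuclideanSpace ℝ (Fin n)))
  rw [finrank_euclideanSpace_fin] at hmp
  have hg : Measurable fun p : Metric.sphere (0 : EuclideanSpace ℝ (Fin n)) 1 × Ioi (0 : ℝ) =>
      f ((p.2 : ℝ) • (p.1 : EuclideanSpace ℝ (Fin n))) := by fun_prop
  conv_lhs => rw [← restrict_compl_singleton (μ := volume) (0 : EuclideanSpace ℝ (Fin n))]
  rw [← lintegral_subtype_comap (measurableSet_singleton _).compl]
  have h1 : ∀ x : ({0}ᶜ : Set (EuclideanSpace ℝ (Fin n))), f x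
      = f (((homeomorphUnitSphereProd _ x).2 : ℝ)
        • ((homeomorphUnitSphereProd _ x).1 : EuclideanSpace ℝ (Fin n))) := by
    intro x
    conv_lhs => rw [← (homeomorphUnitSphereProd _).symm_apply_apply x]
    rw [homeomorphUnitSphereProd_symm_apply_coe]
  rw [lintegral_congr h1, hmp.lintegral_comp hg, lintegral_prod _ hg.aemeasurable]
  refine lintegral_congr fun s => ?_
  have hm : Measurable fun r : Ioi (0 : ℝ) => ENNReal.ofReal ((r : ℝ) ^ (n - 1)) := by fun_prop
  rw [Measure.volumeIoiPow, lintegral_withDensity_eq_lintegral_mul _ hm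
    (g := fun r : Ioi (0 : ℝ) => f ((r : ℝ) • (s : EuclideanSpace ℝ (Fin n)))) (by fun_prop)]
  exact lintegral_subtype_comap measurableSet_Ioi fun r : ℝ => ENNReal.ofReal (r ^ (n - 1))
        * f (r • (s : EuclideanSpace ℝ (Fin n)))

/-- The density on `{x | ∀ k, x k ≠ 0}` of the Lévy measure of the weak subordination of Brownian
motion by a Thorin subordinator with Thorin measure `U`. -/
def levyDensity (μ : EuclideanSpace ℝ (Fin n)) (S : Matrix (Fin n) (Fin n) ℝ)
    (U : Measure (EuclideanSpace ℝ (Fin n))) (x : EuclideanSpace ℝ (Fin n)) : ℝ≥0∞ :=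
  ∫⁻ u in posOrthant n, (∫⁻ r in Ioi (0 : ℝ),
    thorinDensity (u, r) * gaussDensity μ S (r • u, x)) ∂U

theorem measurable_lintegral_thorinDensity_mul_gaussDensity (μ : EuclideanSpace ℝ (Fin n))
    (S : Matrix (Fin n) (Fin n) ℝ) :
    Measurable fun p : EuclideanSpace ℝ (Fin n) × EuclideanSpace ℝ (Fin n) =>
      ∫⁻ r in Ioi (0 : ℝ), thorinDensity (p.1, r) * gaussDensity μ S (r • p.1, p.2) := by
  have h : Measurable fun q : (EuclideanSpace ℝ (Fin n) × EuclideanSpace ℝ (Fin n)) × ℝ =>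
      thorinDensity (q.1.1, q.2) * gaussDensity μ S (q.2 • q.1.1, q.1.2) := by
    have h1 : Measurable fun q : (EuclideanSpace ℝ (Fin n) × EuclideanSpace ℝ (Fin n)) × ℝ =>
      (q.1.1, q.2) := by fun_prop
    have h2 : Measurable fun q : (EuclideanSpace ℝ (Fin n) × EuclideanSpace ℝ (Fin n)) × ℝ =>
      (q.2 • q.1.1, q.1.2) := by fun_prop
    exact (measurable_thorinDensity.comp h1).mul ((measurable_gaussDensity μ S).comp h2)
  exact h.lintegral_prod_right'

theorem measurable_levyDensity (μ : EuclideanSpace ℝ (Fin n)) (S : Matrix (Fin n) (Fin n) ℝ)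
    (U : Measure (EuclideanSpace ℝ (Fin n))) [SFinite U] : Measurable (levyDensity μ S U) := by
  have h := (measurable_lintegral_thorinDensity_mul_gaussDensity μ S).comp measurable_swap
  unfold levyDensity
  exact h.lintegral_prod_right' (ν := U.restrict (posOrthant n))

/-- Only times in the open orthant contribute, and there Tonelli's theorem exchanges the integral of
the Gaussian density over `A` with the integral over the times `r • u`. -/
theorem lintegral_map_atTimes_apply {Ω : Type*} [MeasurableSpace Ω] {P : Measure Ω}
    {B : ℝ≥0 → Ω → EuclideanSpace ℝ (Fin n)} {μ : EuclideanSpace ℝ (Fin n)}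
    {S : Matrix (Fin n) (Fin n) ℝ} (hB : IsBrownianMotion P B μ S) (hS : S.PosDef)
    {U : Measure (EuclideanSpace ℝ (Fin n))} (hU : IsThorinMeasure U)
    {A : Set (EuclideanSpace ℝ (Fin n))} (hA : MeasurableSet A) (hA' : A ⊆ nonzeroCoords n) :
    ∫⁻ t, P.map (atTimes B t) A ∂(thorinLevyMeasure U) = ∫⁻ x in A, levyDensity μ S U x := by
  have hσ := hU.sigmaFinite
  have hg := measurable_gaussDensity μ S
  have hm : Measurable fun t => (posOrthant n).indicator
      (fun t => ∫⁻ x in A, gaussDensity μ S (t, x)) t :=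
    (Measurable.lintegral_prod_right' hg).indicator measurableSet_posOrthant
  have h1 : ∫⁻ t, P.map (atTimes B t) A ∂(thorinLevyMeasure U) = ∫⁻ t, (posOrthant n).indicator
      (fun t => ∫⁻ x in A, gaussDensity μ S (t, x)) t ∂(thorinLevyMeasure U) := by
    refine lintegral_congr_ae ?_
    filter_upwards [hU.thorinLevyMeasure_ae_mem] with t ht
    exact map_atTimes_apply hB hS ht.1 hA hA'
  have h2 : ∀ u, ∫⁻ r in Ioi (0 : ℝ), thorinDensity (u, r) * (posOrthant n).indicator
        (fun t => ∫⁻ x in A, gaussDensity μ S (t, x)) (r • u)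
      = (posOrthant n).indicator (fun u => ∫⁻ x in A, ∫⁻ r in Ioi (0 : ℝ),
        thorinDensity (u, r) * gaussDensity μ S (r • u, x)) u := by
    intro u
    by_cases hu : u ∈ posOrthant n
    · rw [indicator_of_mem hu, lintegral_lintegral_swap]
      · refine setLIntegral_congr_fun measurableSet_Ioi fun r (hr : 0 < r) => ?_
        rw [indicator_of_mem ((smul_mem_posOrthant_iff hr).2 hu), lintegral_const_mul _
          (f := fun x => gaussDensity μ S (r • u, x)) (hg.comp measurable_prodMk_left)]
      · refine Measurable.aemeasurable ?_
        exact (measurable_thorinDensity.comp (by fun_prop)).mul (hg.comp (by fun_prop))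
    · rw [indicator_of_notMem hu, ← lintegral_zero (μ := volume.restrict (Ioi (0 : ℝ)))]
      refine setLIntegral_congr_fun measurableSet_Ioi fun r (hr : 0 < r) => ?_
      rw [indicator_of_notMem (mt (smul_mem_posOrthant_iff hr).1 hu), mul_zero]
  rw [h1, lintegral_thorinLevyMeasure U hm, lintegral_congr h2,
    lintegral_indicator measurableSet_posOrthant, lintegral_lintegral_swap
      (measurable_lintegral_thorinDensity_mul_gaussDensity μ S).aemeasurable]
  rfl

/-- The Lévy density at `r • s` is `r ^ (-n) ℌ_s(r)`, by homogeneity of `𝔄`, `𝔇` and `𝔈`. -/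
theorem ofReal_pow_mul_levyDensity_smul (hn : 2 ≤ n) (μ : EuclideanSpace ℝ (Fin n))
    {S : Matrix (Fin n) (Fin n) ℝ} (hS : S.PosDef) {U : Measure (EuclideanSpace ℝ (Fin n))}
    (hU : IsThorinMeasure U) {s : EuclideanSpace ℝ (Fin n)} (hs : s ∈ nonzeroCoords n) {r : ℝ}
    (hr : 0 < r) :
    ENNReal.ofReal (r ^ (n - 1)) * levyDensity μ S U (r • s)
      = ENNReal.ofReal ((fH μ S U s (r : ℂ)).re / r) := by
  have hn0 : 0 < n := by omega
  have hrs : r • s ∈ nonzeroCoords n := fun k => by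
    simpa [hr.ne'] using hs k
  have hint : IntegrableOn (fun u => Real.exp (r * fE μ S s u)
      * realBessel ((n : ℝ) / 2) ((r * fA μ S s u) ^ 2) / fD S s u) (posOrthant n) U := by
    refine (integrableOn_besselTerm hn μ hS hs hU (ofReal_mem_besselDomain hr)).re.congr ?_
    filter_upwards [ae_restrict_mem measurableSet_posOrthant] with u hu
    rw [besselTerm_ofReal hn0 hS hs _ hr hu]
    rfl
  have h0 : 0 ≤ᵐ[U.restrict (posOrthant n)] fun u => Real.exp (r * fE μ S s u)
      * realBessel ((n : ℝ) / 2) ((r * fA μ S s u) ^ 2) / fD S s u := by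
    filter_upwards [ae_restrict_mem measurableSet_posOrthant] with u hu
    exact div_nonneg (mul_nonneg (Real.exp_pos _).le (realBessel_nonneg _ _)) (fD_pos hS hs hu).le
  rw [fH_ofReal hn0 μ hS hs U hr, Complex.ofReal_re, mul_div_right_comm,
    ENNReal.ofReal_mul (div_nonneg (cConst_nonneg n) hr.le),
    ofReal_integral_eq_lintegral_ofReal hint h0, levyDensity,
    ← lintegral_const_mul' _ _ ENNReal.ofReal_ne_top,
    ← lintegral_const_mul' _ _ ENNReal.ofReal_ne_top]
  refine setLIntegral_congr_fun measurableSet_posOrthant fun u hu => ?_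
  rw [lintegral_thorinDensity_mul_gaussDensity μ hS hn0 hrs hu,
    ← ENNReal.ofReal_mul (by positivity),
    ← ENNReal.ofReal_mul (div_nonneg (cConst_nonneg n) hr.le), fE_smul, fA_smul _ _ hr.le,
    fD_smul _ hr.le]
  congr 1
  have hp : r ^ n = r ^ (n - 1) * r := by rw [← pow_succ, Nat.sub_add_cancel hn0]
  have := (fD_pos hS hs hu).ne'
  rw [hp]
  field_simp

theorem setLIntegral_levyDensity (hn : 2 ≤ n) (μ : EuclideanSpace ℝ (Fin n))
    {S : Matrix (Fin n) (Fin n) ℝ} (hS : S.PosDef) {U : Measure (EuclideanSpace ℝ (Fin n))}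
    (hU : IsThorinMeasure U) {A : Set (EuclideanSpace ℝ (Fin n))} (hA : MeasurableSet A)
    (hA' : A ⊆ nonzeroCoords n) :
    ∫⁻ x in A, levyDensity μ S U x
      = ∫⁻ s in {s : Metric.sphere (0 : EuclideanSpace ℝ (Fin n)) 1 |
            (s : EuclideanSpace ℝ (Fin n)) ∈ nonzeroCoords n},
          (∫⁻ r in Ioi (0 : ℝ),
            A.indicator (fun _ => ENNReal.ofReal ((fH μ S U s (r : ℂ)).re / r))
              (r • (s : EuclideanSpace ℝ (Fin n))))
          ∂((volume : Measure (EuclideanSpace ℝ (Fin n))).toSphere) := by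
  have hσ := hU.sigmaFinite
  rw [← lintegral_indicator hA, lintegral_eq_lintegral_toSphere (by omega)
    ((measurable_levyDensity μ S U).indicator hA), ← lintegral_indicator
      (s := {s : Metric.sphere (0 : EuclideanSpace ℝ (Fin n)) 1 |
        (s : EuclideanSpace ℝ (Fin n)) ∈ nonzeroCoords n})
      (measurable_subtype_coe measurableSet_nonzeroCoords)]
  refine lintegral_congr fun s => ?_
  by_cases hs : (s : EuclideanSpace ℝ (Fin n)) ∈ nonzeroCoords n
  · rw [indicator_of_mem (by exact hs)]
    refine setLIntegral_congr_fun measurableSet_Ioi fun r (hr : 0 < r) => ?_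
    by_cases hrs : r • (s : EuclideanSpace ℝ (Fin n)) ∈ A
    · rw [indicator_of_mem hrs, indicator_of_mem hrs,
        ofReal_pow_mul_levyDensity_smul hn μ hS hU hs hr]
    · rw [indicator_of_notMem hrs, indicator_of_notMem hrs, mul_zero]
  · rw [indicator_of_notMem (by exact hs), ← lintegral_zero (μ := volume.restrict (Ioi (0 : ℝ)))]
    refine setLIntegral_congr_fun measurableSet_Ioi fun r (hr : 0 < r) => ?_
    rw [indicator_of_notMem, mul_zero]
    intro h
    exact hs fun k hk => hA' h k (by simp [hk])

end

end WVGG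

theorem mainTheorem6 {n : ℕ} (hn : 2 ≤ n)
    {Ω : Type*} [MeasurableSpace Ω] (P : Measure Ω)
    (X : ℝ≥0 → Ω → EuclideanSpace ℝ (Fin n))
    (d μ : EuclideanSpace ℝ (Fin n)) (S : Matrix (Fin n) (Fin n) ℝ)
    (U ν : Measure (EuclideanSpace ℝ (Fin n)))
    (hX : WVGG.IsWVGG P X d μ S U) (hν : WVGG.IsLevyMeasureOf P X ν)
    (hS : S.det ≠ 0)
    (z : EuclideanSpace ℝ (Fin n)) (hz : z ∈ WVGG.nonzeroCoords n) :
    -- holomorphy, nonnegativity and the derivative under the integral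
    ((∀ w ∈ WVGG.besselDomain, IntegrableOn
        (fun u => WVGG.besselTerm ((n : ℝ) / 2) μ S z w u) (WVGG.posOrthant n) U) ∧
      DifferentiableOn ℂ (WVGG.fH μ S U z) WVGG.besselDomain ∧
      (∀ r : ℝ, 0 < r → (WVGG.fH μ S U z r).im = 0 ∧ 0 ≤ (WVGG.fH μ S U z r).re) ∧
      (∀ w ∈ WVGG.besselDomain,
        IntegrableOn (fun u => (WVGG.fE μ S z u : ℂ)
          * WVGG.besselTerm ((n : ℝ) / 2) μ S z w u) (WVGG.posOrthant n) U ∧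
        IntegrableOn (fun u => (WVGG.fA μ S z u : ℂ) ^ 2
          * WVGG.besselTerm (((n : ℝ) - 2) / 2) μ S z w u) (WVGG.posOrthant n) U ∧
        HasDerivAt (WVGG.fH μ S U z)
          ((WVGG.cConst n : ℂ) * (∫ u in WVGG.posOrthant n, (WVGG.fE μ S z u : ℂ)
              * WVGG.besselTerm ((n : ℝ) / 2) μ S z w u ∂U)
            - (WVGG.cConst n : ℂ) * w * (∫ u in WVGG.posOrthant n, (WVGG.fA μ S z u : ℂ) ^ 2
              * WVGG.besselTerm (((n : ℝ) - 2) / 2) μ S z w u ∂U)) w)) ∧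
    -- the right-hand limit of the derivative at the origin
    ((∫⁻ u in WVGG.posOrthant n,
        ENNReal.ofReal (WVGG.fA μ S z u / WVGG.fD S z u) ∂U) < ∞ →
      (∫⁻ u in WVGG.posOrthant n,
        ENNReal.ofReal (|WVGG.fE μ S z u| / WVGG.fD S z u) ∂U) < ∞ ∧
      Tendsto (fun r : ℝ => deriv (fun x : ℝ => WVGG.fH μ S U z (x : ℂ)) r) (𝓝[>] (0 : ℝ))
        (𝓝 ((WVGG.cConst n * (2 : ℝ) ^ (((n : ℝ) - 2) / 2) * Real.Gamma ((n : ℝ) / 2)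
          * ∫ u in WVGG.posOrthant n, WVGG.fE μ S z u / WVGG.fD S z u ∂U : ℝ) : ℂ))) ∧
    -- the Lévy measure in Euclidean polar coordinates
    (∀ A : Set (EuclideanSpace ℝ (Fin n)), MeasurableSet A → A ⊆ WVGG.nonzeroCoords n →
      ν A = ∫⁻ s in {s : Metric.sphere (0 : EuclideanSpace ℝ (Fin n)) 1 |
            (s : EuclideanSpace ℝ (Fin n)) ∈ WVGG.nonzeroCoords n},
          (∫⁻ r in Ioi (0 : ℝ),
            A.indicator (fun _ => ENNReal.ofReal ((WVGG.fH μ S U s (r : ℂ)).re / r))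
              (r • (s : EuclideanSpace ℝ (Fin n))))
          ∂((volume : Measure (EuclideanSpace ℝ (Fin n))).toSphere)) := by
  obtain ⟨Ω₁, _, P₁, B, Ω₂, _, P₂, T, hT, hB, d₁, τ, ν', hτ, hν', hX'⟩ := hX
  obtain ⟨b, Q, hXν⟩ := hν
  have hU := hT.isThorinMeasure
  have hSpos : S.PosDef := hB.posSemidef.posDef_iff_det_ne_zero.2 hS
  refine ⟨⟨fun w hw => WVGG.integrableOn_besselTerm hn μ hSpos hz hU hw,
    fun w hw => (WVGG.hasDerivAt_fH hn μ hSpos hz hU hw).differentiableAt.differentiableWithinAt,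
    fun r hr => WVGG.fH_ofReal_im_re (by omega) μ hSpos hz U hr,
    fun w hw => ⟨WVGG.integrableOn_fE_mul_besselTerm hn μ hSpos hz hU hw,
      WVGG.integrableOn_fA_sq_mul_besselTerm hn μ hSpos hz hU hw,
      WVGG.hasDerivAt_fH hn μ hSpos hz hU hw⟩⟩,
    fun hfin => ⟨(WVGG.lintegral_fE_div_fD_le μ hSpos hz U).trans_lt hfin,
      WVGG.tendsto_deriv_fH hn μ hSpos hz hU hfin⟩, fun A hA hA' => ?_⟩
  have h0 : (0 : EuclideanSpace ℝ (Fin n)) ∉ A := fun h => hA' h ⟨0, by omega⟩ rfl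
  rw [hXν.levyMeasure_unique hX', hν' A hA h0, WVGG.levyMeasure_eq_thorinLevyMeasure hT hτ,
    WVGG.lintegral_map_atTimes_apply hB hSpos hU hA hA',
    WVGG.setLIntegral_levyDensity hn μ hSpos hU hA hA']
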